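/- Fix countably infinite sets of variables and of constants ($\mathbf{Dom}$), a finite schema $\Sigma$ of extensional predicates with arities, and an infinite supply of intensional predicates of each arity. A *semi-positive datalog rule* has the form $S(\bar x) \mathrel{:-} \alpha_1,\dots,\alpha_n$, where $S$ is intensional, $\bar x$ is a tuple of variables, and each $\alpha_i$ is a positive literal (an extensional atom, an intensional atom, or an equality $s=t$ of terms), a negated extensional atom, or an inequality $s\neq t$; rules are *safe*: every variable of the rule occurs in a positive literal of its body. An *sp-Datalog program* $P$ is a finite sequence of such rules with a designated intensional answer predicate, such that every intensional predicate occurring in a body also occurs in a head; it is a *Datalog program* if all its body literals are positive. An *instance* is a finite set of extensional facts, and $P(\mathbf I)$ denotes the set of tuples over $\mathbf{Dom}$ in the answer predicate under the least fixpoint semantics (assignments take values in $\mathbf{Dom}$). An *update* of an instance $\mathbf I$ is a pair $\mathsf U=(\mathsf{Ins},\mathsf{Del})$ of finite sets of facts with $\mathsf{Ins}\cap\mathbf I=\emptyset$ and $\mathsf{Del}\subseteq\mathbf I$; its size is $|\mathsf{Ins}\cup\mathsf{Del}|$ and $\mathbf I_{\mathsf U}=(\mathbf I\cup\mathsf{Ins})\setminus\mathsf{Del}$.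 It is a *repair* with respect to $\langle P,\mathbf I,\bar a\rangle$ if $\bar a\in P(\mathbf I_{\mathsf U})$. For a class $\mathcal L$ of programs over $\Sigma$, $\mathrm{MA}_{\min}^{\mathcal L}$ is the following function problem: given $P\in\mathcal L$, an instance $\mathbf I$ and a tuple $\bar a$ of constants whose length is the arity of the answer predicate of $P$ (constants, variables and predicate indices being written in binary), compute a repair of minimum size with respect to $\langle P,\mathbf I,\bar a\rangle$, or indicate that no repair exists. **Theorem.** For every fixed finite schema $\Sigma$, $\mathrm{MA}_{\min}^{\mathrm{Datalog}}$ is in $\mathrm{FEXP}$ and $\mathrm{MA}_{\min}^{\mathrm{sp\text{-}Datalog}}$ is in $\mathrm{F2EXP}$; that is, they are solved by deterministic Turing machines running in time $2^{p(n)}$ and $2^{2^{p(n)}}$ respectively, where $n$ is the length of the input and $p$ is a polynomial (which may depend on $\Sigma$). -/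

import Mathlib

/-! ## Semi-positive Datalog

Constants and variables are natural numbers (two countably infinite sets, kept apart by `Term`). -/

/-- A finite schema of extensional predicates `0, …, n - 1`, each with an arity. -/
structure Schema where
  n : ℕ
  arity : Fin n → ℕ

/-- Intensional predicate symbols: infinitely many of each arity. -/
structure IDB where
  arity : ℕ
  idx : ℕ
  deriving DecidableEq

inductive Term where
  | var (x : ℕ)
  | const (c : ℕ)
  deriving DecidableEq

/-- The value of a term under an assignment `g` of constants to variables. -/
def Term.eval (g : ℕ → ℕ) : Term → ℕ
  | .var x => g x
  | .const c => c

/-- The literals that may occur in the body of a semi-positive rule. -/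
inductive Literal (σ : Schema) where
  /-- `R(t₁, …, t_k)`, extensional -/
  | edb (R : Fin σ.n) (t : Fin (σ.arity R) → Term)
  /-- `S(t₁, …, t_k)`, intensional -/
  | idb (S : IDB) (t : Fin S.arity → Term)
  /-- `s = t` -/
  | eq (s t : Term)
  /-- `¬ R(t₁, …, t_k)`, extensional -/
  | negEdb (R : Fin σ.n) (t : Fin (σ.arity R) → Term)
  /-- `s ≠ t` -/
  | neq (s t : Term)

/-- Positive literals: extensional atoms, intensional atoms and equalities. -/
def Literal.IsPositive {σ : Schema} : Literal σ → Prop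
  | .edb _ _ => True
  | .idb _ _ => True
  | .eq _ _ => True
  | .negEdb _ _ => False
  | .neq _ _ => False

/-- The variable `x` occurs in the literal. -/
def Literal.HasVar {σ : Schema} (x : ℕ) : Literal σ → Prop
  | .edb _ t => ∃ i, t i = .var x
  | .idb _ t => ∃ i, t i = .var x
  | .eq s t => s = .var x ∨ t = .var x
  | .negEdb _ t => ∃ i, t i = .var x
  | .neq s t => s = .var x ∨ t = .var x

/-- A rule `S(x̄) :- α₁, …, αₙ`; the arguments of the head are variables. -/
structure Rule (σ : Schema) where
  head : IDB
  headVars : Fin head.arity → ℕ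
  body : List (Literal σ)

/-- The variable `x` occurs in the rule. -/
def Rule.HasVar {σ : Schema} (r : Rule σ) (x : ℕ) : Prop :=
  (∃ i, r.headVars i = x) ∨ ∃ l ∈ r.body, l.HasVar x

/-- Every variable of the rule occurs in some positive literal of the body. -/
def Rule.Safe {σ : Schema} (r : Rule σ) : Prop :=
  ∀ x, r.HasVar x → ∃ l ∈ r.body, l.IsPositive ∧ l.HasVar x

/-- A finite sequence of rules with a designated answer predicate. -/
structure Program (σ : Schema) where
  rules : List (Rule σ)
  ans : IDB

/-- The class of semi-positive Datalog programs: all rules are safe, and every intensional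
predicate occurring in a body also occurs in a head. -/
def spDatalog (σ : Schema) : Set (Program σ) :=
  {P | (∀ r ∈ P.rules, r.Safe) ∧
    ∀ r ∈ P.rules, ∀ S t, Literal.idb S t ∈ r.body → ∃ r' ∈ P.rules, r'.head = S}

/-- The class of Datalog programs: those semi-positive programs all of whose literals are
positive. -/
def Datalog (σ : Schema) : Set (Program σ) :=
  {P | P ∈ spDatalog σ ∧ ∀ r ∈ P.rules, ∀ l ∈ r.body, l.IsPositive}

/-- A fact `R(c₁, …, c_k)`, for an extensional predicate `R` and constants `cᵢ`. -/
structure DBFact (σ : Schema) where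
  rel : Fin σ.n
  args : Fin (σ.arity rel) → ℕ
  deriving DecidableEq

/-- A database instance is a finite set of facts. -/
abbrev Instance (σ : Schema) := Finset (DBFact σ)

/-- A non-intensional literal is true in the instance `I` under the assignment `g`
(no condition is imposed on intensional literals). -/
def Literal.HoldsEDB {σ : Schema} (I : Instance σ) (g : ℕ → ℕ) : Literal σ → Prop
  | .edb R t => (⟨R, fun i => (t i).eval g⟩ : DBFact σ) ∈ I
  | .idb _ _ => True
  | .eq s t => s.eval g = t.eval g
  | .negEdb R t => (⟨R, fun i => (t i).eval g⟩ : DBFact σ) ∉ I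
  | .neq s t => s.eval g ≠ t.eval g

/-- Least fixpoint semantics: `Derives P I S a` says that `S(a)` belongs to the least family of
intensional relations that is closed under the rules of `P` over the instance `I`. -/
inductive Derives {σ : Schema} (P : Program σ) (I : Instance σ) :
    (S : IDB) → (Fin S.arity → ℕ) → Prop where
  | rule (r : Rule σ) (hr : r ∈ P.rules) (g : ℕ → ℕ)
      (hE : ∀ l ∈ r.body, l.HoldsEDB I g)
      (hI : ∀ (S : IDB) (t : Fin S.arity → Term), Literal.idb S t ∈ r.body →
        Derives P I S (fun i => (t i).eval g)) :
      Derives P I r.head (fun i => g (r.headVars i))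

/-- The answer `P(I)`. -/
def Program.answer {σ : Schema} (P : Program σ) (I : Instance σ) :
    Set (Fin P.ans.arity → ℕ) :=
  {a | Derives P I P.ans a}

/-! ## Updates and repairs -/

/-- A pair of finite sets of facts, to be inserted and deleted. -/
structure Update (σ : Schema) where
  ins : Finset (DBFact σ)
  del : Finset (DBFact σ)

/-- `U` is an update for `I`: the inserted facts are new, the deleted ones are in `I`. -/
def Update.IsUpdateFor {σ : Schema} (U : Update σ) (I : Instance σ) : Prop :=
  Disjoint U.ins I ∧ U.del ⊆ I

/-- The updated instance. -/
def Update.apply {σ : Schema} (U : Update σ) (I : Instance σ) : Instance σ :=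
  (I ∪ U.ins) \ U.del

def Update.size {σ : Schema} (U : Update σ) : ℕ :=
  (U.ins ∪ U.del).card

/-- `U` is a repair with respect to `⟨P, I, a⟩`. -/
def IsRepair {σ : Schema} (P : Program σ) (I : Instance σ) (a : Fin P.ans.arity → ℕ)
    (U : Update σ) : Prop :=
  U.IsUpdateFor I ∧ a ∈ P.answer (U.apply I)

/-- `U` is a repair of minimum cardinality with respect to `⟨P, I, a⟩`. -/
def IsMinRepair {σ : Schema} (P : Program σ) (I : Instance σ) (a : Fin P.ans.arity → ℕ)
    (U : Update σ) : Prop :=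
  IsRepair P I a U ∧ ∀ U' : Update σ, IsRepair P I a U' → U.size ≤ U'.size

/-! ## Function problems and the classes FEXP and F2EXP -/

/-- A function (search) problem: given `x : Input`, compute some `y : Output` with `Sol x y`.
Inputs and outputs are written as strings over finite alphabets. -/
structure FunctionProblem where
  Input : Type
  Output : Type
  ΓIn : Type
  ΓOut : Type
  finIn : Fintype ΓIn
  finOut : Fintype ΓOut
  encIn : Input → List ΓIn
  encOut : Output → List ΓOut
  encIn_injective : Function.Injective encIn
  encOut_injective : Function.Injective encOut
  Sol : Input → Output → Prop

/-- Some deterministic (multi-stack) Turing machine solves the problem and halts within `T n` steps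
on all inputs whose encoding has length `n`. -/
def FunctionProblem.SolvableInTime (Q : FunctionProblem) (T : ℕ → ℕ) : Prop :=
  ∃ f : Q.Input → Q.Output, (∀ x, Q.Sol x (f x)) ∧
    ∃ c : Turing.TM2ComputableInTime Q.encIn Q.encOut f, ∀ n, c.time n ≤ T n

/-- Function problems solvable in time `2 ^ poly(n)`. -/
def FEXP : Set FunctionProblem :=
  {Q | ∃ p : Polynomial ℕ, Q.SolvableInTime fun n => 2 ^ p.eval n}

/-- Function problems solvable in time `2 ^ 2 ^ poly(n)`. -/
def F2EXP : Set FunctionProblem :=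
  {Q | ∃ p : Polynomial ℕ, Q.SolvableInTime fun n => 2 ^ 2 ^ p.eval n}

/-! ## Encodings

Everything is written over the six-letter alphabet `Computability.Γ'`. Numbers are written in
binary, and every code below is a prefix code, so that concatenations can be decoded. -/

namespace Enc

open Computability

def nat (n : ℕ) : List Γ' := (encodeNat n).map Γ'.bit ++ [Γ'.comma]

def list {α : Type} (f : α → List Γ') : List α → List Γ'
  | [] => [Γ'.ket]
  | a :: l => Γ'.bra :: (f a ++ list f l)

def tuple {α : Type} (f : α → List Γ') {k : ℕ} (t : Fin k → α) : List Γ' :=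
  list f (List.ofFn t)

def term : Term → List Γ'
  | .var x => nat 0 ++ nat x
  | .const c => nat 1 ++ nat c

/-- The arity of an intensional symbol can be read off from the list of its arguments. -/
def literal {σ : Schema} : Literal σ → List Γ'
  | .edb R t => nat 0 ++ (nat R ++ tuple term t)
  | .idb S t => nat 1 ++ (nat S.idx ++ tuple term t)
  | .eq s t => nat 2 ++ (term s ++ term t)
  | .negEdb R t => nat 3 ++ (nat R ++ tuple term t)
  | .neq s t => nat 4 ++ (term s ++ term t)

def rule {σ : Schema} (r : Rule σ) : List Γ' :=
  nat r.head.idx ++ (tuple nat r.headVars ++ list literal r.body)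

def program {σ : Schema} (P : Program σ) : List Γ' :=
  list rule P.rules ++ (nat P.ans.arity ++ nat P.ans.idx)

def fact {σ : Schema} (F : DBFact σ) : List Γ' :=
  nat F.rel ++ tuple nat F.args

/-- Prefix codes. -/
def IsPrefixCode {α : Type} (f : α → List Γ') : Prop :=
  ∀ ⦃x y : α⦄ ⦃u v : List Γ'⦄, f x ++ u = f y ++ v → x = y ∧ u = v

theorem IsPrefixCode.injective {α : Type} {f : α → List Γ'} (hf : IsPrefixCode f) :
    Function.Injective f := by
  intro x y h
  exact (hf (u := []) (v := []) (by rw [h])).1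

theorem isPrefixCode_nat : IsPrefixCode nat := by
  have key : ∀ (a b : List Bool) (u v : List Γ'),
      a.map Γ'.bit ++ (Γ'.comma :: u) = b.map Γ'.bit ++ (Γ'.comma :: v) → a = b ∧ u = v := by
    intro a
    induction a with
    | nil =>
      intro b u v h
      cases b <;> simp_all
    | cons x a ih =>
      intro b u v h
      cases b with
      | nil => simp at h
      | cons y b =>
        simp only [List.map_cons, List.cons_append, List.cons.injEq, Γ'.bit.injEq] at h
        obtain ⟨h1, h2⟩ := ih b u v h.2
        exact ⟨by rw [h.1, h1], h2⟩
  intro x y u v h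
  simp only [nat, List.append_assoc, List.singleton_append] at h
  obtain ⟨h1, h2⟩ := key _ _ _ _ h
  exact ⟨encodingNatBool.encode_injective h1, h2⟩

theorem isPrefixCode_list {α : Type} {f : α → List Γ'} (hf : IsPrefixCode f) :
    IsPrefixCode (list f) := by
  intro a
  induction a with
  | nil =>
    intro b u v h
    cases b <;> simp_all [list]
  | cons x a ih =>
    intro b u v h
    cases b with
    | nil => simp [list] at h
    | cons y b =>
      simp only [list, List.cons_append, List.append_assoc, List.cons.injEq, true_and] at h
      obtain ⟨h1, h2⟩ := hf h
      obtain ⟨h3, h4⟩ := ih h2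
      exact ⟨by rw [h1, h3], h4⟩

theorem tuple_inj {α : Type} {f : α → List Γ'} (hf : IsPrefixCode f) {k : ℕ} {s t : Fin k → α}
    {u v : List Γ'} (h : tuple f s ++ u = tuple f t ++ v) : s = t ∧ u = v := by
  obtain ⟨h1, h2⟩ := isPrefixCode_list hf h
  exact ⟨List.ofFn_injective h1, h2⟩

theorem tuple_length {α : Type} {f : α → List Γ'} (hf : IsPrefixCode f) {k m : ℕ} {s : Fin k → α}
    {t : Fin m → α} {u v : List Γ'} (h : tuple f s ++ u = tuple f t ++ v) : k = m := by
  obtain ⟨h1, -⟩ := isPrefixCode_list hf h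
  simpa using congrArg List.length h1

theorem isPrefixCode_term : IsPrefixCode term := by
  intro x y u v h
  cases x <;> cases y <;> simp only [term, List.append_assoc] at h <;>
    obtain ⟨h1, h2⟩ := isPrefixCode_nat h <;> first | (exact absurd h1 (by decide)) | skip
  all_goals
    obtain ⟨h3, h4⟩ := isPrefixCode_nat h2
    exact ⟨by rw [h3], h4⟩

theorem isPrefixCode_literal {σ : Schema} : IsPrefixCode (literal (σ := σ)) := by
  intro x y u v h
  cases x <;> cases y <;> simp only [literal, List.append_assoc] at h <;>
    obtain ⟨h1, h2⟩ := isPrefixCode_nat h <;> first | (exact absurd h1 (by decide)) | skip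
  · rename_i R t R' t'
    obtain ⟨h3, h4⟩ := isPrefixCode_nat h2
    obtain rfl := Fin.ext h3
    obtain ⟨rfl, h6⟩ := tuple_inj isPrefixCode_term h4
    exact ⟨rfl, h6⟩
  · rename_i S t S' t'
    obtain ⟨h3, h4⟩ := isPrefixCode_nat h2
    have h5 := tuple_length isPrefixCode_term h4
    obtain ⟨k, i⟩ := S
    obtain ⟨k', i'⟩ := S'
    dsimp only at h3 h5 h4 t t'
    subst h3 h5
    obtain ⟨rfl, h6⟩ := tuple_inj isPrefixCode_term h4
    exact ⟨rfl, h6⟩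
  · obtain ⟨rfl, h4⟩ := isPrefixCode_term h2
    obtain ⟨rfl, h5⟩ := isPrefixCode_term h4
    exact ⟨rfl, h5⟩
  · rename_i R t R' t'
    obtain ⟨h3, h4⟩ := isPrefixCode_nat h2
    obtain rfl := Fin.ext h3
    obtain ⟨rfl, h6⟩ := tuple_inj isPrefixCode_term h4
    exact ⟨rfl, h6⟩
  · obtain ⟨rfl, h4⟩ := isPrefixCode_term h2
    obtain ⟨rfl, h5⟩ := isPrefixCode_term h4
    exact ⟨rfl, h5⟩

theorem isPrefixCode_rule {σ : Schema} : IsPrefixCode (rule (σ := σ)) := by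
  rintro ⟨⟨k, i⟩, x, b⟩ ⟨⟨k', i'⟩, x', b'⟩ u v h
  simp only [rule, List.append_assoc] at h
  obtain ⟨h1, h2⟩ := isPrefixCode_nat h
  have h3 := tuple_length isPrefixCode_nat h2
  dsimp only at h1 h3 x x'
  subst h1 h3
  obtain ⟨rfl, h4⟩ := tuple_inj isPrefixCode_nat h2
  obtain ⟨rfl, h5⟩ := isPrefixCode_list isPrefixCode_literal h4
  exact ⟨rfl, h5⟩

theorem isPrefixCode_program {σ : Schema} : IsPrefixCode (program (σ := σ)) := by
  rintro ⟨r, ⟨k, i⟩⟩ ⟨r', ⟨k', i'⟩⟩ u v h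
  simp only [program, List.append_assoc] at h
  obtain ⟨rfl, h1⟩ := isPrefixCode_list isPrefixCode_rule h
  obtain ⟨rfl, h2⟩ := isPrefixCode_nat h1
  obtain ⟨rfl, h3⟩ := isPrefixCode_nat h2
  exact ⟨rfl, h3⟩

theorem isPrefixCode_fact {σ : Schema} : IsPrefixCode (fact (σ := σ)) := by
  rintro ⟨R, t⟩ ⟨R', t'⟩ u v h
  simp only [fact, List.append_assoc] at h
  obtain ⟨h1, h2⟩ := isPrefixCode_nat h
  obtain rfl := Fin.ext h1
  obtain ⟨rfl, h3⟩ := tuple_inj isPrefixCode_nat h2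
  exact ⟨rfl, h3⟩

end Enc

/-! ## The missing answer repair problem -/

/-- An input `⟨P, I, a⟩` with `P` in the class `L`. The instance is presented by a list of its
facts, in any order. -/
structure MAInput {σ : Schema} (L : Set (Program σ)) where
  prog : Program σ
  mem : prog ∈ L
  facts : List (DBFact σ)
  tup : Fin prog.ans.arity → ℕ

def MAInput.inst {σ : Schema} {L : Set (Program σ)} (x : MAInput L) : Instance σ :=
  x.facts.toFinset

def MAInput.encode {σ : Schema} {L : Set (Program σ)} (x : MAInput L) :
    List Computability.Γ' :=
  Enc.program x.prog ++ (Enc.list Enc.fact x.facts ++ Enc.tuple Enc.nat x.tup)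

theorem MAInput.encode_injective {σ : Schema} {L : Set (Program σ)} :
    Function.Injective (MAInput.encode (L := L)) := by
  rintro ⟨P, hP, l, a⟩ ⟨P', hP', l', a'⟩ h
  simp only [MAInput.encode] at h
  obtain ⟨rfl, h1⟩ := Enc.isPrefixCode_program h
  obtain ⟨rfl, h2⟩ := Enc.isPrefixCode_list Enc.isPrefixCode_fact h1
  obtain ⟨rfl, -⟩ := Enc.tuple_inj (s := a) (t := a') (u := []) (v := []) Enc.isPrefixCode_nat
    (by rw [h2])
  rfl

/-- An output: the lists of facts to insert and to delete, or `none`, which stands for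
"no repair exists". -/
abbrev MAOutput (σ : Schema) := Option (List (DBFact σ) × List (DBFact σ))

def MAOutput.encode {σ : Schema} : MAOutput σ → List Computability.Γ'
  | none => []
  | some (i, d) => Enc.list Enc.fact i ++ Enc.list Enc.fact d

theorem MAOutput.encode_injective {σ : Schema} :
    Function.Injective (MAOutput.encode (σ := σ)) := by
  have ne : ∀ l : List (DBFact σ), Enc.list Enc.fact l ≠ [] := by
    intro l; cases l <;> simp [Enc.list]
  rintro (_ | ⟨i, d⟩) (_ | ⟨i', d'⟩) h
  · rfl
  · exact absurd h.symm (by simp [MAOutput.encode, ne])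
  · exact absurd h (by simp [MAOutput.encode, ne])
  · obtain ⟨rfl, h1⟩ := Enc.isPrefixCode_list Enc.isPrefixCode_fact h
    obtain rfl := (Enc.isPrefixCode_list Enc.isPrefixCode_fact).injective h1
    rfl

/-- `y` answers the input `x`: it is a minimum-cardinality repair, or it says, correctly, that there
is no repair. -/
def MAOutput.IsSolution {σ : Schema} {L : Set (Program σ)} (x : MAInput L) : MAOutput σ → Prop
  | some (i, d) => IsMinRepair x.prog x.inst x.tup ⟨i.toFinset, d.toFinset⟩
  | none => ¬ ∃ U, IsRepair x.prog x.inst x.tup U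

/-- The missing answer repair problem (combined complexity) for the class `L` of programs. -/
def MAmin {σ : Schema} (L : Set (Program σ)) : FunctionProblem where
  Input := MAInput L
  Output := MAOutput σ
  ΓIn := Computability.Γ'
  ΓOut := Computability.Γ'
  finIn := inferInstance
  finOut := inferInstance
  encIn := MAInput.encode
  encOut := MAOutput.encode
  encIn_injective := MAInput.encode_injective
  encOut_injective := MAOutput.encode_injective
  Sol := MAOutput.IsSolution

/-! ## A structured programming language for stack machines -/

/-! The algorithm is exhaustive search. A finite set `D` of constants is fixed. All instances over
`D` are listed, those from which the goal is derivable are kept by computing a least fixpoint, and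
one that differs least from the given instance is returned. A repair of minimum size deletes nothing
it need not and inserts nothing it need not, so updates correspond to target instances, and the size
of an update becomes that of a symmetric difference. Since the schema is fixed, there are
polynomially many facts over `D`, hence `2 ^ poly |D|` candidates; a fixpoint costs a polynomial in
the number `|D| ^ |V|` of assignments. So `solve` runs in time `2 ^ poly` in the combined size of
the input and `D` (`pt_solve`), and it is correct as soon as every repair can be matched by one over
`D` that is no larger (`solve_correct`). What remains is to bound `D`.

For Datalog the numbers of the input suffice. The map that sends every other constant to `0` is a
homomorphism fixing the input; positive derivations survive it (`Derives.map`), and it does not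
increase the number of inserted facts.

With negation and inequalities only injective renamings are harmless. An instance `J` can still be
renamed into `D` when `D` has room for the constants of `J` together with one value for each
variable of a rule (`Derives.rename`, `Derives.exists_over`). It is therefore enough to bound the
instance reached by some repair that is no larger than a given one. If the repair is small, so is
the instance it leads to. If it is large, it can be replaced by an update to any small instance that
yields the tuple, and such an instance exists by a small model property (`Derives.exists_small`).

For the small model, each node of a derivation tree is described by its atom and by the facts about
the constants it sees, over a fixed set `X` of `|C| + |V|` colours (`Realizable`). There are only `2
^ poly` such types. One witness of least rank is chosen for each realizable type, and the tree is
rebuilt with constants named by pairs of a type and a colour (`Realizable.exists_small`). Ranks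
decrease strictly along branches, so the new constants of a node have smaller rank than the
inherited ones, and a fact can be decided by the type of least rank among its constants. Thus
exponentially many constants suffice, and the search over them is doubly exponential.

The time bounds are proved for actual machines: structured stack programs are compiled to `TM2`
machines, values are trees in prefix code on one stack, and polynomial time is shown to be closed
under the usual list operations. -/

namespace StackProg

open Computability Turing

/-- The stacks of the machine: one for input and output, one holding values, and three auxiliary
ones. -/
inductive Stk where
  | io | main | auxL | auxR | cnt
  deriving DecidableEq

instance : Fintype Stk :=
  ⟨{.io, .main, .auxL, .auxR, .cnt}, fun k => by cases k <;> decide⟩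

/-- Structured programs. The state of the machine is the symbol that was popped last. -/
inductive Cmd where
  | skip
  | push (k : Stk) (a : Γ')
  /-- push the current symbol -/
  | copy (k : Stk)
  | pop (k : Stk)
  | seq (c d : Cmd)
  | ite (p : Option Γ' → Bool) (c d : Cmd)
  | loop (p : Option Γ' → Bool) (c : Cmd)

/-- The memory of the machine. -/
structure Mem where
  sym : Option Γ'
  stk : Stk → List Γ'

/-- `Runs c s s' n`: started in `s`, the program `c` ends in `s'` after `n` steps. -/
inductive Runs : Cmd → Mem → Mem → ℕ → Prop
  | skip (s) : Runs .skip s s 1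
  | push (k a v S) : Runs (.push k a) ⟨v, S⟩ ⟨v, Function.update S k (a :: S k)⟩ 1
  | copy (k v S) :
      Runs (.copy k) ⟨v, S⟩ ⟨v, Function.update S k (v.getD Γ'.blank :: S k)⟩ 1
  | pop (k v S) : Runs (.pop k) ⟨v, S⟩ ⟨(S k).head?, Function.update S k (S k).tail⟩ 1
  | seq {c d s s' s'' n m} : Runs c s s' n → Runs d s' s'' m → Runs (.seq c d) s s'' (n + m)
  | iteT {p c d s s' n} : p s.sym = true → Runs c s s' n → Runs (.ite p c d) s s' (n + 1)
  | iteF {p c d s s' n} : p s.sym = false → Runs d s s' n → Runs (.ite p c d) s s' (n + 1)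
  | loopF {p c s} : p s.sym = false → Runs (.loop p c) s s 1
  | loopT {p c s s' s'' n m} : p s.sym = true → Runs c s s' n → Runs (.loop p c) s' s'' m →
      Runs (.loop p c) s s'' (m + (n + 1))

namespace Cmd

/-- The labels of the machine that executes a program. -/
def Lab : Cmd → Type
  | skip => Unit
  | push _ _ => Unit
  | copy _ => Unit
  | pop _ => Unit
  | seq c d => c.Lab ⊕ d.Lab
  | ite _ c d => Option (c.Lab ⊕ d.Lab)
  | loop _ c => Option c.Lab

instance fintypeLab : (c : Cmd) → Fintype c.Lab
  | skip => inferInstanceAs (Fintype Unit)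
  | push _ _ => inferInstanceAs (Fintype Unit)
  | copy _ => inferInstanceAs (Fintype Unit)
  | pop _ => inferInstanceAs (Fintype Unit)
  | seq c d =>
    haveI := fintypeLab c; haveI := fintypeLab d; inferInstanceAs (Fintype (c.Lab ⊕ d.Lab))
  | ite _ c d =>
    haveI := fintypeLab c; haveI := fintypeLab d
    inferInstanceAs (Fintype (Option (c.Lab ⊕ d.Lab)))
  | loop _ c => haveI := fintypeLab c; inferInstanceAs (Fintype (Option c.Lab))

def entry : (c : Cmd) → c.Lab
  | skip => ()
  | push _ _ => ()
  | copy _ => ()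
  | pop _ => ()
  | seq c _ => Sum.inl c.entry
  | ite _ _ _ => none
  | loop _ _ => none

/-- The statement attached to a label, for a program whose labels are embedded by `emb` in those of
a larger program, which is to continue at `exit`. -/
def code {L : Type} : (c : Cmd) → (emb : c.Lab → L) → (exit : L) → c.Lab →
    TM2.Stmt (fun _ : Stk => Γ') L (Option Γ')
  | skip, _, exit, _ => .goto fun _ => exit
  | push k a, _, exit, _ => .push k (fun _ => a) (.goto fun _ => exit)
  | copy k, _, exit, _ => .push k (fun v => v.getD Γ'.blank) (.goto fun _ => exit)
  | pop k, _, exit, _ => .pop k (fun _ a => a) (.goto fun _ => exit)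
  | seq c d, emb, _, Sum.inl l => c.code (fun l => emb (Sum.inl l)) (emb (Sum.inr d.entry)) l
  | seq _ d, emb, exit, Sum.inr l => d.code (fun l => emb (Sum.inr l)) exit l
  | ite p c d, emb, _, none =>
    .branch p (.goto fun _ => emb (some (Sum.inl c.entry)))
      (.goto fun _ => emb (some (Sum.inr d.entry)))
  | ite _ c _, emb, exit, some (Sum.inl l) => c.code (fun l => emb (some (Sum.inl l))) exit l
  | ite _ _ d, emb, exit, some (Sum.inr l) => d.code (fun l => emb (some (Sum.inr l))) exit l
  | loop p c, emb, exit, none =>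
    .branch p (.goto fun _ => emb (some c.entry)) (.goto fun _ => exit)
  | loop _ c, emb, _, some l => c.code (fun l => emb (some l)) (emb none) l

end Cmd

/-- The configuration of the stack machine with label `l` and memory `s`. -/
def Mem.cfg {L : Type} (s : Mem) (l : L) : TM2.Cfg (fun _ : Stk => Γ') L (Option Γ') :=
  ⟨some l, s.sym, s.stk⟩

/-- The compiled code is simulated step for step. The embedding of labels and the exit label are
arbitrary, because the code of a subprogram sits inside that of a larger program and continues where
the larger one says. -/
theorem Runs.iterate_step {L : Type} {M : L → TM2.Stmt (fun _ : Stk => Γ') L (Option Γ')}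
    {c : Cmd} {s s' : Mem} {n : ℕ} (h : Runs c s s' n) {emb : c.Lab → L} {exit : L}
    (hM : ∀ l, M (emb l) = c.code emb exit l) :
    (flip bind (TM2.step M))^[n] (some (s.cfg (emb c.entry))) = some (s'.cfg exit) := by
  have branch_step : ∀ (l l₁ l₂ : L) (p : Option Γ' → Bool) (s : Mem),
      M l = .branch p (.goto fun _ => l₁) (.goto fun _ => l₂) →
      flip bind (TM2.step M) (some (s.cfg l)) = some (s.cfg (cond (p s.sym) l₁ l₂)) := by
    intro l l₁ l₂ p s hl
    cases hp : p s.sym <;> simp [flip, Mem.cfg, hl, hp]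
  induction h generalizing exit with
  | skip | push | copy | pop =>
    simp [flip, Mem.cfg, hM, Cmd.code]
  | @seq c d s s' s'' n m _ _ ih₁ ih₂ =>
    -- An iterate of a sum applies the second summand first, so the steps of `c` have to stand on
    -- the right; the count in `Runs.loopT` is already written in this order.
    rw [Nat.add_comm, Function.iterate_add_apply]
    have h₁ := ih₁ (emb := fun l => emb (Sum.inl l)) (exit := emb (Sum.inr d.entry))
      (fun l => hM _)
    have h₂ := ih₂ (emb := fun l => emb (Sum.inr l)) (exit := exit) (fun l => hM _)
    rw [← h₂, ← h₁]
    rfl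
  | @iteT p c d s s' n hp _ ih =>
    rw [Function.iterate_succ_apply]
    have h := branch_step (emb none) (emb (some (Sum.inl c.entry))) (emb (some (Sum.inr d.entry)))
      p s (hM _)
    rw [hp] at h
    have h₁ := ih (emb := fun l => emb (some (Sum.inl l))) (exit := exit)
      (fun l => hM _)
    rw [← h₁]
    exact congrArg _ h
  | @iteF p c d s s' n hp _ ih =>
    rw [Function.iterate_succ_apply]
    have h := branch_step (emb none) (emb (some (Sum.inl c.entry))) (emb (some (Sum.inr d.entry)))
      p s (hM _)
    rw [hp] at h
    have h₁ := ih (emb := fun l => emb (some (Sum.inr l))) (exit := exit)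
      (fun l => hM _)
    rw [← h₁]
    exact congrArg _ h
  | @loopF p c s hp =>
    have h := branch_step (emb none) (emb (some c.entry)) exit p s (hM _)
    rw [hp] at h
    exact h
  | @loopT p c s s' s'' n m hp _ _ ih₁ ih₂ =>
    rw [Function.iterate_add_apply, Function.iterate_succ_apply]
    have h := branch_step (emb none) (emb (some c.entry)) exit p s (hM _)
    rw [hp] at h
    have h₁ := ih₁ (emb := fun l => emb (some l)) (exit := emb none) (fun l => hM _)
    rw [← ih₂ hM]
    refine congrArg _ (Eq.trans ?_ h₁)
    exact congrArg _ h

/-- The machine that executes a program and halts. -/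
def Cmd.machine (c : Cmd) : FinTM2 where
  K := Stk
  k₀ := .io
  k₁ := .io
  Γ _ := Γ'
  Λ := Option c.Lab
  main := some c.entry
  σ := Option Γ'
  initialState := none
  Γk₀Fin := inferInstanceAs (Fintype Γ')
  m l := l.elim .halt (c.code some none)

/-- The memory that contains just a word on the input and output stack. -/
def Mem.word (w : List Γ') : Mem := ⟨none, fun k => if k = .io then w else []⟩

/-- A program that computes `f` yields a machine that computes `f`. -/
theorem Cmd.computableInTime {α β : Type} {ea : α → List Γ'} {eb : β → List Γ'} {f : α → β}
    (c : Cmd) (T : ℕ → ℕ)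
    (h : ∀ a, ∃ n ≤ T (ea a).length, Runs c (Mem.word (ea a)) (Mem.word (eb (f a))) n) :
    ∃ M : TM2ComputableInTime ea eb f, ∀ n, M.time n = T n + 1 := by
  choose n hn hr using h
  -- The additional step executes the `halt` statement at the exit label.
  refine ⟨⟨⟨c.machine, Equiv.refl _, Equiv.refl _⟩, fun n => T n + 1, fun a => ⟨⟨n a + 1, ?_⟩, ?_⟩⟩,
    fun _ => rfl⟩
  · have h₁ := (hr a).iterate_step (M := c.machine.m) (emb := some) (exit := none) (fun _ => rfl)
    rw [Nat.add_comm, Function.iterate_add_apply]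
    have e (w : List Γ') : List.map (Equiv.refl Γ').invFun w = w := List.map_id w
    have e₁ (w : List Γ') : initList c.machine w = (Mem.word w).cfg (some c.entry) :=
      congrArg (TM2.Cfg.mk _ _) (funext fun k => by cases k <;> rfl)
    have e₂ (w : List Γ') : haltList c.machine w = ⟨none, (Mem.word w).sym, (Mem.word w).stk⟩ :=
      congrArg (TM2.Cfg.mk _ _) (funext fun k => by cases k <;> rfl)
    refine (congrArg _ ((congrArg _ (congrArg some ((congrArg _ (e _)).trans (e₁ _)))).trans h₁)).trans ?_
    exact congrArg some ((congrArg _ (e _)).trans (e₂ _)).symm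
  · exact Nat.succ_le_succ (hn a)

end StackProg

/-! ## Values on the main stack -/

namespace StackProg

open Computability

/-- `Within c s s' T`: started in `s`, the program `c` ends in `s'` after at most `T` steps. -/
def Within (c : Cmd) (s s' : Mem) (T : ℕ) : Prop := ∃ n ≤ T, Runs c s s' n

theorem Within.mono {c : Cmd} {s s' : Mem} {T T' : ℕ} (h : Within c s s' T) (hT : T ≤ T') :
    Within c s s' T' := by
  obtain ⟨n, hn, hr⟩ := h
  exact ⟨n, hn.trans hT, hr⟩

theorem Runs.within {c : Cmd} {s s' : Mem} {n : ℕ} (h : Runs c s s' n) : Within c s s' n :=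
  ⟨n, le_rfl, h⟩

theorem Within.seq {c d : Cmd} {s s' s'' : Mem} {T T' : ℕ} (h : Within c s s' T)
    (h' : Within d s' s'' T') : Within (.seq c d) s s'' (T + T') := by
  obtain ⟨n, hn, hr⟩ := h
  obtain ⟨n', hn', hr'⟩ := h'
  exact ⟨n + n', by lia, hr.seq hr'⟩

theorem Within.iteT {p : Option Γ' → Bool} {c d : Cmd} {s s' : Mem} {T : ℕ} (hp : p s.sym = true)
    (h : Within c s s' T) : Within (.ite p c d) s s' (T + 1) := by
  obtain ⟨n, hn, hr⟩ := h
  exact ⟨n + 1, by lia, hr.iteT hp⟩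

theorem Within.iteF {p : Option Γ' → Bool} {c d : Cmd} {s s' : Mem} {T : ℕ} (hp : p s.sym = false)
    (h : Within d s s' T) : Within (.ite p c d) s s' (T + 1) := by
  obtain ⟨n, hn, hr⟩ := h
  exact ⟨n + 1, by lia, hr.iteF hp⟩

theorem Within.loopF {p : Option Γ' → Bool} {c : Cmd} {s : Mem} (hp : p s.sym = false) :
    Within (.loop p c) s s 1 := (Runs.loopF hp).within

theorem Within.loopT {p : Option Γ' → Bool} {c : Cmd} {s s' s'' : Mem} {T T' : ℕ}
    (hp : p s.sym = true) (h : Within c s s' T) (h' : Within (.loop p c) s' s'' T') :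
    Within (.loop p c) s s'' (T' + (T + 1)) := by
  obtain ⟨n, hn, hr⟩ := h
  obtain ⟨n', hn', hr'⟩ := h'
  exact ⟨n' + (n + 1), by lia, hr.loopT hp hr'⟩

infixr:60 " ;; " => Cmd.seq

/-- The contents of the five stacks. -/
def stks (i m a b c : List Γ') : Stk → List Γ'
  | .io => i
  | .main => m
  | .auxL => a
  | .auxR => b
  | .cnt => c

section
variable (i m a b c x : List Γ')

@[simp] theorem stks_io : stks i m a b c .io = i := rfl
@[simp] theorem stks_main : stks i m a b c .main = m := rfl
@[simp] theorem stks_auxL : stks i m a b c .auxL = a := rfl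
@[simp] theorem stks_auxR : stks i m a b c .auxR = b := rfl
@[simp] theorem stks_cnt : stks i m a b c .cnt = c := rfl

@[simp] theorem update_io : Function.update (stks i m a b c) .io x = stks x m a b c := by
  funext k; cases k <;> simp
@[simp] theorem update_main : Function.update (stks i m a b c) .main x = stks i x a b c := by
  funext k; cases k <;> simp
@[simp] theorem update_auxL : Function.update (stks i m a b c) .auxL x = stks i m x b c := by
  funext k; cases k <;> simp
@[simp] theorem update_auxR : Function.update (stks i m a b c) .auxR x = stks i m a x c := by
  funext k; cases k <;> simp
@[simp] theorem update_cnt : Function.update (stks i m a b c) .cnt x = stks i m a b x := by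
  funext k; cases k <;> simp

end

theorem within_skip (s : Mem) : Within .skip s s 1 := (Runs.skip s).within

theorem within_push (k : Stk) (a : Γ') (v : Option Γ') (S : Stk → List Γ') :
    Within (.push k a) ⟨v, S⟩ ⟨v, Function.update S k (a :: S k)⟩ 1 := (Runs.push k a v S).within

theorem within_copy (k : Stk) (a : Γ') (S : Stk → List Γ') :
    Within (.copy k) ⟨some a, S⟩ ⟨some a, Function.update S k (a :: S k)⟩ 1 :=
  (Runs.copy k (some a) S).within

theorem within_pop (k : Stk) (v : Option Γ') (S : Stk → List Γ') :
    Within (.pop k) ⟨v, S⟩ ⟨(S k).head?, Function.update S k (S k).tail⟩ 1 :=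
  (Runs.pop k v S).within

/-- Binary trees, the universal data type. -/
inductive BTree where
  | leaf
  | node (l r : BTree)

/-- The prefix code of a tree. -/
def BTree.flat : BTree → List Γ'
  | leaf => [Γ'.ket]
  | node l r => Γ'.bra :: (l.flat ++ r.flat)

/-- This leaves `blank` free to mark the bottom of a tree that is parked on an auxiliary stack. -/
theorem BTree.blank_notMem_flat (t : BTree) : Γ'.blank ∉ t.flat := by
  induction t <;> simp_all [flat]

theorem BTree.flat_length_pos (t : BTree) : 0 < t.flat.length := by
  cases t <;> simp [flat]

/-- Push the current symbol to `k` if the flag is set. -/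
def copyIf : Bool → Stk → Cmd
  | true, k => .copy k
  | false, _ => .skip

/-- Push a marker to `k` if the flag is set. -/
def markIf : Bool → Stk → Cmd
  | true, k => .push k .blank
  | false, _ => .skip

def addIf (p : Bool) (w a : List Γ') : List Γ' := if p then w ++ a else a

/-- Read a symbol of a tree; the counter holds the number of trees that are still to be read. -/
def readSymbol (p q : Bool) : Cmd :=
  .pop .main ;; copyIf p .auxL ;; copyIf q .auxR ;;
    .ite (fun v => v = some .bra) (.push .cnt .comma ;; .push .cnt .comma) .skip ;; .pop .cnt

/-- Move a tree from the main stack to the auxiliary stacks selected by the flags. -/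
def readTree (p q : Bool) : Cmd :=
  markIf p .auxL ;; markIf q .auxR ;; .push .cnt .comma ;; .pop .cnt ;;
    .loop Option.isSome (readSymbol p q)

/-- The marker held in the state accounts for one pending tree and the counter for the remaining
ones. After `bra` two subtrees replace one tree, so two markers are pushed and one is popped; any
other symbol finishes a tree, and the next marker is popped. The state is `none` once nothing is
pending. -/
theorem within_readSymbol (p q : Bool) (v : Option Γ') (x : Γ') (i m a b c : List Γ') :
    Within (readSymbol p q) ⟨v, stks i (x :: m) a b c⟩
      (if x = .bra then ⟨some .comma, stks i m (addIf p [x] a) (addIf q [x] b) (.comma :: c)⟩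
        else ⟨c.head?, stks i m (addIf p [x] a) (addIf q [x] b) c.tail⟩) 7 := by
  have h₁ : Within (.pop .main) ⟨v, stks i (x :: m) a b c⟩ ⟨some x, stks i m a b c⟩ 1 := by
    simpa using within_pop .main v (stks i (x :: m) a b c)
  have h₂ : Within (copyIf p .auxL) ⟨some x, stks i m a b c⟩
      ⟨some x, stks i m (addIf p [x] a) b c⟩ 1 := by
    cases p
    · exact within_skip _
    · simpa [copyIf, addIf] using within_copy .auxL x (stks i m a b c)
  have h₃ (a) : Within (copyIf q .auxR) ⟨some x, stks i m a b c⟩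
      ⟨some x, stks i m a (addIf q [x] b) c⟩ 1 := by
    cases q
    · exact within_skip _
    · simpa [copyIf, addIf] using within_copy .auxR x (stks i m a b c)
  have h₄ (v a b c) : Within (.pop .cnt) ⟨v, stks i m a b c⟩ ⟨c.head?, stks i m a b c.tail⟩ 1 := by
    simpa using within_pop .cnt v (stks i m a b c)
  have h₅ (v a b c) : Within (.push .cnt .comma) ⟨v, stks i m a b c⟩
      ⟨v, stks i m a b (.comma :: c)⟩ 1 := by
    simpa using within_push .cnt .comma v (stks i m a b c)
  by_cases hx : x = .bra
  · rw [if_pos hx]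
    exact h₁.seq (h₂.seq ((h₃ _).seq ((Within.iteT (by simp [hx]) ((h₅ _ _ _ _).seq (h₅ _ _ _ _))).seq
      (h₄ _ _ _ _))))
  · rw [if_neg hx]
    exact (h₁.seq (h₂.seq ((h₃ _).seq ((Within.iteF (by simp [hx]) (within_skip _)).seq
      (h₄ _ _ _ _))))).mono (by lia)

theorem addIf_append (p : Bool) (w w' a : List Γ') :
    addIf p w (addIf p w' a) = addIf p (w ++ w') a := by
  cases p <;> simp [addIf]

/-- Phrased by continuation: a bound for the rest of the loop gives one for the loop that still has
`t` in front. At a node the induction hypothesis for the right subtree then feeds the one for the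
left. -/
theorem within_loop_readSymbol (p q : Bool) (t : BTree) (i m a b c : List Γ') (s : Mem) (T : ℕ)
    (h : Within (.loop Option.isSome (readSymbol p q))
      ⟨c.head?, stks i m (addIf p t.flat.reverse a) (addIf q t.flat.reverse b) c.tail⟩ s T) :
    Within (.loop Option.isSome (readSymbol p q)) ⟨some .comma, stks i (t.flat ++ m) a b c⟩ s
      (T + 8 * t.flat.length) := by
  induction t generalizing m a b c T with
  | leaf =>
    have h₁ := within_readSymbol p q (some .comma) .ket i m a b c
    exact Within.loopT rfl h₁ h
  | node l r ihl ihr =>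
    have h₁ := within_readSymbol p q (some .comma) .bra i (l.flat ++ (r.flat ++ m)) a b c
    rw [if_pos rfl] at h₁
    have e : (l.node r).flat.reverse = r.flat.reverse ++ (l.flat.reverse ++ [Γ'.bra]) := by
      simp [BTree.flat]
    rw [e, ← addIf_append, ← addIf_append, ← addIf_append, ← addIf_append] at h
    have h₂ := ihl _ _ _ (.comma :: c) _ (ihr _ _ _ _ _ h)
    have h₃ := Within.loopT rfl h₁ h₂
    simp only [BTree.flat, List.cons_append, List.append_assoc, List.length_cons,
      List.length_append]
    exact h₃.mono (by lia)

theorem within_readTree (p q : Bool) (t : BTree) (v : Option Γ') (i m a b : List Γ') :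
    Within (readTree p q) ⟨v, stks i (t.flat ++ m) a b []⟩
      ⟨none, stks i m (addIf p (t.flat.reverse ++ [.blank]) a)
        (addIf q (t.flat.reverse ++ [.blank]) b) []⟩ (5 + 8 * t.flat.length) := by
  have h₁ (m a b) : Within (markIf p .auxL) ⟨v, stks i m a b []⟩
      ⟨v, stks i m (addIf p [.blank] a) b []⟩ 1 := by
    cases p
    · exact within_skip _
    · simpa [markIf, addIf] using within_push .auxL .blank v (stks i m a b [])
  have h₂ (m a b) : Within (markIf q .auxR) ⟨v, stks i m a b []⟩
      ⟨v, stks i m a (addIf q [.blank] b) []⟩ 1 := by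
    cases q
    · exact within_skip _
    · simpa [markIf, addIf] using within_push .auxR .blank v (stks i m a b [])
  have h₃ (m a b) : Within (.push .cnt .comma) ⟨v, stks i m a b []⟩
      ⟨v, stks i m a b [.comma]⟩ 1 := by
    simpa using within_push .cnt .comma v (stks i m a b [])
  have h₄ (m a b) : Within (.pop .cnt) ⟨v, stks i m a b [.comma]⟩
      ⟨some .comma, stks i m a b []⟩ 1 := by
    simpa using within_pop .cnt v (stks i m a b [.comma])
  refine ((h₁ _ _ _).seq ((h₂ _ _ _).seq ((h₃ _ _ _).seq ((h₄ _ _ _).seq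
    (within_loop_readSymbol p q t _ _ _ _ _ _ 1 ?_))))).mono (by lia)
  rw [addIf_append, addIf_append]
  exact Within.loopF rfl

/-- Move the word above the topmost marker of `k` to the main stack. -/
def restore (k : Stk) : Cmd :=
  .pop k ;; .loop (fun v => v ≠ some .blank) (.copy .main ;; .pop k)

/-- A tree is parked in reverse order, so popping it symbol by symbol back to the main stack
restores its code. -/
theorem within_restore (k : Stk) (hk : k ≠ .main) (w a : List Γ') (hw : Γ'.blank ∉ w)
    (v : Option Γ') (S : Stk → List Γ') (hS : S k = w ++ .blank :: a) :
    Within (restore k) ⟨v, S⟩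
      ⟨some .blank, Function.update (Function.update S k a) .main (w.reverse ++ S .main)⟩
      (2 + 3 * w.length) := by
  have key : ∀ (w : List Γ') (_ : Γ'.blank ∉ w) (S : Stk → List Γ')
      (_ : S k = (w ++ .blank :: a).tail),
      Within (.loop (fun v => v ≠ some .blank) (.copy .main ;; .pop k))
        ⟨(w ++ .blank :: a).head?, S⟩
        ⟨some .blank, Function.update (Function.update S k a) .main (w.reverse ++ S .main)⟩
        (1 + 3 * w.length) := by
    intro w
    induction w with
    | nil =>
      intro _ S hS
      have e : Function.update (Function.update S k a) .main ([].reverse ++ S .main) = S := by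
        funext j
        by_cases h : j = .main
        · simp [h]
        · by_cases h' : j = k
          · subst h'; simp_all
          · simp [h, h']
      rw [e]
      exact Within.loopF (by simp)
    | cons x w ih =>
      intro hw S hS
      simp only [List.mem_cons, not_or] at hw
      have h₁ := within_copy .main x S
      have h₂ := within_pop k (some x) (Function.update S .main (x :: S .main))
      rw [Function.update_of_ne hk] at h₂
      have h₃ := ih hw.2 (Function.update (Function.update S .main (x :: S .main)) k (S k).tail)
        (by simp [hS])
      have e : (S k).head? = (w ++ .blank :: a).head? := by rw [hS]; simp
      rw [← e] at h₃
      have h₄ := Within.loopT (p := fun v => v ≠ some .blank)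
        (by simpa using fun h => hw.1 h.symm) (h₁.seq h₂) h₃
      have e' : Function.update (Function.update (Function.update (Function.update S .main
          (x :: S .main)) k (S k).tail) k a) .main (w.reverse ++ (Function.update (Function.update S
          .main (x :: S .main)) k (S k).tail) .main) =
          Function.update (Function.update S k a) .main ((x :: w).reverse ++ S .main) := by
        funext j
        by_cases h : j = .main
        · subst h; simp [Function.update_of_ne hk.symm]
        · by_cases h' : j = k
          · subst h'; simp [h]
          · simp [h, h']
      rw [e'] at h₄
      exact h₄.mono (by simp only [List.length_cons]; lia)
  have h₁ := within_pop k v S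
  have h₂ := key w hw (Function.update S k (S k).tail) (by simp [hS])
  rw [Function.update_idem, Function.update_of_ne hk.symm, ← hS] at h₂
  exact (h₁.seq h₂).mono (by lia)

theorem within_restore_auxL (t : BTree) (v : Option Γ') (i m a b : List Γ') :
    Within (restore .auxL) ⟨v, stks i m (t.flat.reverse ++ .blank :: a) b []⟩
      ⟨some .blank, stks i (t.flat ++ m) a b []⟩ (2 + 3 * t.flat.length) := by
  simpa using within_restore .auxL (by decide) t.flat.reverse a (by simpa using t.blank_notMem_flat)
    v (stks i m (t.flat.reverse ++ .blank :: a) b []) rfl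

theorem within_restore_auxR (t : BTree) (v : Option Γ') (i m a b : List Γ') :
    Within (restore .auxR) ⟨v, stks i m a (t.flat.reverse ++ .blank :: b) []⟩
      ⟨some .blank, stks i (t.flat ++ m) a b []⟩ (2 + 3 * t.flat.length) := by
  simpa using within_restore .auxR (by decide) t.flat.reverse b (by simpa using t.blank_notMem_flat)
    v (stks i m a (t.flat.reverse ++ .blank :: b) []) rfl

def drop : Cmd := readTree false false

theorem within_drop (t : BTree) (v : Option Γ') (i m a b : List Γ') :
    Within drop ⟨v, stks i (t.flat ++ m) a b []⟩ ⟨none, stks i m a b []⟩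
      (5 + 8 * t.flat.length) :=
  within_readTree false false t v i m a b

def dup : Cmd := readTree true true ;; restore .auxL ;; restore .auxR

theorem within_dup (t : BTree) (v : Option Γ') (i m a b : List Γ') :
    Within dup ⟨v, stks i (t.flat ++ m) a b []⟩
      ⟨some .blank, stks i (t.flat ++ (t.flat ++ m)) a b []⟩ (9 + 14 * t.flat.length) := by
  have h := within_readTree true true t v i m a b
  simp only [addIf, if_true, List.append_assoc, List.cons_append, List.nil_append] at h
  exact (h.seq ((within_restore_auxL _ _ _ _ _ _).seq (within_restore_auxR _ _ _ _ _ _))).mono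
    (by lia)

def swap : Cmd := readTree true false ;; readTree false true ;; restore .auxL ;; restore .auxR

theorem within_swap (t u : BTree) (v : Option Γ') (i m a b : List Γ') :
    Within swap ⟨v, stks i (t.flat ++ (u.flat ++ m)) a b []⟩
      ⟨some .blank, stks i (u.flat ++ (t.flat ++ m)) a b []⟩
      (14 + 11 * (t.flat.length + u.flat.length)) := by
  have h₁ := within_readTree true false t v i (u.flat ++ m) a b
  have h₂ (a) := within_readTree false true u none i m a b
  simp only [addIf, if_true, List.append_assoc, List.cons_append, List.nil_append] at h₁ h₂
  exact (h₁.seq ((h₂ _).seq ((within_restore_auxL _ _ _ _ _ _).seq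
    (within_restore_auxR _ _ _ _ _ _)))).mono (by lia)

end StackProg

/-! ## Functions computed by programs -/

namespace StackProg

open Computability

/-- Types whose elements are represented by trees. -/
class Data (α : Type) where
  tree : α → BTree

/-! ### Representation of values by trees, and their sizes -/

section Data

variable {α β : Type} [Data α] [Data β]

def enc (a : α) : List Γ' := (Data.tree a).flat

def size (a : α) : ℕ := (enc a).length

theorem size_pos (a : α) : 0 < size a := BTree.flat_length_pos _

instance : Data Bool := ⟨fun b => bif b then .node .leaf .leaf else .leaf⟩

instance : Data (α × β) := ⟨fun p => .node (Data.tree p.1) (Data.tree p.2)⟩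

def listTree : List α → BTree
  | [] => .leaf
  | a :: l => .node (Data.tree a) (listTree l)

instance : Data (List α) := ⟨listTree⟩

instance {p : α → Prop} : Data (Subtype p) := ⟨fun a => Data.tree a.1⟩

/-- Representation through a map into another type. -/
@[reducible] def Data.via (f : β → α) : Data β := ⟨fun b => Data.tree (f b)⟩

theorem enc_pair (a : α) (b : β) : enc (a, b) = .bra :: (enc a ++ enc b) := rfl

theorem enc_cons (a : α) (l : List α) : enc (a :: l) = .bra :: (enc a ++ enc l) := rfl

@[simp] theorem size_pair (a : α) (b : β) : size (a, b) = size a + size b + 1 := by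
  simp [size, enc_pair]

@[simp] theorem size_nil : size ([] : List α) = 1 := rfl

@[simp] theorem size_cons (a : α) (l : List α) : size (a :: l) = size a + size l + 1 := by
  simp [size, enc_cons]

theorem length_lt_size (l : List α) : l.length < size l := by
  induction l with
  | nil => simp
  | cons a l ih => simp only [List.length_cons, size_cons]; lia

theorem size_le_of_mem {l : List α} {a : α} (h : a ∈ l) : size a ≤ size l := by
  induction l with
  | nil => simp at h
  | cons b l ih =>
    rw [size_cons]
    rcases List.mem_cons.1 h with rfl | h
    · lia
    · have := ih h; lia

theorem size_append (l l' : List α) : size (l ++ l') + 1 = size l + size l' := by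
  induction l with
  | nil => simp; lia
  | cons a l ih => simp only [List.cons_append, size_cons]; lia

@[simp] theorem size_reverse (l : List α) : size l.reverse = size l := by
  induction l with
  | nil => rfl
  | cons a l ih =>
    have := size_append l.reverse [a]
    simp only [List.reverse_cons, size_cons, size_nil] at this ⊢
    lia

theorem size_le_of_forall {l : List α} {B : ℕ} (h : ∀ a ∈ l, size a ≤ B) :
    size l ≤ l.length * (B + 1) + 1 := by
  induction l with
  | nil => simp
  | cons a l ih =>
    simp only [List.mem_cons, forall_eq_or_imp] at h
    have := ih h.2
    simp only [size_cons, List.length_cons]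
    nlinarith [h.1]

@[simp] theorem enc_subtype {p : α → Prop} (a : Subtype p) : enc a = enc a.1 := rfl

@[simp] theorem size_subtype {p : α → Prop} (a : Subtype p) : size a = size a.1 := rfl

end Data

/-! ### Programs for functions on the main stack, with running times -/

section Comp

variable {α β γ δ : Type} [Data α] [Data β] [Data γ] [Data δ]

/-- The function `f` is computed on the main stack, in time `T`. -/
def Comp (f : α → β) (T : α → ℕ) : Prop :=
  ∃ c : Cmd, ∀ (a : α) (v : Option Γ') (i m x y : List Γ'), ∃ v' : Option Γ',
    Within c ⟨v, stks i (enc a ++ m) x y []⟩ ⟨v', stks i (enc (f a) ++ m) x y []⟩ (T a)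

def Mem.total (s : Mem) : ℕ :=
  (s.stk .io).length + (s.stk .main).length + (s.stk .auxL).length + (s.stk .auxR).length +
    (s.stk .cnt).length

/-- A single step pushes at most one symbol. -/
theorem Runs.total_le {c : Cmd} {s s' : Mem} {n : ℕ} (h : Runs c s s' n) :
    s'.total ≤ s.total + n := by
  induction h with
  | skip => lia
  | push k a v S => cases k <;> simp [Mem.total] <;> lia
  | copy k v S => cases k <;> simp [Mem.total] <;> lia
  | pop k v S => cases k <;> simp [Mem.total] <;> lia
  | seq => lia
  | iteT => lia
  | iteF => lia
  | loopF => lia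
  | loopT => lia

/-- Output is bounded by input plus time, so time bounds are also size bounds and compositions can
be estimated. -/
theorem Comp.size_le {f : α → β} {T : α → ℕ} (h : Comp f T) (a : α) :
    size (f a) ≤ size a + T a := by
  obtain ⟨c, hc⟩ := h
  obtain ⟨v', n, hn, hr⟩ := hc a none [] [] [] []
  have := hr.total_le
  simp [Mem.total] at this
  simp only [size]
  lia

theorem Comp.mono {f : α → β} {T T' : α → ℕ} (h : Comp f T) (hT : ∀ a, T a ≤ T' a) :
    Comp f T' := by
  obtain ⟨c, hc⟩ := h
  refine ⟨c, fun a v i m x y => ?_⟩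
  obtain ⟨v', h'⟩ := hc a v i m x y
  exact ⟨v', h'.mono (hT a)⟩

/-- A function that does not change the representation. -/
theorem comp_cast {f : α → β} (h : ∀ a, enc (f a) = enc a) : Comp f fun _ => 1 :=
  ⟨.skip, fun a v i m x y => ⟨v, by rw [h]; exact within_skip _⟩⟩

theorem Comp.comp {g : β → γ} {f : α → β} {T : α → ℕ} {U : β → ℕ} (hg : Comp g U)
    (hf : Comp f T) : Comp (fun a => g (f a)) fun a => T a + U (f a) := by
  obtain ⟨c, hc⟩ := hf
  obtain ⟨d, hd⟩ := hg
  refine ⟨c ;; d, fun a v i m x y => ?_⟩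
  obtain ⟨v', h'⟩ := hc a v i m x y
  obtain ⟨v'', h''⟩ := hd (f a) v' i m x y
  exact ⟨v'', h'.seq h''⟩

/-- The argument is duplicated, `g` is applied to the top copy, and after a swap `f` is applied to
the other one; `g` comes first because the code of the first component must end on top. The factor
`12` arises since the swap is linear in the size of `g a`, which `Comp.size_le` bounds by `size a +
U a`. -/
theorem Comp.pair {f : α → β} {g : α → γ} {T U : α → ℕ} (hf : Comp f T) (hg : Comp g U) :
    Comp (fun a => (f a, g a)) fun a => T a + 12 * U a + 36 * size a + 24 := by
  have hsize := hg.size_le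
  obtain ⟨c, hc⟩ := hf
  obtain ⟨d, hd⟩ := hg
  refine ⟨dup ;; d ;; swap ;; c ;; .push .main .bra, fun a v i m x y => ?_⟩
  have h₁ := within_dup (Data.tree a) v i m x y
  obtain ⟨v₂, h₂⟩ := hd a (some .blank) i (enc a ++ m) x y
  have h₃ := within_swap (Data.tree (g a)) (Data.tree a) v₂ i m x y
  obtain ⟨v₄, h₄⟩ := hc a (some .blank) i (enc (g a) ++ m) x y
  have h₅ := within_push .main .bra v₄ (stks i (enc (f a) ++ (enc (g a) ++ m)) x y [])
  refine ⟨v₄, ?_⟩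
  have e : enc (f a, g a) ++ m = .bra :: (enc (f a) ++ (enc (g a) ++ m)) := by simp [enc_pair]
  rw [e]
  simp only [update_main, stks_main] at h₅
  refine (h₁.seq (h₂.seq (h₃.seq (h₄.seq h₅)))).mono ?_
  have := hsize a
  simp only [size, enc] at this ⊢
  lia

theorem within_pop_main (x : Γ') (v : Option Γ') (i m a b c : List Γ') :
    Within (.pop .main) ⟨v, stks i (x :: m) a b c⟩ ⟨some x, stks i m a b c⟩ 1 := by
  simpa using within_pop .main v (stks i (x :: m) a b c)

theorem within_push_main (x : Γ') (v : Option Γ') (i m a b c : List Γ') :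
    Within (.push .main x) ⟨v, stks i m a b c⟩ ⟨v, stks i (x :: m) a b c⟩ 1 := by
  simpa using within_push .main x v (stks i m a b c)

theorem comp_fst : Comp (Prod.fst : α × β → α) fun p => 20 * size p + 20 := by
  refine ⟨.pop .main ;; swap ;; drop, fun ⟨a, b⟩ v i m x y => ⟨none, ?_⟩⟩
  have h₁ := within_pop_main .bra v i (enc a ++ (enc b ++ m)) x y []
  have h₂ := within_swap (Data.tree a) (Data.tree b) (some .bra) i m x y
  have h₃ := within_drop (Data.tree b) (some .blank) i (enc a ++ m) x y
  rw [enc_pair, List.cons_append, List.append_assoc]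
  refine (h₁.seq (h₂.seq h₃)).mono ?_
  have := size_pair a b
  simp only [size, enc] at this ⊢
  lia

theorem comp_snd : Comp (Prod.snd : α × β → β) fun p => 8 * size p + 6 := by
  refine ⟨.pop .main ;; drop, fun ⟨a, b⟩ v i m x y => ⟨none, ?_⟩⟩
  have h₁ := within_pop_main .bra v i (enc a ++ (enc b ++ m)) x y []
  have h₃ := within_drop (Data.tree a) (some .bra) i (enc b ++ m) x y
  rw [enc_pair, List.cons_append, List.append_assoc]
  refine (h₁.seq h₃).mono ?_
  have := size_pair a b
  simp only [size, enc] at this ⊢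
  lia

/-- Push a word on the main stack. -/
def pushWord : List Γ' → Cmd
  | [] => .skip
  | x :: w => pushWord w ;; .push .main x

theorem within_pushWord (w : List Γ') (v : Option Γ') (i m a b c : List Γ') :
    Within (pushWord w) ⟨v, stks i m a b c⟩ ⟨v, stks i (w ++ m) a b c⟩ (w.length + 1) := by
  induction w with
  | nil => exact within_skip _
  | cons x w ih => exact (ih.seq (within_push_main _ _ _ _ _ _ _)).mono (by simp)

theorem comp_const (b : β) : Comp (fun _ : α => b) fun a => 8 * size a + (size b + 6) := by
  refine ⟨drop ;; pushWord (enc b), fun a v i m x y => ⟨none, ?_⟩⟩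
  refine ((within_drop (Data.tree a) v i m x y).seq (within_pushWord _ _ _ _ _ _ _)).mono ?_
  simp only [size, enc]
  lia

/-- The branches live on subtypes, which have the same codes as the full type; each branch may thus
rely on the outcome of the test. The first symbol of the code of a Boolean decides, and `true`
leaves two more symbols to be discarded. -/
theorem Comp.dite {b : α → Bool} {f : α → β} {T U V : α → ℕ} (hb : Comp b T)
    (ht : Comp (fun x : {a // b a = true} => f x) fun x => U x)
    (he : Comp (fun x : {a // b a = false} => f x) fun x => V x) :
    Comp f fun a => T a + U a + V a + 14 * size a + 13 := by
  obtain ⟨cb, hb⟩ := hb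
  obtain ⟨ct, ht⟩ := ht
  obtain ⟨ce, he⟩ := he
  refine ⟨dup ;; cb ;; .pop .main ;;
    .ite (fun v => v = some .bra) (.pop .main ;; .pop .main ;; ct) ce, fun a v i m x y => ?_⟩
  have h₁ := within_dup (Data.tree a) v i m x y
  obtain ⟨v₂, h₂⟩ := hb a (some .blank) i (enc a ++ m) x y
  cases h : b a with
  | true =>
    rw [h] at h₂
    obtain ⟨v₃, h₃⟩ := ht ⟨a, h⟩ (some .ket) i m x y
    refine ⟨v₃, (h₁.seq (h₂.seq ((within_pop_main _ _ _ _ _ _ _).seq (Within.iteT rfl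
      ((within_pop_main _ _ _ _ _ _ _).seq ((within_pop_main _ _ _ _ _ _ _).seq h₃)))))).mono ?_⟩
    simp only [size, enc]
    lia
  | false =>
    rw [h] at h₂
    obtain ⟨v₃, h₃⟩ := he ⟨a, h⟩ (some .ket) i m x y
    refine ⟨v₃, (h₁.seq (h₂.seq ((within_pop_main _ _ _ _ _ _ _).seq (Within.iteF rfl
      h₃)))).mono ?_⟩
    simp only [size, enc]
    lia

theorem comp_isEmpty : Comp (List.isEmpty : List α → Bool) fun l => 8 * size l + 20 := by
  refine ⟨.pop .main ;; .ite (fun v => v = some .bra) (drop ;; drop ;; pushWord (enc false))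
    (pushWord (enc true)), fun l v i m x y => ?_⟩
  cases l with
  | nil =>
    refine ⟨some .ket, ((within_pop_main _ _ _ _ _ _ _).seq (Within.iteF rfl
      (within_pushWord _ _ _ _ _ _ _))).mono ?_⟩
    change 1 + (4 + 1) ≤ _
    lia
  | cons a l =>
    rw [enc_cons, List.cons_append, List.append_assoc]
    refine ⟨none, ((within_pop_main _ _ _ _ _ _ _).seq (Within.iteT rfl
      ((within_drop (Data.tree a) _ _ _ _ _).seq ((within_drop (Data.tree l) _ _ _ _ _).seq
      (within_pushWord _ _ _ _ _ _ _))))).mono ?_⟩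
    simp only [size_cons]
    simp only [size, enc]
    change 1 + (5 + 8 * _ + (5 + 8 * _ + (1 + 1)) + 1) ≤ _
    lia

/-- The list acts only as a clock, one cell per round. The predicate `P` restricts the arguments to
those whose iterates obey the bound `B`, since the cost of a round depends on the size of the
current value. -/
theorem Comp.iterate {f : α → α} {T : α → ℕ} (hf : Comp f T) (P : List γ × α → Prop)
    (B : List γ × α → ℕ)
    (hB : ∀ p, P p → ∀ i ≤ p.1.length, T (f^[i] p.2) ≤ B p ∧ size (f^[i] p.2) ≤ B p) :
    Comp (fun p : Subtype P => f^[p.1.1.length] p.1.2)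
      fun p => 3 + size p * (35 + 30 * size p + 23 * B p) := by
  obtain ⟨c, hc⟩ := hf
  have key : ∀ (l : List γ) (a : α) (N C : ℕ) (i m x y : List Γ'), size l ≤ N →
      (∀ j ≤ l.length, T (f^[j] a) ≤ C ∧ size (f^[j] a) ≤ C) →
      Within (.loop (fun v => v = some .bra) (drop ;; swap ;; c ;; swap ;; .pop .main))
      ⟨(enc l).head?, stks i ((enc l).tail ++ (enc a ++ m)) x y []⟩
      ⟨some .ket, stks i (enc (f^[l.length] a) ++ m) x y []⟩
      (1 + l.length * (35 + 30 * N + 23 * C)) := by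
    intro l
    induction l with
    | nil => intro a N C i m x y _ _; exact Within.mono (.loopF (by rfl)) (by simp)
    | cons h l ih =>
      intro a N C i m x y hN hC
      have h₀ := hC 0 (by simp)
      have h₁ := hC 1 (by simp)
      simp only [Function.iterate_zero, id, Function.iterate_one] at h₀ h₁
      have r₁ := within_drop (Data.tree h) (some .bra) i (enc l ++ (enc a ++ m)) x y
      have r₂ := within_swap (Data.tree l) (Data.tree a) none i m x y
      obtain ⟨v₃, r₃⟩ := hc a (some .blank) i (enc l ++ m) x y
      have r₄ := within_swap (Data.tree (f a)) (Data.tree l) v₃ i m x y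
      have r₅ := within_pop .main (some .blank) (stks i (enc l ++ (enc (f a) ++ m)) x y [])
      have hne : enc l ≠ [] := List.length_pos_iff.1 (size_pos l)
      simp only [stks_main, update_main, List.tail_append_of_ne_nil hne,
        List.head?_append_of_ne_nil _ hne] at r₅
      rw [size_cons] at hN
      have r₆ := ih (f a) N C i m x y (by lia) (fun j hj => by
        have := hC (j + 1) (by simpa using hj)
        rwa [Function.iterate_succ_apply] at this)
      have r := Within.loopT (p := fun v => v = some .bra) rfl
        (r₁.seq (r₂.seq (r₃.seq (r₄.seq r₅)))) r₆
      simp only [enc_cons, List.head?_cons, List.tail_cons, List.append_assoc, List.length_cons,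
        Function.iterate_succ_apply]
      refine r.mono ?_
      simp only [size, enc] at hN h₀ h₁ ⊢
      rw [Nat.add_mul]
      lia
  -- The first pop removes the `bra` of the pair; the second one reads the first symbol of the
  -- clock, which tells whether a round is due.
  refine ⟨.pop .main ;; .pop .main ;;
    .loop (fun v => v = some .bra) (drop ;; swap ;; c ;; swap ;; .pop .main),
    fun ⟨⟨l, a⟩, hp⟩ v i m x y => ⟨some .ket, ?_⟩⟩
  have r₁ := within_pop_main .bra v i (enc l ++ (enc a ++ m)) x y []
  have r₂ := within_pop .main (some .bra) (stks i (enc l ++ (enc a ++ m)) x y [])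
  have hne : enc l ≠ [] := List.length_pos_iff.1 (size_pos l)
  simp only [stks_main, update_main, List.tail_append_of_ne_nil hne,
    List.head?_append_of_ne_nil _ hne] at r₂
  have r₃ := key l a (size (l, a)) (B (l, a)) i m x y (by rw [size_pair]; lia) (hB (l, a) hp)
  rw [enc_subtype, enc_pair, List.cons_append, List.append_assoc]
  refine (r₁.seq (r₂.seq r₃)).mono ?_
  simp only [size_subtype]
  have : l.length ≤ size (l, a) := by have := length_lt_size l; rw [size_pair]; lia
  have := Nat.mul_le_mul_right (35 + 30 * size (l, a) + 23 * B (l, a)) this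
  lia

end Comp

end StackProg

/-! ## Input and output -/

namespace StackProg

open Computability

def symIdx : Γ' → ℕ
  | .bit false => 0
  | .bit true => 1
  | .bra => 2
  | .ket => 3
  | .comma => 4
  | .blank => 5

def symWord (s : Γ') : List Bool := List.replicate (symIdx s) false

theorem symWord_injective : Function.Injective symWord := by
  intro s t h
  have h : symIdx s = symIdx t := by simpa [symWord] using congrArg List.length h
  rcases s with _ | (_ | _) | _ | _ | _ <;> rcases t with _ | (_ | _) | _ | _ | _ <;>
    simp_all [symIdx]

instance : Data Γ' := Data.via symWord

theorem size_sym_le (s : Γ') : size s ≤ 11 := by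
  rcases s with _ | (_ | _) | _ | _ | _ <;> decide

theorem size_symWord_le (w : List Γ') : size w ≤ 12 * w.length + 1 := by
  induction w with
  | nil => simp
  | cons a w ih =>
    have := size_sym_le a
    simp only [size_cons, List.length_cons]
    lia

/-- Run a program that depends on the current symbol. -/
def dispatch (g : Γ' → Cmd) : Cmd :=
  .ite (fun v => v = some (.bit false)) (g (.bit false)) <|
  .ite (fun v => v = some (.bit true)) (g (.bit true)) <|
  .ite (fun v => v = some .bra) (g .bra) <|
  .ite (fun v => v = some .ket) (g .ket) <|
  .ite (fun v => v = some .comma) (g .comma) (g .blank)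

theorem within_dispatch {g : Γ' → Cmd} {a : Γ'} {S : Stk → List Γ'} {s : Mem} {T : ℕ}
    (h : Within (g a) ⟨some a, S⟩ s T) : Within (dispatch g) ⟨some a, S⟩ s (T + 5) := by
  rcases a with _ | (_ | _) | _ | _ | _
  · exact .iteF rfl <| .iteF rfl <| .iteF rfl <| .iteF rfl <| .iteF rfl h
  · exact (Within.iteT rfl h).mono (by lia)
  · exact (Within.iteF rfl <| .iteT rfl h).mono (by lia)
  · exact (Within.iteF rfl <| .iteF rfl <| .iteT rfl h).mono (by lia)
  · exact (Within.iteF rfl <| .iteF rfl <| .iteF rfl <| .iteT rfl h).mono (by lia)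
  · exact (Within.iteF rfl <| .iteF rfl <| .iteF rfl <| .iteF rfl <| .iteT rfl h).mono (by lia)

/-- Transfer the content of the input stack to the main stack. -/
def readInput : Cmd :=
  .pop .io ;; .loop Option.isSome (.copy .auxL ;; .pop .io) ;; .push .main .ket ;; .pop .auxL ;;
    .loop Option.isSome (dispatch (fun a => pushWord (enc a)) ;; .push .main .bra ;; .pop .auxL)

theorem within_readInput (w : List Γ') (v : Option Γ') :
    Within readInput ⟨v, stks w [] [] [] []⟩ ⟨none, stks [] (enc w) [] [] []⟩
      (5 + 24 * w.length) := by
  have key₁ : ∀ w x : List Γ', Within (.loop Option.isSome (.copy .auxL ;; .pop .io))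
      ⟨w.head?, stks w.tail [] x [] []⟩ ⟨none, stks [] [] (w.reverse ++ x) [] []⟩
      (1 + 3 * w.length) := by
    intro w
    induction w with
    | nil => intro x; exact .loopF rfl
    | cons a w ih =>
      intro x
      have h₁ := within_copy .auxL a (stks w [] x [] [])
      have h₂ := within_pop .io (some a) (stks w [] (a :: x) [] [])
      simp only [update_auxL, update_io, stks_auxL, stks_io] at h₁ h₂
      have h₃ := Within.loopT (p := Option.isSome) rfl (h₁.seq h₂) (ih (a :: x))
      simp only [List.reverse_cons, List.append_assoc, List.singleton_append]
      exact h₃.mono (by simp only [List.length_cons]; lia)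
  have key₂ : ∀ w u : List Γ', Within (.loop Option.isSome
      (dispatch (fun a => pushWord (enc a)) ;; .push .main .bra ;; .pop .auxL))
      ⟨w.head?, stks [] (enc u) w.tail [] []⟩ ⟨none, stks [] (enc (w.reverse ++ u)) [] [] []⟩
      (1 + 20 * w.length) := by
    intro w
    induction w with
    | nil => intro u; exact .loopF rfl
    | cons a w ih =>
      intro u
      have h₁ := within_dispatch (g := fun a => pushWord (enc a))
        (within_pushWord (enc a) (some a) [] (enc u) w [] [])
      have h₂ := within_push_main .bra (some a) [] (enc a ++ enc u) w [] []
      have h₃ := within_pop .auxL (some a) (stks [] (enc (a :: u)) w [] [])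
      simp only [update_auxL, stks_auxL] at h₃
      have h₄ := Within.loopT (p := Option.isSome) rfl (h₁.seq (h₂.seq h₃)) (ih (a :: u))
      simp only [List.reverse_cons, List.append_assoc, List.singleton_append]
      refine h₄.mono ?_
      have := size_sym_le a
      simp only [List.length_cons]
      simp only [size] at this
      lia
  have h₁ := within_pop .io v (stks w [] [] [] [])
  have h₃ := within_push_main .ket none [] [] w.reverse [] []
  have h₄ := within_pop .auxL none (stks [] [Γ'.ket] w.reverse [] [])
  have h₂ := key₁ w []
  have h₅ := key₂ w.reverse []
  simp only [update_auxL, update_io, stks_auxL, stks_io, List.append_nil, List.reverse_reverse,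
    List.length_reverse] at *
  exact (h₁.seq (h₂.seq (h₃.seq (h₄.seq h₅)))).mono (by lia)

/-- Read a symbol from the main stack and push it to an auxiliary stack. -/
def decode : List Γ' → Cmd
  | [] => .skip
  | s :: r => .pop .main ;; .ite (fun v => v = some .ket) (.push .auxL s) (.pop .main ;; decode r)

/-- Symbols are stored as unary indices, so decoding walks down the alphabet, one cell per letter.
-/
theorem within_decode (r : List Γ') (j : ℕ) (hj : j < r.length) (v : Option Γ')
    (i m x y c : List Γ') : ∃ v', Within (decode r)
      ⟨v, stks i (enc (List.replicate j false) ++ m) x y c⟩ ⟨v', stks i m (r[j] :: x) y c⟩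
      (4 * r.length) := by
  induction r generalizing j v with
  | nil => simp at hj
  | cons s r ih =>
    cases j with
    | zero =>
      have h₁ := within_pop_main .ket v i m x y c
      have h₂ := within_push .auxL s (some .ket) (stks i m x y c)
      simp only [update_auxL, stks_auxL] at h₂
      exact ⟨_, (h₁.seq (Within.iteT rfl h₂)).mono (by simp only [List.length_cons]; lia)⟩
    | succ j =>
      obtain ⟨v', h⟩ := ih j (by simpa using hj) (some .ket)
      have h₁ := within_pop_main .bra v i (.ket :: (enc (List.replicate j false) ++ m)) x y c
      have h₂ := within_pop_main .ket (some .bra) i (enc (List.replicate j false) ++ m) x y c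
      exact ⟨v', (h₁.seq (Within.iteF rfl (h₂.seq h))).mono (by
        simp only [List.length_cons]; lia)⟩

def alphabet : List Γ' := [.bit false, .bit true, .bra, .ket, .comma, .blank]

/-- Transfer the content of the main stack to the output stack. -/
def writeOutput : Cmd :=
  .pop .main ;; .loop (fun v => v = some .bra) (decode alphabet ;; .pop .main) ;;
    .pop .auxL ;; .loop Option.isSome (.copy .io ;; .pop .auxL)

theorem within_writeOutput (w : List Γ') (v : Option Γ') :
    Within writeOutput ⟨v, stks [] (enc w) [] [] []⟩ ⟨none, stks w [] [] [] []⟩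
      (4 + 29 * w.length) := by
  have key₁ : ∀ w x : List Γ', Within (.loop (fun v => v = some .bra) (decode alphabet ;; .pop .main))
      ⟨(enc w).head?, stks [] (enc w).tail x [] []⟩
      ⟨some .ket, stks [] [] (w.reverse ++ x) [] []⟩ (1 + 26 * w.length) := by
    intro w
    induction w with
    | nil => intro x; exact .loopF (p := fun v => v = some .bra) rfl
    | cons a w ih =>
      intro x
      have ha : ∃ h : symIdx a < alphabet.length, alphabet[symIdx a] = a := by
        rcases a with _ | (_ | _) | _ | _ | _ <;> exact ⟨by decide, rfl⟩
      obtain ⟨ha, ha'⟩ := ha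
      obtain ⟨v', h₁⟩ := within_decode alphabet (symIdx a) ha (some .bra) [] (enc w) x [] []
      rw [ha'] at h₁
      have h₂ := within_pop .main v' (stks [] (enc w) (a :: x) [] [])
      simp only [update_main, stks_main] at h₂
      have h₃ := Within.loopT (p := fun v => v = some .bra) rfl (h₁.seq h₂) (ih (a :: x))
      simp only [List.reverse_cons, List.append_assoc, List.singleton_append]
      refine h₃.mono ?_
      simp only [List.length_cons, alphabet, List.length_nil]
      lia
  have key₂ : ∀ w x : List Γ', Within (.loop Option.isSome (.copy .io ;; .pop .auxL))
      ⟨w.head?, stks x [] w.tail [] []⟩ ⟨none, stks (w.reverse ++ x) [] [] [] []⟩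
      (1 + 3 * w.length) := by
    intro w
    induction w with
    | nil => intro x; exact .loopF rfl
    | cons a w ih =>
      intro x
      have h₁ := within_copy .io a (stks x [] w [] [])
      have h₂ := within_pop .auxL (some a) (stks (a :: x) [] w [] [])
      simp only [update_auxL, update_io, stks_auxL, stks_io] at h₁ h₂
      have h₃ := Within.loopT (p := Option.isSome) rfl (h₁.seq h₂) (ih (a :: x))
      simp only [List.reverse_cons, List.append_assoc, List.singleton_append]
      exact h₃.mono (by simp only [List.length_cons]; lia)
  have h₁ := within_pop .main v (stks [] (enc w) [] [] [])
  have h₂ := key₁ w []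
  have h₃ := within_pop .auxL (some .ket) (stks [] [] w.reverse [] [])
  have h₄ := key₂ w.reverse []
  simp only [update_auxL, update_main, stks_auxL, stks_main, List.append_nil, List.reverse_reverse,
    List.length_reverse] at *
  exact (h₁.seq (h₂.seq (h₃.seq h₄))).mono (by lia)

theorem word_eq (w : List Γ') : Mem.word w = ⟨none, stks w [] [] [] []⟩ := by
  unfold Mem.word
  congr 1
  funext k
  cases k <;> rfl

/-- A function on words that is computed on the main stack is computed by a machine. -/
theorem Comp.computableInTime {α β : Type} {ea : α → List Γ'} {eb : β → List Γ'} {f : α → β}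
    {T : ℕ → ℕ} (h : @Comp α β (Data.via ea) (Data.via eb) f
      fun a => T (@size α (Data.via ea) a)) (hT : Monotone T) :
    ∃ M : Turing.TM2ComputableInTime ea eb f,
      ∀ n, M.time n = 30 * T (12 * n + 1) + 400 * n + 100 := by
  have hsize := @Comp.size_le α β (Data.via ea) (Data.via eb) f _ h
  obtain ⟨c, hc⟩ := h
  obtain ⟨M, hM⟩ := Cmd.computableInTime (ea := ea) (eb := eb) (f := f)
    (readInput ;; c ;; writeOutput) (fun n => 30 * T (12 * n + 1) + 400 * n + 99) fun a => by
      obtain ⟨v, h⟩ := hc a none [] [] [] []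
      rw [List.append_nil, List.append_nil] at h
      have := (within_readInput (ea a) none).seq (h.seq (within_writeOutput (eb (f a)) v))
      rw [word_eq, word_eq]
      refine this.mono ?_
      -- A word of length `n` is represented by a tree of size at most `12 * n + 1`, which is where
      -- the argument of `T` comes from. The length of the output is controlled by its size, and
      -- that by the running time.
      have h₁ : @size α (Data.via ea) a ≤ 12 * (ea a).length + 1 := size_symWord_le (ea a)
      have h₂ := hT h₁
      have h₃ : (eb (f a)).length < @size β (Data.via eb) (f a) := length_lt_size (eb (f a))
      have h₄ := hsize a
      dsimp only at h₄ ⊢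
      lia
  exact ⟨M, fun n => by rw [hM]⟩

end StackProg

/-! ## Polynomial time -/

namespace StackProg

open Computability

theorem eval_monotone (p : Polynomial ℕ) : Monotone fun n => p.eval n := by
  intro a b h
  simp only [Polynomial.eval_eq_sum_range]
  gcongr

/-- `T` is bounded by a polynomial in `m`. -/
def PolyB {α : Type} (m T : α → ℕ) : Prop := ∃ p : Polynomial ℕ, ∀ a, T a ≤ p.eval (m a)

namespace PolyB

variable {α β : Type} {m n T U : α → ℕ}

theorem refl (m : α → ℕ) : PolyB m m := ⟨.X, fun a => by simp⟩

theorem of_le (h : PolyB m U) (hT : ∀ a, T a ≤ U a) : PolyB m T := by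
  obtain ⟨p, hp⟩ := h
  exact ⟨p, fun a => (hT a).trans (hp a)⟩

theorem const (c : ℕ) : PolyB m fun _ => c := ⟨.C c, fun a => by simp⟩

theorem add (hT : PolyB m T) (hU : PolyB m U) : PolyB m fun a => T a + U a := by
  obtain ⟨p, hp⟩ := hT
  obtain ⟨q, hq⟩ := hU
  exact ⟨p + q, fun a => by simpa using add_le_add (hp a) (hq a)⟩

theorem mul (hT : PolyB m T) (hU : PolyB m U) : PolyB m fun a => T a * U a := by
  obtain ⟨p, hp⟩ := hT
  obtain ⟨q, hq⟩ := hU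
  exact ⟨p * q, fun a => by simpa using Nat.mul_le_mul (hp a) (hq a)⟩

theorem pow (hT : PolyB m T) (k : ℕ) : PolyB m fun a => T a ^ k := by
  obtain ⟨p, hp⟩ := hT
  exact ⟨p ^ k, fun a => by simpa using Nat.pow_le_pow_left (hp a) k⟩

theorem trans (hU : PolyB n U) (hn : PolyB m n) : PolyB m U := by
  obtain ⟨p, hp⟩ := hU
  obtain ⟨q, hq⟩ := hn
  refine ⟨p.comp q, fun a => (hp a).trans ?_⟩
  rw [Polynomial.eval_comp]
  exact eval_monotone p (hq a)

theorem comp {m T : β → ℕ} (h : PolyB m T) (f : α → β) :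
    PolyB (fun a => m (f a)) fun a => T (f a) := by
  obtain ⟨p, hp⟩ := h
  exact ⟨p, fun a => hp (f a)⟩

end PolyB

/-! ### Closure properties of polynomial time -/

section PT

variable {α β γ σ : Type} [Data α] [Data β] [Data γ] [Data σ] {m : α → ℕ}

/-- The function `f` is computed in time polynomial in the measure `m`, which dominates the size of
the argument. -/
def PT (m : α → ℕ) (f : α → β) : Prop := PolyB m size ∧ ∃ T, Comp f T ∧ PolyB m T

/-- Functions computed in polynomial time. -/
abbrev FP (f : α → β) : Prop := PT size f

theorem Comp.fp {f : α → β} {T : α → ℕ} (h : Comp f T) (hT : PolyB size T) : FP f :=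
  ⟨.refl _, T, h, hT⟩

theorem PT.sizeB {f : α → β} (h : PT m f) : PolyB m fun a => size (f a) := by
  obtain ⟨hm, T, hf, hT⟩ := h
  exact (hm.add hT).of_le hf.size_le

theorem PT.mono {f : α → β} {m' : α → ℕ} (h : PT m f) (hm : PolyB m' m) : PT m' f := by
  obtain ⟨h, T, hf, hT⟩ := h
  exact ⟨h.trans hm, T, hf, hT.trans hm⟩

theorem PT.congr {f g : α → β} (h : PT m f) (hfg : ∀ a, g a = f a) : PT m g := by
  rwa [show g = f from funext hfg]

theorem PT.comp' {g : β → γ} {f : α → β} {n : β → ℕ} (hg : PT n g) (hf : PT m f)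
    (h : PolyB m fun a => n (f a)) : PT m fun a => g (f a) := by
  obtain ⟨-, U, hg, hU⟩ := hg
  obtain ⟨hm, T, hf, hT⟩ := hf
  exact ⟨hm, _, hg.comp hf, hT.add ((hU.comp f).trans h)⟩

theorem PT.comp {g : β → γ} {f : α → β} (hg : FP g) (hf : PT m f) : PT m fun a => g (f a) :=
  hg.comp' hf hf.sizeB

theorem PT.pair {f : α → β} {g : α → γ} (hf : PT m f) (hg : PT m g) :
    PT m fun a => (f a, g a) := by
  obtain ⟨hm, T, hf, hT⟩ := hf
  obtain ⟨-, U, hg, hU⟩ := hg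
  exact ⟨hm, _, hf.pair hg, ((hT.add ((PolyB.const 12).mul hU)).add
    ((PolyB.const 36).mul hm)).add (.const 24)⟩

theorem PT.cod {P : β → Prop} {f : α → β} (hf : PT m f) (h : ∀ a, P (f a)) :
    PT m fun a => (⟨f a, h a⟩ : Subtype P) := hf

theorem fp_cast {f : α → β} (h : ∀ a, enc (f a) = enc a) : FP f := (comp_cast h).fp (.const 1)

theorem fp_id : FP fun a : α => a := fp_cast fun _ => rfl

theorem fp_val {P : α → Prop} : FP fun a : Subtype P => a.1 := fp_cast fun _ => rfl

theorem PT.id (hm : PolyB m size) : PT m fun a : α => a := fp_id.mono hm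

theorem fp_fst : FP (Prod.fst : α × β → α) :=
  comp_fst.fp (((PolyB.const 20).mul (.refl _)).add (.const 20))

theorem fp_snd : FP (Prod.snd : α × β → β) :=
  comp_snd.fp (((PolyB.const 8).mul (.refl _)).add (.const 6))

theorem PT.fst {f : α → β × γ} (h : PT m f) : PT m fun a => (f a).1 := fp_fst.comp h

theorem PT.snd {f : α → β × γ} (h : PT m f) : PT m fun a => (f a).2 := fp_snd.comp h

theorem fp_const (b : β) : FP fun _ : α => b :=
  (comp_const b).fp (((PolyB.const 8).mul (.refl _)).add (.const _))

theorem PT.dite {b : α → Bool} {f : α → β} (hb : PT m b)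
    (ht : PT (fun x => m x.1) fun x : {a // b a = true} => f x)
    (he : PT (fun x => m x.1) fun x : {a // b a = false} => f x) : PT m f := by
  obtain ⟨hm, T, hb, hT⟩ := hb
  obtain ⟨-, U, ht, p, hU⟩ := ht
  obtain ⟨-, V, he, q, hV⟩ := he
  -- The running times of the branches are defined only on subtypes; the polynomials that bound them
  -- make sense everywhere.
  refine ⟨hm, _, hb.dite (U := fun a => p.eval (m a)) (V := fun a => q.eval (m a))
    (ht.mono hU) (he.mono hV), ?_⟩
  exact (((hT.add ⟨p, fun _ => le_rfl⟩).add ⟨q, fun _ => le_rfl⟩).add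
    ((PolyB.const 14).mul hm)).add (.const 13)

theorem PT.restrict {f : α → β} (hf : PT m f) {P : α → Prop} :
    PT (fun x => m x.1) fun x : Subtype P => f x.1 :=
  hf.comp' (fp_val.mono (hf.1.comp Subtype.val)) (.refl _)

theorem PT.cond {b : α → Bool} {f g : α → β} (hb : PT m b) (hf : PT m f) (hg : PT m g) :
    PT m fun a => bif b a then f a else g a :=
  hb.dite (hf.restrict.congr fun x => by rw [x.2]; rfl) (hg.restrict.congr fun x => by rw [x.2]; rfl)

theorem PT.and {b c : α → Bool} (hb : PT m b) (hc : PT m c) : PT m fun a => b a && c a :=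
  (hb.cond hc ((fp_const false).mono hb.1)).congr fun a => by cases b a <;> rfl

theorem PT.or {b c : α → Bool} (hb : PT m b) (hc : PT m c) : PT m fun a => b a || c a :=
  (hb.cond ((fp_const true).mono hb.1) hc).congr fun a => by cases b a <;> rfl

theorem PT.not {b : α → Bool} (hb : PT m b) : PT m fun a => !b a :=
  (hb.cond ((fp_const false).mono hb.1) ((fp_const true).mono hb.1)).congr fun a => by
    cases b a <;> rfl

theorem fp_isEmpty : FP (List.isEmpty : List α → Bool) :=
  comp_isEmpty.fp (((PolyB.const 8).mul (.refl _)).add (.const 20))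

theorem PT.cons {f : α → β} {l : α → List β} (hf : PT m f) (hl : PT m l) :
    PT m fun a => f a :: l a :=
  (fp_cast (f := fun p : β × List β => p.1 :: p.2) fun _ => rfl).comp (hf.pair hl)

/-- The head and the tail of a nonempty list. -/
def uncons (l : {l : List α // l.isEmpty = false}) : α × List α :=
  match l with
  | ⟨a :: l, _⟩ => (a, l)

theorem enc_uncons (l : {l : List α // l.isEmpty = false}) : enc (uncons l) = enc l := by
  obtain ⟨_ | ⟨a, l⟩, h⟩ := l
  · cases h
  · rfl

/-- A nonempty list has the same code as the pair of its head and tail, so taking it apart costs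
nothing once it is known to be nonempty. -/
theorem PT.casesList {l : α → List β} {f : α → γ} {g : α × β × List β → γ} (hl : PT m l)
    (hf : PT m f) (hg : FP g) : PT m fun a => match l a with
      | [] => f a
      | b :: t => g (a, b, t) := by
  have hu : PT (fun x => m x.1) fun x : {a // (l a).isEmpty = false} =>
      uncons ⟨l x.1, x.2⟩ := (fp_cast enc_uncons).comp (hl.restrict.cod fun x => x.2)
  have hg' : PT (fun x => m x.1) fun x : {a // (l a).isEmpty = false} =>
      g (x.1, uncons ⟨l x.1, x.2⟩) := hg.comp ((PT.id hl.1).restrict.pair hu)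
  refine (fp_isEmpty.comp hl).dite (hf.restrict.congr fun x => ?_) (hg'.congr fun x => ?_)
  · have := x.2
    rw [List.isEmpty_iff] at this
    rw [this]
  · have key : ∀ k : {k : List β // k.isEmpty = false}, (match k.1 with
        | [] => f x.1
        | b :: t => g (x.1, b, t)) = g (x.1, uncons k) := by
      rintro ⟨_ | ⟨b, t⟩, hk⟩
      · cases hk
      · rfl
    exact key ⟨l x.1, x.2⟩

theorem fp_tail : FP (List.tail : List α → List α) :=
  (PT.casesList (g := fun p : List α × α × List α => p.2.2) fp_id fp_id fp_snd.snd).congr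
    fun l => by cases l <;> rfl

theorem fp_headD (d : α) : FP fun l : List α => l.headD d :=
  (PT.casesList (g := fun p : List α × α × List α => p.2.1) fp_id (fp_const d) fp_snd.fst).congr
    fun l => by cases l <;> rfl

/-- A step of a left fold. -/
def foldStep (g : α × σ × β → σ) (s : List β × σ × α) : List β × σ × α :=
  match s.1 with
  | [] => s
  | b :: t => (t, g (s.2.2, s.2.1, b), s.2.2)

theorem fp_foldStep {g : α × σ × β → σ} (hg : FP g) : FP (foldStep g) := by
  have h₁ : FP fun p : (List β × σ × α) × β × List β => p.1.2.2 := fp_fst.snd.snd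
  have h₂ : FP fun p : (List β × σ × α) × β × List β => p.1.2.1 := fp_fst.snd.fst
  have h₃ : FP fun p : (List β × σ × α) × β × List β => p.2.1 := fp_snd.fst
  have h₄ : FP fun p : (List β × σ × α) × β × List β => p.2.2 := fp_snd.snd
  exact (PT.casesList fp_fst fp_id (h₄.pair ((hg.comp (h₁.pair (h₂.pair h₃))).pair h₁)))

omit [Data α] [Data β] [Data σ] in
theorem foldStep_iterate (g : α × σ × β → σ) (l₁ l₂ : List β) (s : σ) (a : α) :
    (foldStep g)^[l₁.length] (l₁ ++ l₂, s, a) =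
      (l₂, l₁.foldl (fun s b => g (a, s, b)) s, a) := by
  induction l₁ generalizing s with
  | nil => rfl
  | cons b l ih => exact ih _

/-- The fold is an iteration of `foldStep`. The bound `B` on the accumulator after every prefix
cannot be omitted: a polynomial-time step may double the accumulator, and then the whole fold would
be exponential. -/
theorem PT.foldl {l : α → List β} {x : α → σ} {g : α × σ × β → σ} {B : α → ℕ} (hl : PT m l)
    (hx : PT m x) (hg : FP g) (hB : PolyB m B)
    (h : ∀ a l₁ l₂, l a = l₁ ++ l₂ →
      size (l₁.foldl (fun s b => g (a, s, b)) (x a)) ≤ B a) :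
    PT m fun a => (l a).foldl (fun s b => g (a, s, b)) (x a) := by
  obtain ⟨-, T, hT, q, hq⟩ := fp_foldStep hg
  let M : α → ℕ := fun a => size (l a) + B a + size a + 2
  have hM : PolyB m M := ((hl.sizeB.add hB).add hl.1).add (.const 2)
  have hsize : ∀ a, ∀ i ≤ (l a).length,
      size ((foldStep g)^[i] (l a, x a, a)) ≤ M a := by
    intro a i hi
    have e := foldStep_iterate g ((l a).take i) ((l a).drop i) (x a) a
    rw [List.take_append_drop, List.length_take_of_le hi] at e
    rw [e]
    have h₁ := h a ((l a).take i) ((l a).drop i) (List.take_append_drop i (l a)).symm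
    have h₂ := size_append ((l a).take i) ((l a).drop i)
    rw [List.take_append_drop] at h₂
    have h₃ := size_pos ((l a).take i)
    simp only [size_pair, M]
    lia
  -- The list appears twice: as the clock, and as the data consumed by the steps.
  have h₁ := hT.iterate (γ := β) (fun p => ∃ a, p = (l a, l a, x a, a))
    (fun p => q.eval (M p.2.2.2) + M p.2.2.2) (by
      rintro _ ⟨a, rfl⟩ i hi
      have := hsize a i hi
      exact ⟨((hq _).trans (eval_monotone q this)).trans (Nat.le_add_right _ _),
        this.trans (Nat.le_add_left _ _)⟩)
  have h₀ := (hl.pair (hl.pair (hx.pair (PT.id hl.1)))).cod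
    (P := fun p => ∃ a, p = (l a, l a, x a, a)) fun a => ⟨a, rfl⟩
  have hs := h₀.sizeB
  obtain ⟨-, U, hU, hU'⟩ := h₀
  have h₂ : PT m fun a => (foldStep g)^[(l a).length] (l a, x a, a) := by
    refine ⟨hl.1, _, h₁.comp hU, hU'.add ((PolyB.const 3).add (hs.mul (((PolyB.const 35).add
      ((PolyB.const 30).mul hs)).add ((PolyB.const 23).mul ?_))))⟩
    exact (PolyB.trans ⟨q, fun _ => le_rfl⟩ hM).add hM
  refine h₂.snd.fst.congr fun a => ?_
  have e := foldStep_iterate g (l a) [] (x a) a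
  rw [List.append_nil] at e
  rw [e]

end PT

end StackProg

/-! ## Lists in polynomial time -/

namespace StackProg

open Computability

set_option linter.unusedSectionVars false

section Lists

variable {α β γ σ : Type} [Data α] [Data β] [Data γ] [Data σ] {m : α → ℕ}

theorem PT.nil (hm : PolyB m size) : PT m fun _ : α => ([] : List β) := (fp_const []).mono hm

theorem fp_reverseAppend : FP fun p : List β × List β => p.1.reverse ++ p.2 := by
  refine (PT.foldl (l := fun p : List β × List β => p.1) (x := fun p => p.2)
    (g := fun q => q.2.2 :: q.2.1) (B := size) fp_fst fp_snd (fp_snd.snd.cons fp_snd.fst)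
    (.refl _) ?_).congr ?_
  · rintro ⟨_, k⟩ l₁ l₂ rfl
    have h₁ : ∀ (l k : List β), l.foldl (fun s b => b :: s) k = l.reverse ++ k := by
      intro l; induction l <;> simp_all
    have h₂ := size_append l₁.reverse k
    have h₃ := size_append l₁ l₂
    rw [h₁, size_pair]
    rw [size_reverse] at h₂
    have := size_pos l₂
    lia
  · rintro ⟨l, k⟩
    dsimp only
    induction l generalizing k with
    | nil => rfl
    | cons b l ih => rw [List.foldl_cons, ← ih]; simp

theorem PT.reverse {l : α → List β} (hl : PT m l) : PT m fun a => (l a).reverse :=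
  (fp_reverseAppend.comp (hl.pair (.nil hl.1))).congr fun a => by simp

theorem PT.append {l k : α → List β} (hl : PT m l) (hk : PT m k) : PT m fun a => l a ++ k a :=
  (fp_reverseAppend.comp (hl.reverse.pair hk)).congr fun a => by simp

theorem size_flatMap_le {l : List β} {f : β → List γ} {C : ℕ} (h : ∀ b ∈ l, size (f b) ≤ C) :
    size (l.flatMap f) ≤ l.length * C + 1 := by
  induction l with
  | nil => simp
  | cons b l ih =>
    simp only [List.mem_cons, forall_eq_or_imp] at h
    have h₁ := size_append (f b) (l.flatMap f)
    have h₂ := ih h.2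
    rw [List.flatMap_cons, List.length_cons, Nat.add_mul]
    lia

/-- The values are accumulated in reverse order, so that a step only prepends, and the result is
reversed at the end. -/
theorem PT.flatMap {l : α → List β} {f : α × β → List γ} (hl : PT m l) (hf : FP f) :
    PT m fun a => (l a).flatMap fun b => f (a, b) := by
  have e : ∀ (a : α) (l : List β) (s : List γ),
      l.foldl (fun s b => (f (a, b)).reverse ++ s) s = (l.flatMap fun b => f (a, b)).reverse ++ s := by
    intro a l
    induction l <;> simp_all
  obtain ⟨q, hq⟩ := hf.sizeB
  have hf' : FP fun q : α × List γ × β => (f (q.1, q.2.2)).reverse ++ q.2.1 :=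
    (hf.comp (fp_fst.pair fp_snd.snd)).reverse.append fp_snd.fst
  refine (PT.foldl (x := fun _ => []) (B := fun a => (size (l a)) *
    q.eval (size a + size (l a) + 1) + 1) hl (.nil hl.1) hf' ?_ ?_).reverse.congr fun a => ?_
  · exact (hl.sizeB.mul (PolyB.trans ⟨q, fun _ => le_rfl⟩ ((hl.1.add hl.sizeB).add (.const 1)))).add
      (.const 1)
  · intro a l₁ l₂ h
    simp only [e, List.append_nil, size_reverse]
    have h₁ := size_append l₁ l₂
    have h₂ := length_lt_size l₁
    have h₃ := size_pos l₂
    rw [← h] at h₁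
    refine (size_flatMap_le fun b hb => ?_).trans
      (Nat.add_le_add_right (Nat.mul_le_mul_right (q.eval (size a + size (l a) + 1)) ?_) 1)
    · refine (hq _).trans (eval_monotone q ?_)
      have := size_le_of_mem hb
      rw [size_pair]
      lia
    · lia
  · simp only [e, List.append_nil, List.reverse_reverse]

theorem PT.map {l : α → List β} {f : α × β → γ} (hl : PT m l) (hf : FP f) :
    PT m fun a => (l a).map fun b => f (a, b) :=
  (hl.flatMap (hf.cons (.nil (.refl _)))).congr fun a => by
    induction l a <;> simp_all

theorem PT.filter {l : α → List β} {p : α × β → Bool} (hl : PT m l) (hp : FP p) :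
    PT m fun a => (l a).filter fun b => p (a, b) :=
  (hl.flatMap (hp.cond (fp_snd.cons (.nil (.refl _))) (.nil (.refl _)))).congr fun a => by
    induction l a with
    | nil => rfl
    | cons b l ih => cases h : p (a, b) <;> simp [h, ih]

theorem PT.all {l : α → List β} {p : α × β → Bool} (hl : PT m l) (hp : FP p) :
    PT m fun a => (l a).all fun b => p (a, b) :=
  (fp_isEmpty.comp (hl.filter hp.not)).congr fun a => by
    induction l a with
    | nil => rfl
    | cons b l ih => cases h : p (a, b) <;> simp [h, ih]

theorem PT.any {l : α → List β} {p : α × β → Bool} (hl : PT m l) (hp : FP p) :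
    PT m fun a => (l a).any fun b => p (a, b) :=
  (hl.all hp.not).not.congr fun a => by
    induction l a with
    | nil => rfl
    | cons b l ih => cases h : p (a, b) <;> simp [h, ih]

/-- Types with an equality test that works in polynomial time. -/
class EqData (α : Type) [Data α] [DecidableEq α] : Prop where
  fp : FP fun p : α × α => decide (p.1 = p.2)

theorem PT.eq [DecidableEq β] [EqData β] {f g : α → β} (hf : PT m f) (hg : PT m g) :
    PT m fun a => decide (f a = g a) :=
  EqData.fp.comp (hf.pair hg)

instance : EqData Bool :=
  ⟨(PT.cond fp_fst fp_snd fp_snd.not).congr fun p => by rcases p with ⟨_ | _, _ | _⟩ <;> rfl⟩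

instance [DecidableEq α] [DecidableEq β] [EqData α] [EqData β] : EqData (α × β) :=
  ⟨((fp_fst.fst.eq fp_snd.fst).and (fp_fst.snd.eq fp_snd.snd)).congr fun p => by
    simp [Prod.ext_iff]⟩

theorem eqData_via [DecidableEq α] [DecidableEq β] [EqData α] {f : β → α}
    (hf : Function.Injective f) : @EqData β (Data.via f) _ :=
  letI : Data β := Data.via f
  have h : FP f := fp_cast fun _ => rfl
  ⟨((h.comp fp_fst).eq (h.comp fp_snd)).congr fun p => by simp [hf.eq_iff]⟩

/-- A step of the comparison of two lists. -/
def eqStep [DecidableEq β] (s : List β × Bool) (b : β) : List β × Bool :=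
  match s.1 with
  | [] => ([], false)
  | c :: t => (t, s.2 && decide (b = c))

-- The state consists of the unread part of the second list and of a flag; the lists agree exactly
-- if nothing is left over and the flag has survived.
omit [Data β] in
theorem foldl_eqStep [DecidableEq β] (l k : List β) (o : Bool) :
    ((l.foldl eqStep (k, o)).1.isEmpty && (l.foldl eqStep (k, o)).2) = (decide (l = k) && o) := by
  induction l generalizing k o with
  | nil => cases k <;> simp
  | cons b l ih =>
    cases k with
    | nil =>
      rw [List.foldl_cons]
      refine (ih [] false).trans ?_
      simp
    | cons c k =>
      rw [List.foldl_cons]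
      refine (ih k _).trans ?_
      by_cases h : b = c <;> by_cases h' : l = k <;> simp [h, h']

theorem fp_eqStep [DecidableEq β] [EqData β] :
    FP fun q : (List β × List β) × (List β × Bool) × β => eqStep q.2.1 q.2.2 := by
  have h : FP fun q : (((List β × List β) × (List β × Bool) × β) × β × List β) =>
      (q.2.2, q.1.2.1.2 && decide (q.1.2.2 = q.2.1)) :=
    fp_snd.snd.pair (fp_fst.snd.fst.snd.and (fp_fst.snd.snd.eq fp_snd.fst))
  exact (PT.casesList fp_snd.fst.fst (fp_const ([], false)) h).congr fun _ => rfl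

instance [DecidableEq β] [EqData β] : EqData (List β) := by
  have h : FP fun p : List β × List β => p.1.foldl eqStep (p.2, true) := by
    refine PT.foldl (B := fun p => size p + 4) fp_fst (fp_snd.pair (fp_const true)) fp_eqStep
      ((PolyB.refl _).add (.const 4)) ?_
    rintro ⟨l, k⟩ l₁ l₂ rfl
    have hs : ∀ b : Bool, size b ≤ 3 := by decide
    have : ∀ (l k : List β) (o : Bool), size (l.foldl eqStep (k, o)) ≤ size k + 4 := by
      intro l
      induction l with
      | nil =>
        intro k o
        have := hs o
        rw [List.foldl_nil, size_pair]
        lia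
      | cons b l ih =>
        intro k o
        cases k with
        | nil => exact ih [] false
        | cons c k =>
          refine (ih k _).trans ?_
          rw [size_cons]
          lia
    refine (this _ _ _).trans ?_
    dsimp only
    rw [size_pair]
    lia
  exact ⟨((fp_isEmpty.comp h.fst).and h.snd).congr fun p => by rw [foldl_eqStep]; simp⟩

instance : Data ℕ := Data.via encodeNat

instance : EqData ℕ := eqData_via encodingNatBool.encode_injective

instance : EqData Γ' := eqData_via symWord_injective

/-- The Boolean membership test. -/
def memb [DecidableEq β] (x : β) (l : List β) : Bool := l.any fun b => decide (x = b)

omit [Data β] in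
@[simp] theorem memb_iff [DecidableEq β] {x : β} {l : List β} : memb x l = true ↔ x ∈ l := by
  simp [memb]

theorem PT.mem [DecidableEq β] [EqData β] {x : α → β} {l : α → List β} (hx : PT m x)
    (hl : PT m l) : PT m fun a => memb (x a) (l a) := by
  have h : FP fun p : β × List β => memb p.1 p.2 := fp_snd.any (fp_fst.fst.eq fp_snd)
  exact h.comp (hx.pair hl)

/-- The value of the last entry with a given key. -/
def lookupD [DecidableEq β] (d : γ) (l : List (β × γ)) (k : β) : γ :=
  l.foldl (fun s p => bif decide (p.1 = k) then p.2 else s) d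

theorem fp_lookupD [DecidableEq β] [EqData β] (d : γ) :
    FP fun p : List (β × γ) × β => lookupD d p.1 p.2 := by
  have hg : FP fun q : (List (β × γ) × β) × γ × β × γ =>
      bif decide (q.2.2.1 = q.1.2) then q.2.2.2 else q.2.1 :=
    (fp_snd.snd.fst.eq fp_fst.snd).cond fp_snd.snd.snd fp_snd.fst
  refine PT.foldl (B := fun p => size p.1 + size d) fp_fst (fp_const d) hg
    (fp_fst.sizeB.add (.const _)) ?_
  rintro ⟨l, k⟩ l₁ l₂ rfl
  have key : ∀ (l : List (β × γ)) (s : γ),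
      size (l.foldl (fun s p => bif decide (p.1 = k) then p.2 else s) s) ≤ size l + size s := by
    intro l
    induction l with
    | nil => intro s; simp
    | cons p l ih =>
      intro s
      refine (ih _).trans ?_
      have h₁ : size p = size p.1 + size p.2 + 1 := size_pair p.1 p.2
      cases decide (p.1 = k)
      all_goals
        simp only [size_cons]
        lia
  refine (key l₁ d).trans ?_
  have h₁ := size_append l₁ l₂
  have h₂ := size_pos l₂
  dsimp only
  lia

/-- No arithmetic is needed: one entry of `l` is dropped for each entry of `k`, and nothing remains
exactly if `l` is not longer. -/
theorem PT.length_le {l k : α → List β} (hl : PT m l) (hk : PT m k) :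
    PT m fun a => decide ((l a).length ≤ (k a).length) := by
  have h : FP fun p : List β × List β => p.2.foldl (fun s _ => s.tail) p.1 := by
    refine PT.foldl (g := fun q : (List β × List β) × List β × β => q.2.1.tail)
      (B := fun p => size p.1) fp_snd fp_fst (fp_tail.comp fp_snd.fst) fp_fst.sizeB ?_
    rintro ⟨l, k⟩ l₁ l₂ -
    have : ∀ (l₁ l : List β), size (l₁.foldl (fun s _ => s.tail) l) ≤ size l := by
      intro l₁
      induction l₁ with
      | nil => intro l; rfl
      | cons b l₁ ih =>
        intro l
        refine (ih _).trans ?_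
        cases l with
        | nil => rfl
        | cons c l => simp only [List.tail_cons, size_cons]; lia
    exact this _ _
  have e : ∀ (k l : List β), k.foldl (fun s _ => s.tail) l = l.drop k.length := by
    intro k
    induction k with
    | nil => intro l; rfl
    | cons b k ih => intro l; rw [List.foldl_cons, ih, List.drop_tail]; rfl
  refine (fp_isEmpty.comp (h.comp (hl.pair hk))).congr fun a => ?_
  rw [e, Bool.eq_iff_iff]
  simp

end Lists

end StackProg

/-! ## Exponential time -/

namespace StackProg

open Computability

set_option linter.unusedSectionVars false

/-! ### Enumeration of assignments and of subsets -/

section Choices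

variable {α β γ : Type} [Data α] [Data β] [Data γ] {m : α → ℕ}

/-- All association lists with the given keys and with values in a given list. -/
def choices (xs : List β) (ys : List γ) : List (List (β × γ)) :=
  xs.foldl (fun acc x => ys.flatMap fun y => acc.map fun s => (x, y) :: s) [[]]

/-- Each key is put in front of those treated before, whence the reversed order of the keys. -/
theorem mem_choices {xs : List β} {ys : List γ} {s : List (β × γ)} :
    s ∈ choices xs ys ↔ s.map Prod.fst = xs.reverse ∧ ∀ p ∈ s, p.2 ∈ ys := by
  have key : ∀ (xs : List β) (acc : List (List (β × γ))),
      s ∈ xs.foldl (fun acc x => ys.flatMap fun y => acc.map fun s => (x, y) :: s) acc ↔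
        ∃ t, ∃ u ∈ acc, s = t ++ u ∧ t.map Prod.fst = xs.reverse ∧ ∀ p ∈ t, p.2 ∈ ys := by
    intro xs
    induction xs with
    | nil =>
      intro acc
      constructor
      · intro h
        exact ⟨[], s, h, by simp⟩
      · rintro ⟨t, u, hu, rfl, ht, -⟩
        simp only [List.reverse_nil, List.map_eq_nil_iff] at ht
        simpa [ht] using hu
    | cons x xs ih =>
      intro acc
      rw [List.foldl_cons, ih]
      constructor
      · rintro ⟨t, u, hu, rfl, ht, ht'⟩
        simp only [List.mem_flatMap, List.mem_map] at hu
        obtain ⟨y, hy, u, hu, rfl⟩ := hu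
        refine ⟨t ++ [(x, y)], u, hu, by simp, by simp [ht], ?_⟩
        intro p hp
        simp only [List.mem_append, List.mem_singleton] at hp
        rcases hp with hp | rfl
        · exact ht' p hp
        · exact hy
      · rintro ⟨t, u, hu, rfl, ht, ht'⟩
        rw [List.reverse_cons] at ht
        obtain ⟨t₁, t₂, rfl, h₁, h₂⟩ := List.map_eq_append_iff.1 ht
        obtain ⟨⟨x', y⟩, t₃, rfl, rfl, h₃⟩ := List.map_eq_cons_iff.1 h₂
        simp only [List.map_eq_nil_iff] at h₃
        subst h₃
        refine ⟨t₁, (x', y) :: u, ?_, by simp, h₁, fun p hp => ht' p (by simp [hp])⟩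
        simp only [List.mem_flatMap, List.mem_map]
        exact ⟨y, ht' (x', y) (by simp), u, hu, rfl⟩
  rw [choices, key]
  constructor
  · rintro ⟨t, u, hu, rfl, h⟩
    simp only [List.mem_singleton] at hu
    subst hu
    simpa using h
  · intro h
    exact ⟨s, [], by simp, by simp, h⟩

theorem length_choices (xs : List β) (ys : List γ) :
    (choices xs ys).length = ys.length ^ xs.length := by
  have key : ∀ (xs : List β) (acc : List (List (β × γ))),
      (xs.foldl (fun acc x => ys.flatMap fun y => acc.map fun s => (x, y) :: s) acc).length =
        acc.length * ys.length ^ xs.length := by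
    intro xs
    induction xs with
    | nil => intro acc; simp
    | cons x xs ih =>
      intro acc
      rw [List.foldl_cons, ih]
      simp only [List.length_flatMap, List.length_map, List.map_const', List.sum_replicate,
        smul_eq_mul, List.length_cons]
      ring
  rw [choices, key]
  simp

theorem size_choices_le (xs : List β) (ys : List γ) :
    size (choices xs ys) ≤
      ys.length ^ xs.length * (xs.length * (size xs + size ys + 2) + 2) + 1 := by
  rw [← length_choices]
  refine size_le_of_forall fun s hs => ?_
  rw [mem_choices] at hs
  have hlen : s.length = xs.length := by simpa using congrArg List.length hs.1
  rw [← hlen]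
  refine size_le_of_forall fun p hp => ?_
  have h₁ : size p.1 ≤ size xs := by
    refine size_le_of_mem ?_
    rw [← List.mem_reverse, ← hs.1]
    exact List.mem_map_of_mem hp
  have h₂ := size_le_of_mem (hs.2 p hp)
  have h₃ : size p = size p.1 + size p.2 + 1 := size_pair p.1 p.2
  lia

/-- The fold also has to be bounded on prefixes of `xs`. The successor in the base makes the power
monotone in the exponent even when `ys` is empty. -/
theorem PT.choices {xs : α → List β} {ys : α → List γ} (hx : PT m xs) (hy : PT m ys)
    (hB : PolyB m fun a => ((ys a).length + 1) ^ (xs a).length) :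
    PT m fun a => choices (xs a) (ys a) := by
  have hg : FP fun q : (List β × List γ) × List (List (β × γ)) × β =>
      q.1.2.flatMap fun y => q.2.1.map fun s => (q.2.2, y) :: s := by
    have h₁ : FP fun r : (((List β × List γ) × List (List (β × γ)) × β) × γ) × List (β × γ) =>
        (r.1.1.2.2, r.1.2) :: r.2 := (fp_fst.fst.snd.snd.pair fp_fst.snd).cons fp_snd
    have h₂ : FP fun r : ((List β × List γ) × List (List (β × γ)) × β) × γ =>
        r.1.2.1.map fun s => (r.1.2.2, r.2) :: s := fp_fst.snd.fst.map h₁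
    exact fp_fst.snd.flatMap h₂
  let n : List β × List γ → ℕ := fun p => size p + (p.2.length + 1) ^ p.1.length
  have hn : PolyB n size := (PolyB.refl n).of_le fun _ => Nat.le_add_right _ _
  have hn' : PolyB n fun p => (p.2.length + 1) ^ p.1.length :=
    (PolyB.refl n).of_le fun _ => Nat.le_add_left _ _
  have h : PT n fun p => StackProg.choices p.1 p.2 := by
    refine PT.foldl (B := fun p => (p.2.length + 1) ^ p.1.length *
      (size p * (size p + 2) + 2) + 1) (fp_fst.mono hn) ((fp_const [[]]).mono hn) hg
      ((hn'.mul ((hn.mul (hn.add (.const 2))).add (.const 2))).add (.const 1)) ?_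
    rintro ⟨_, ys⟩ l₁ l₂ rfl
    refine (size_choices_le l₁ ys).trans (Nat.add_le_add_right (Nat.mul_le_mul
      ((Nat.pow_le_pow_left (Nat.le_succ _) _).trans
        (Nat.pow_le_pow_right (Nat.succ_pos _) (by simp)))
      (Nat.add_le_add_right (Nat.mul_le_mul ?_ ?_) _)) _)
    · have h₁ := length_lt_size l₁
      have h₂ := size_append l₁ l₂
      have h₃ := size_pos l₂
      rw [size_pair]
      lia
    · have h₂ := size_append l₁ l₂
      have h₃ := size_pos l₂
      rw [size_pair]
      lia
  exact h.comp' (hx.pair hy) ((hx.pair hy).sizeB.add hB)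

end Choices

/-! ### Exponentials absorb polynomials -/

section Bounds

/-- A base of at least `2` lets a coefficient `c` be absorbed, as `c ≤ 2 ^ c`, and it also absorbs
the factor `2` of a sum. -/
theorem exists_eval_le_pow (q : Polynomial ℕ) : ∃ k, ∀ n, q.eval n ≤ (n + 2) ^ k := by
  induction q using Polynomial.induction_on' with
  | add p q hp hq =>
    obtain ⟨k, hk⟩ := hp
    obtain ⟨l, hl⟩ := hq
    refine ⟨max k l + 1, fun n => ?_⟩
    have h₁ := (hk n).trans (Nat.pow_le_pow_right (by lia) (le_max_left k l))
    have h₂ := (hl n).trans (Nat.pow_le_pow_right (by lia) (le_max_right k l))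
    rw [Polynomial.eval_add, pow_succ]
    nlinarith [Nat.zero_le (n * (n + 2) ^ max k l)]
  | monomial j c =>
    refine ⟨c + j, fun n => ?_⟩
    rw [Polynomial.eval_monomial, pow_add]
    refine Nat.mul_le_mul ?_ (Nat.pow_le_pow_left (by lia) j)
    exact Nat.lt_two_pow_self.le.trans (Nat.pow_le_pow_left (by lia) c)

variable {α : Type} {s T : α → ℕ}

/-- A polynomial in `2 ^ p` is at most `(2 ^ p + 2) ^ k ≤ 2 ^ ((p + 2) * k)`, and the exponent is
again a polynomial. -/
theorem PolyB.le_two_pow {p : Polynomial ℕ} (h : PolyB (fun a => 2 ^ p.eval (s a)) T) :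
    ∃ q : Polynomial ℕ, ∀ a, T a ≤ 2 ^ q.eval (s a) := by
  obtain ⟨r, hr⟩ := h
  obtain ⟨k, hk⟩ := exists_eval_le_pow r
  refine ⟨(p + 2) * k, fun a => (hr a).trans ((hk _).trans ?_)⟩
  simp only [Polynomial.eval_mul, Polynomial.eval_add, Polynomial.eval_natCast,
    Polynomial.eval_ofNat, pow_mul]
  refine Nat.pow_le_pow_left ?_ k
  have := Nat.one_le_two_pow (n := p.eval (s a))
  rw [pow_add]
  lia

theorem PolyB.le_two_pow_two_pow {p : Polynomial ℕ}
    (h : PolyB (fun a => 2 ^ 2 ^ p.eval (s a)) T) :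
    ∃ q : Polynomial ℕ, ∀ a, T a ≤ 2 ^ 2 ^ q.eval (s a) := by
  obtain ⟨r, hr⟩ := h
  obtain ⟨k, hk⟩ := exists_eval_le_pow r
  refine ⟨p + 2 + k, fun a => (hr a).trans ((hk _).trans ?_)⟩
  simp only [Polynomial.eval_add, Polynomial.eval_natCast, Polynomial.eval_ofNat]
  have h₁ := Nat.one_le_two_pow (n := 2 ^ p.eval (s a))
  have h₂ := Nat.one_le_two_pow (n := p.eval (s a))
  have h₃ : k ≤ 2 ^ k := Nat.lt_two_pow_self.le
  calc (2 ^ 2 ^ p.eval (s a) + 2) ^ k ≤ (2 ^ (2 ^ p.eval (s a) + 2)) ^ k :=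
        Nat.pow_le_pow_left (by rw [pow_add]; lia) k
    _ = 2 ^ ((2 ^ p.eval (s a) + 2) * k) := (pow_mul _ _ _).symm
    _ ≤ 2 ^ 2 ^ (p.eval (s a) + 2 + k) := by
      refine Nat.pow_le_pow_right (by lia) ?_
      rw [pow_add, pow_add]
      exact Nat.mul_le_mul (by lia) h₃

theorem polyB_two_pow (p : Polynomial ℕ) (h : ∀ a, T a ≤ p.eval (s a)) (q : Polynomial ℕ) :
    PolyB (fun a => 2 ^ (q + p).eval (s a)) T :=
  (PolyB.refl _).of_le fun a => (h a).trans (Nat.lt_two_pow_self.le.trans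
    (Nat.pow_le_pow_right (by lia) (by simp)))

end Bounds

/-- A function computed in time `F (poly)`, for `F` that absorbs polynomials, is computed by a
machine in time `F (poly)`. -/
theorem PT.exists_computableInTime {α β : Type} {ea : α → List Γ'} {eb : β → List Γ'} {f : α → β}
    {F : ℕ → ℕ} (hF : Monotone F) (hF' : ∀ n, n ≤ F n)
    (hF'' : ∀ (p : Polynomial ℕ) (T : ℕ → ℕ), PolyB (fun n => F (p.eval n)) T →
      ∃ q : Polynomial ℕ, ∀ n, T n ≤ F (q.eval n))
    {p : Polynomial ℕ} (h : @PT α β (Data.via ea) (Data.via eb)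
      (fun a => F (p.eval (@size α (Data.via ea) a))) f) :
    ∃ (q : Polynomial ℕ) (M : Turing.TM2ComputableInTime ea eb f),
      ∀ n, M.time n ≤ F (q.eval n) := by
  let _ : Data α := Data.via ea
  let _ : Data β := Data.via eb
  obtain ⟨-, T, hT, r, hr⟩ := h
  obtain ⟨M, hM⟩ := Comp.computableInTime (T := fun n => r.eval (F (p.eval n))) (hT.mono hr)
    ((eval_monotone r).comp (hF.comp (eval_monotone p)))
  obtain ⟨q, hq⟩ := hF'' (p.comp (12 * .X + 1) + .X) M.time (by
    have h₁ : PolyB (fun n => F ((p.comp (12 * .X + 1) + .X).eval n)) fun n => n :=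
      (PolyB.refl _).of_le fun n => le_trans (by simp) (hF' _)
    have h₂ : PolyB (fun n => F ((p.comp (12 * .X + 1) + .X).eval n))
        fun n => r.eval (F (p.eval (12 * n + 1))) :=
      PolyB.trans ⟨r, fun _ => le_rfl⟩ ((PolyB.refl _).of_le fun n => hF (by simp))
    exact (((PolyB.mul (.const 30) h₂).add (PolyB.mul (.const 400) h₁)).add (.const 100)).of_le
      fun n => (hM n).le)
  exact ⟨q, M, hq⟩

end StackProg

/-! ## Parsing -/

namespace StackProg

open Computability

set_option linter.unusedSectionVars false

variable {α β γ : Type} [Data α] [Data β] [Data γ] {m : α → ℕ}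

/-- Only the representations of the values of a function matter. -/
theorem PT.recast {f : α → β} (hf : PT m f) {g : α → γ} (h : ∀ a, enc (g a) = enc (f a)) :
    PT m g := by
  obtain ⟨hm, T, ⟨c, hc⟩, hT⟩ := hf
  exact ⟨hm, T, ⟨c, fun a v i m x y => by rw [h]; exact hc a v i m x y⟩, hT⟩

/-- A word that begins with the code of a value. -/
structure Str (f : α → List Γ') where
  val : α
  rest : List Γ'

def Str.word {f : α → List Γ'} (s : Str f) : List Γ' := f s.val ++ s.rest

instance (f : α → List Γ') : Data (Str f) := Data.via Str.word

/-- The code `f` can be parsed in polynomial time. -/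
def Parses (f : α → List Γ') : Prop :=
  (FP fun s : Str f => (s.val, s.rest)) ∧ ∀ a, size a + 1 ≤ 4 * (f a).length

theorem fp_word (f : α → List Γ') : FP (Str.word : Str f → List Γ') := fp_cast fun _ => rfl

/-- Together with the bound `4 * length` in `Parses`, this keeps a parsed value within twice the
size of the word it was read from. -/
theorem two_mul_length_lt_size (w : List Γ') : 2 * w.length < size w := by
  induction w with
  | nil => simp
  | cons a w ih =>
    have := size_pos a
    simp only [List.length_cons, size_cons]
    lia

/-- A step of the separation of the leading bits of a word. -/
def bitsStep (s : List Bool × List Γ' × Bool) (a : Γ') : List Bool × List Γ' × Bool :=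
  bif s.2.2 then (s.1, a :: s.2.1, true)
  else bif decide (a = .comma) then (s.1, s.2.1, true)
  else (decide (a = .bit true) :: s.1, s.2.1, false)

/-- The state holds the bits and the rest of the word, both reversed, and a flag that is set by the
first comma. -/
theorem foldl_bitsStep (b : List Bool) (r : List Γ') (c : List Bool) :
    (b.map Γ'.bit ++ .comma :: r).foldl bitsStep (c, [], false) =
      (b.reverse ++ c, r.reverse, true) := by
  have h : ∀ (r t : List Γ') (c : List Bool),
      r.foldl bitsStep (c, t, true) = (c, r.reverse ++ t, true) := by
    intro r
    induction r with
    | nil => intro t c; rfl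
    | cons a r ih =>
      intro t c
      refine (ih (a :: t) c).trans ?_
      simp
  induction b generalizing c with
  | nil =>
    refine (h r [] c).trans ?_
    simp
  | cons x b ih =>
    have e : bitsStep (c, [], false) (.bit x) = (x :: c, [], false) := by cases x <;> rfl
    rw [List.map_cons, List.cons_append, List.foldl_cons, e, ih]
    simp

theorem fp_foldl_bitsStep : FP fun w : List Γ' => w.foldl bitsStep ([], [], false) := by
  have hg : FP fun q : List Γ' × (List Bool × List Γ' × Bool) × Γ' => bitsStep q.2.1 q.2.2 := by
    have hs : FP fun q : List Γ' × (List Bool × List Γ' × Bool) × Γ' => q.2.1 := fp_snd.fst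
    have ha : FP fun q : List Γ' × (List Bool × List Γ' × Bool) × Γ' => q.2.2 := fp_snd.snd
    have h₁ := hs.fst.pair ((ha.cons hs.snd.fst).pair (fp_const true))
    have h₂ := hs.fst.pair (hs.snd.fst.pair (fp_const true))
    have h₃ := ((ha.eq (fp_const (.bit true))).cons hs.fst).pair
      (hs.snd.fst.pair (fp_const false))
    exact (hs.snd.snd.cond h₁ ((ha.eq (fp_const .comma)).cond h₂ h₃)).congr fun _ => rfl
  refine PT.foldl (B := fun w => 12 * size w + 10) fp_id (fp_const _) hg
    ((PolyB.mul (.const 12) (.refl _)).add (.const 10)) ?_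
  rintro _ l₁ l₂ rfl
  have hb : ∀ b : Bool, size b ≤ 3 := by decide
  have key : ∀ (l : List Γ') (s : List Bool × List Γ' × Bool),
      size (l.foldl bitsStep s) ≤ 12 * l.length + size s.1 + size s.2.1 + 5 := by
    intro l
    induction l with
    | nil =>
      rintro ⟨b, r, o⟩
      have := hb o
      simp only [List.foldl_nil, size_pair]
      lia
    | cons a l ih =>
      rintro ⟨b, r, o⟩
      refine (ih _).trans ?_
      have h₁ := size_sym_le a
      have h₂ := hb (decide (a = .bit true))
      rw [List.length_cons]
      cases o
      · by_cases ha : a = .comma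
        · simp only [bitsStep, cond_false, ha, decide_true, cond_true]
          lia
        · simp only [bitsStep, cond_false, ha, decide_false, size_cons]
          lia
      · simp only [bitsStep, cond_true, size_cons]
        lia
  refine (key _ _).trans ?_
  have h₁ := length_lt_size l₁
  have h₂ := size_append l₁ l₂
  have h₃ := size_pos l₂
  simp only [size_nil]
  lia

theorem size_bits_le (l : List Bool) : size l ≤ 4 * l.length + 1 := by
  have hb : ∀ b : Bool, size b ≤ 3 := by decide
  induction l with
  | nil => simp
  | cons b l ih =>
    have := hb b
    simp only [size_cons, List.length_cons]
    lia

theorem parses_nat : Parses Enc.nat := by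
  constructor
  · have h : FP fun s : Str Enc.nat => s.word.foldl bitsStep ([], [], false) :=
      fp_foldl_bitsStep.comp (fp_word _)
    refine (h.fst.reverse.pair h.snd.fst.reverse).recast fun s => ?_
    have e : s.word = (encodeNat s.val).map Γ'.bit ++ .comma :: s.rest := by
      simp [Str.word, Enc.nat]
    rw [e, foldl_bitsStep]
    simp only [List.append_nil, List.reverse_reverse]
    rfl
  · intro n
    have h : size n = size (encodeNat n) := rfl
    have := size_bits_le (encodeNat n)
    simp only [Enc.nat, List.length_append, List.length_map, List.length_singleton]
    lia

/-- After the first value has been split off, the rest of the word begins with the code of the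
second. As a `Str` is represented by its word alone, regrouping the word changes nothing in memory.
-/
theorem Parses.pair {f : α → List Γ'} {g : β → List Γ'} (hf : Parses f) (hg : Parses g) :
    Parses fun p : α × β => f p.1 ++ g p.2 := by
  constructor
  · have h₁ : FP fun s : Str fun p : α × β => f p.1 ++ g p.2 =>
        (⟨s.val.1, g s.val.2 ++ s.rest⟩ : Str f) :=
      fp_cast fun s => by
        change enc (f s.val.1 ++ (g s.val.2 ++ s.rest)) = enc ((f s.val.1 ++ g s.val.2) ++ s.rest)
        rw [List.append_assoc]
    have h₂ := hf.1.comp h₁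
    have h₃ : FP fun s : Str fun p : α × β => f p.1 ++ g p.2 =>
        (⟨s.val.2, s.rest⟩ : Str g) := h₂.snd.recast fun s => rfl
    have h₄ := hg.1.comp h₃
    exact (h₂.fst.pair h₄.fst).pair h₄.snd
  · rintro ⟨a, b⟩
    have h₁ := hf.2 a
    have h₂ := hg.2 b
    simp only [size_pair, List.length_append]
    lia

theorem Parses.via {f : α → List Γ'} (hf : Parses f) (φ : β → α) {g : β → List Γ'}
    (h : ∀ b, g b = f (φ b)) : @Parses β (Data.via φ) g := by
  obtain rfl : g = fun b => f (φ b) := funext h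
  let _ : Data β := Data.via φ
  constructor
  · have h₁ : FP fun s : Str fun b => f (φ b) => (⟨φ s.val, s.rest⟩ : Str f) :=
      fp_cast fun s => rfl
    exact (hf.1.comp h₁).recast fun s => rfl
  · exact fun b => hf.2 (φ b)

/-- A step of parsing a list. -/
def listStep {f : α → List Γ'} (s : List α × Str (Enc.list f)) : List α × Str (Enc.list f) :=
  match s with
  | (_, ⟨[], _⟩) => s
  | (k, ⟨a :: l, r⟩) => (a :: k, ⟨l, r⟩)

/-- The next symbol tells a further entry (`bra`) from the end of the list (`ket`). Inside the first
branch the list is provably nonempty, so its head exists and can be parsed. -/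
theorem fp_listStep {f : α → List Γ'} (hf : Parses f) :
    FP (listStep : List α × Str (Enc.list f) → _) := by
  have hw : FP fun s : List α × Str (Enc.list f) => s.2.word := (fp_word _).comp fp_snd
  have hne : ∀ s : {s : List α × Str (Enc.list f) //
      decide (s.2.word.headD .blank = .bra) = true}, s.1.2.val ≠ [] := by
    rintro ⟨⟨k, ⟨l, r⟩⟩, hs⟩ rfl
    simp [Str.word, Enc.list] at hs
  refine (((fp_headD .blank).comp hw).eq (fp_const .bra)).dite ?_ (fp_val.recast ?_)
  · have h₁ : FP fun s : {s : List α × Str (Enc.list f) //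
        decide (s.2.word.headD .blank = .bra) = true} =>
        (⟨s.1.2.val.head (hne s), Enc.list f s.1.2.val.tail ++ s.1.2.rest⟩ : Str f) :=
      (fp_tail.comp (hw.comp fp_val)).recast fun s => by
        obtain ⟨⟨k, ⟨l, r⟩⟩, hs⟩ := s
        have hl := hne ⟨⟨k, ⟨l, r⟩⟩, hs⟩
        cases l with
        | nil => exact absurd rfl hl
        | cons a l =>
          change enc (f a ++ (Enc.list f l ++ r)) = enc ((Enc.list f (a :: l) ++ r).tail)
          simp [Enc.list]
    have h₂ := hf.1.comp h₁
    exact ((h₂.fst.cons (fp_fst.comp fp_val)).pair h₂.snd).recast fun s => by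
      obtain ⟨⟨k, ⟨l, r⟩⟩, hs⟩ := s
      have hl := hne ⟨⟨k, ⟨l, r⟩⟩, hs⟩
      cases l with
      | nil => exact absurd rfl hl
      | cons a l => rfl
  · rintro ⟨⟨k, ⟨l, r⟩⟩, hs⟩
    cases l with
    | nil => rfl
    | cons a l => simp [Str.word, Enc.list] at hs

theorem size_le_list {f : α → List Γ'} (hf : ∀ a, size a + 1 ≤ 4 * (f a).length) (l : List α) :
    size l + 1 ≤ 4 * (Enc.list f l).length := by
  induction l with
  | nil => simp [Enc.list]
  | cons a l ih =>
    have := hf a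
    simp only [size_cons, Enc.list, List.length_cons, List.length_append]
    lia

theorem length_le_length_list {f : α → List Γ'} (l : List α) :
    l.length ≤ (Enc.list f l).length := by
  induction l with
  | nil => simp
  | cons a l ih =>
    simp only [Enc.list, List.length_cons, List.length_append]
    lia

/-- The list `u` is a clock: each tick moves one entry until none is left, and later ticks are idle.
In use `u` is the word itself, which has at least one symbol per entry. -/
theorem foldl_listStep {δ : Type} {f : α → List Γ'} (u : List δ) (l k : List α) (r : List Γ') :
    ∃ l₁ l₂, l = l₁ ++ l₂ ∧ (u.length < l.length ∨ l₂ = []) ∧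
      u.foldl (fun s _ => listStep s) (k, (⟨l, r⟩ : Str (Enc.list f))) =
        (l₁.reverse ++ k, ⟨l₂, r⟩) := by
  induction u generalizing l k with
  | nil =>
    refine ⟨[], l, rfl, ?_, by simp⟩
    cases l <;> simp
  | cons d u ih =>
    cases l with
    | nil =>
      obtain ⟨l₁, l₂, h₁, h₂, h₃⟩ := ih [] k
      obtain ⟨rfl, rfl⟩ : l₁ = [] ∧ l₂ = [] := by simpa using h₁.symm
      exact ⟨[], [], rfl, .inr rfl, h₃⟩
    | cons a l =>
      obtain ⟨l₁, l₂, h₁, h₂, h₃⟩ := ih l (a :: k)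
      refine ⟨a :: l₁, l₂, by simp [h₁], by simpa using h₂, ?_⟩
      rw [List.foldl_cons]
      refine h₃.trans ?_
      simp

theorem Parses.list {f : α → List Γ'} (hf : Parses f) : Parses (Enc.list f) := by
  refine ⟨?_, size_le_list hf.2⟩
  have hx : FP fun s : Str (Enc.list f) => (([] : List α), s) := (fp_const []).pair fp_id
  have h : FP fun s : Str (Enc.list f) =>
      s.word.foldl (fun s _ => listStep s) (([] : List α), s) := by
    refine PT.foldl (g := fun q : Str (Enc.list f) × (List α × Str (Enc.list f)) × Γ' =>
      listStep q.2.1) (B := fun s => 3 * size s + 1) (fp_word _) hx ((fp_listStep hf).comp fp_snd.fst)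
      ((PolyB.mul (.const 3) (.refl _)).add (.const 1)) ?_
    rintro ⟨l, r⟩ u - -
    obtain ⟨l₁, l₂, rfl, -, h₃⟩ := foldl_listStep (f := f) u l [] r
    rw [h₃]
    have e : ∀ l₁ l₂, Enc.list f (l₁ ++ l₂) ++ r =
        (l₁.flatMap fun a => .bra :: f a) ++ (Enc.list f l₂ ++ r) := by
      intro l₁ l₂
      induction l₁ <;> simp_all [Enc.list]
    have h₀ : ∀ l, size (⟨l, r⟩ : Str (Enc.list f)) = size (Enc.list f l ++ r) := fun _ => rfl
    have h₁ := size_append (l₁.flatMap fun a => .bra :: f a) (Enc.list f l₂ ++ r)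
    have h₂ := size_append l₁ l₂
    have h₄ := size_append (Enc.list f (l₁ ++ l₂)) r
    have h₅ := size_le_list hf.2 (l₁ ++ l₂)
    have h₆ := two_mul_length_lt_size (Enc.list f (l₁ ++ l₂))
    have h₇ := size_pos l₂
    have h₈ := size_pos r
    have h₉ := size_pos (l₁.flatMap fun a => .bra :: f a)
    rw [← e] at h₁
    rw [List.append_nil, size_pair, size_reverse, h₀, h₀]
    lia
  refine (h.fst.reverse.pair (fp_tail.comp ((fp_word _).comp h.snd))).congr ?_
  rintro ⟨l, r⟩
  obtain ⟨l₁, l₂, rfl, h₂, h₃⟩ :=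
    foldl_listStep (f := f) (⟨l, r⟩ : Str (Enc.list f)).word l [] r
  have : l₂ = [] := by
    refine h₂.resolve_left ?_
    have := length_le_length_list (f := f) (l₁ ++ l₂)
    simp only [Str.word, List.length_append] at this ⊢
    lia
  subst this
  rw [h₃]
  simp [Str.word, Enc.list]

end StackProg

/-! ## Parsing of programs and instances -/

namespace StackProg

open Computability

variable {σ : Schema}

def Term.raw : Term → ℕ × ℕ
  | .var x => (0, x)
  | .const c => (1, c)

/-- The kind of a literal, its predicate symbol, and its arguments. -/
def Literal.raw : Literal σ → ℕ × ℕ × List Term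
  | .edb R t => (0, R, List.ofFn t)
  | .idb S t => (1, S.idx, List.ofFn t)
  | .eq s t => (2, 0, [s, t])
  | .negEdb R t => (3, R, List.ofFn t)
  | .neq s t => (4, 0, [s, t])

def DBFact.raw (F : DBFact σ) : ℕ × List ℕ := (F.rel, List.ofFn F.args)

def Rule.raw (r : Rule σ) : ℕ × List ℕ × List (Literal σ) :=
  (r.head.idx, List.ofFn r.headVars, r.body)

def Program.raw (P : Program σ) : List (Rule σ) × ℕ × ℕ := (P.rules, P.ans.arity, P.ans.idx)

def MAInput.raw {L : Set (Program σ)} (x : MAInput L) :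
    Program σ × List (DBFact σ) × List ℕ := (x.prog, x.facts, List.ofFn x.tup)

instance : Data Term := Data.via Term.raw
instance : Data (Literal σ) := Data.via Literal.raw
instance : Data (DBFact σ) := Data.via DBFact.raw
instance : Data (Rule σ) := Data.via Rule.raw
instance : Data (Program σ) := Data.via Program.raw
instance {L : Set (Program σ)} : Data (MAInput L) := Data.via MAInput.raw

theorem parses_term : Parses Enc.term :=
  (parses_nat.pair parses_nat).via Term.raw fun t => by cases t <;> rfl

theorem parses_fact : Parses (Enc.fact (σ := σ)) :=
  (parses_nat.pair parses_nat.list).via DBFact.raw fun _ => rfl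

/-- The code of a literal after the code of its kind. -/
def literalBody : ℕ × ℕ × List Term → List Γ'
  | (k, n, ts) => bif decide (k = 2) || decide (k = 4) then
      Enc.term (ts.getD 0 (.var 0)) ++ Enc.term (ts.getD 1 (.var 0))
    else Enc.nat n ++ Enc.list Enc.term ts

theorem literal_eq (l : Literal σ) :
    Enc.literal l = Enc.nat (Literal.raw l).1 ++ literalBody (Literal.raw l) := by
  cases l <;> rfl

/-- The kind is parsed first, since it determines the format of what follows: equalities and
inequalities are two bare terms, all others a predicate index and a list of terms. -/
theorem parses_literal : Parses (Enc.literal (σ := σ)) := by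
  constructor
  · have h₁ : FP fun s : Str (Enc.literal (σ := σ)) =>
        (⟨(Literal.raw s.val).1, literalBody (Literal.raw s.val) ++ s.rest⟩ : Str Enc.nat) :=
      fp_cast fun s => by
        change enc (Enc.nat _ ++ (literalBody _ ++ s.rest)) = enc (Enc.literal s.val ++ s.rest)
        rw [literal_eq, List.append_assoc]
    have h₂ := parses_nat.1.comp h₁
    have hb := (h₂.fst.eq (fp_const 2)).or (h₂.fst.eq (fp_const 4))
    refine hb.dite ?_ ?_
    · have h₃ : FP fun s : {s : Str (Enc.literal (σ := σ)) //
          (decide ((Literal.raw s.val).1 = 2) || decide ((Literal.raw s.val).1 = 4)) = true} =>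
          (⟨((Literal.raw s.1.val).2.2.getD 0 (.var 0), (Literal.raw s.1.val).2.2.getD 1 (.var 0)),
            s.1.rest⟩ : Str fun p : Term × Term => Enc.term p.1 ++ Enc.term p.2) :=
        (h₂.snd.comp fp_val).recast fun s => by
          obtain ⟨⟨l, r⟩, hs⟩ := s
          change enc ((Enc.term _ ++ Enc.term _) ++ r) = enc (literalBody (Literal.raw l) ++ r)
          dsimp only at hs
          rw [literalBody, hs]
          rfl
      have h₄ := (parses_term.pair parses_term).1.comp h₃
      exact (((h₂.fst.comp fp_val).pair ((fp_const 0).pair (h₄.fst.fst.cons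
        (h₄.fst.snd.cons (.nil (.refl _)))))).pair h₄.snd).recast fun s => by
          obtain ⟨⟨l, r⟩, hs⟩ := s
          cases l with
          | eq s t => rfl
          | neq s t => rfl
          | _ => simp [Literal.raw] at hs
    · have h₃ : FP fun s : {s : Str (Enc.literal (σ := σ)) //
          (decide ((Literal.raw s.val).1 = 2) || decide ((Literal.raw s.val).1 = 4)) = false} =>
          (⟨(Literal.raw s.1.val).2,
            s.1.rest⟩ : Str fun p : ℕ × List Term => Enc.nat p.1 ++ Enc.list Enc.term p.2) :=
        (h₂.snd.comp fp_val).recast fun s => by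
          obtain ⟨⟨l, r⟩, hs⟩ := s
          change enc ((Enc.nat _ ++ Enc.list Enc.term _) ++ r) =
            enc (literalBody (Literal.raw l) ++ r)
          dsimp only at hs
          rw [literalBody, hs]
          rfl
      have h₄ := (parses_nat.pair parses_term.list).1.comp h₃
      exact (((h₂.fst.comp fp_val).pair h₄.fst).pair h₄.snd).recast fun s => rfl
  · intro l
    have h : size l = size (Literal.raw l).1 + (size (Literal.raw l).2.1 +
        size (Literal.raw l).2.2 + 1) + 1 := by
      rw [← size_pair, ← size_pair]; rfl
    have h₁ := parses_nat.2 (Literal.raw l).1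
    have h₂ := parses_nat.2 (Literal.raw l).2.1
    have h₃ := parses_term.list.2 (Literal.raw l).2.2
    rw [literal_eq, List.length_append]
    cases l with
    | eq s t =>
      -- The raw form has a dummy predicate and list cells that the code lacks; the slack in the
      -- bounds for the kind and for the two terms pays for them.
      have h₄ := parses_term.2 s
      have h₅ := parses_term.2 t
      have h₆ : size (0 : ℕ) = 1 := rfl
      have h₇ : size (2 : ℕ) = 7 := by decide
      have h₈ : (Enc.nat 2).length = 3 := by decide
      have e : literalBody (Literal.raw (.eq s t : Literal σ)) = Enc.term s ++ Enc.term t := rfl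
      simp only [e, List.length_append]
      simp only [Literal.raw, size_cons, size_nil] at *
      lia
    | neq s t =>
      have h₄ := parses_term.2 s
      have h₅ := parses_term.2 t
      have h₆ : size (0 : ℕ) = 1 := rfl
      have h₇ : size (4 : ℕ) = 9 := by decide
      have h₈ : (Enc.nat 4).length = 4 := by decide
      have e : literalBody (Literal.raw (.neq s t : Literal σ)) = Enc.term s ++ Enc.term t := rfl
      simp only [e, List.length_append]
      simp only [Literal.raw, size_cons, size_nil] at *
      lia
    | edb R t =>
      have e : literalBody (Literal.raw (.edb R t : Literal σ)) =
        Enc.nat R ++ Enc.list Enc.term (List.ofFn t) := rfl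
      simp only [e, List.length_append]
      simp only [Literal.raw] at *
      lia
    | idb R t =>
      have e : literalBody (Literal.raw (.idb R t : Literal σ)) =
        Enc.nat R.idx ++ Enc.list Enc.term (List.ofFn t) := rfl
      simp only [e, List.length_append]
      simp only [Literal.raw] at *
      lia
    | negEdb R t =>
      have e : literalBody (Literal.raw (.negEdb R t : Literal σ)) =
        Enc.nat R ++ Enc.list Enc.term (List.ofFn t) := rfl
      simp only [e, List.length_append]
      simp only [Literal.raw] at *
      lia

theorem parses_rule : Parses (Enc.rule (σ := σ)) :=
  (parses_nat.pair (parses_nat.list.pair parses_literal.list)).via Rule.raw fun _ => rfl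

theorem parses_program : Parses (Enc.program (σ := σ)) :=
  (parses_rule.list.pair (parses_nat.pair parses_nat)).via Program.raw fun _ => rfl

theorem parses_input {L : Set (Program σ)} : Parses (MAInput.encode (L := L)) :=
  (parses_program.pair (parses_fact.list.pair parses_nat.list)).via MAInput.raw fun _ => rfl

end StackProg

/-! ## The algorithm -/

namespace StackProg

open Computability

variable {σ : Schema} {ι : Type} [Data ι] {m : ι → ℕ}

/-- An atom: a predicate symbol and a list of constants. -/
abbrev Atom := ℕ × List ℕ

/-- Assignments of constants to variables. -/
abbrev Asg := List (ℕ × ℕ)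

def Asg.fn (s : Asg) (x : ℕ) : ℕ := lookupD 0 s x

theorem fp_fn : FP fun p : Asg × ℕ => p.1.fn p.2 := fp_lookupD 0

theorem PT.fn {s : ι → Asg} {x : ι → ℕ}
    (hs : PT m s) (hx : PT m x) :
    PT m fun a => (s a).fn (x a) :=
  (fp_fn.comp (hs.pair hx) :)

theorem fp_eval : FP fun p : Asg × Term => p.2.eval p.1.fn := by
  have h : FP fun p : Asg × Term => Term.raw p.2 := (fp_cast fun _ => rfl).comp fp_snd
  refine ((h.fst.eq (fp_const 0)).cond (fp_fst.fn h.snd) h.snd).congr ?_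
  rintro ⟨s, x | c⟩ <;> rfl

theorem PT.eval {s : ι → Asg} {t : ι → Term}
    (hs : PT m s) (ht : PT m t) :
    PT m fun a => (t a).eval (s a).fn :=
  (fp_eval.comp (hs.pair ht) :)

/-- The truth value of a literal, given the extensional and intensional atoms that are true. -/
def rawHolds (E F : List Atom) (s : Asg) (l : ℕ × ℕ × List Term) : Bool :=
  let v := l.2.2.map fun t => t.eval s.fn
  bif decide (l.1 = 0) then memb (l.2.1, v) E
  else bif decide (l.1 = 1) then memb (l.2.1, v) F
  else bif decide (l.1 = 2) then decide (v.headD 0 = v.tail.headD 0)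
  else bif decide (l.1 = 3) then !memb (l.2.1, v) E
  else !decide (v.headD 0 = v.tail.headD 0)

theorem fp_rawHolds : FP fun p : (List Atom × List Atom) × Asg × Literal σ =>
    rawHolds p.1.1 p.1.2 p.2.1 (Literal.raw p.2.2) := by
  have hl : FP fun p : (List Atom × List Atom) × Asg × Literal σ => Literal.raw p.2.2 :=
    (fp_cast fun _ => rfl).comp fp_snd.snd
  have he : FP fun p : ((List Atom × List Atom) × Asg × Literal σ) × Term =>
      p.2.eval p.1.2.1.fn := fp_fst.snd.fst.eval fp_snd
  have hv : FP fun p : (List Atom × List Atom) × Asg × Literal σ =>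
      (Literal.raw p.2.2).2.2.map fun t => t.eval p.2.1.fn := hl.snd.snd.map he
  have ha := hl.snd.fst.pair hv
  have h₁ : FP fun p : (List Atom × List Atom) × Asg × Literal σ => p.1 := fp_fst
  have hE := ha.mem h₁.fst
  have hF := ha.mem h₁.snd
  have hq := ((fp_headD 0).comp hv).eq ((fp_headD 0).comp (fp_tail.comp hv))
  have h₃ := (hl.fst.eq (fp_const 3)).cond hE.not hq.not
  have h₂ := (hl.fst.eq (fp_const 2)).cond hq h₃
  have h₁ := (hl.fst.eq (fp_const 1)).cond hF h₂
  exact ((hl.fst.eq (fp_const 0)).cond hE h₁).congr fun _ => by unfold rawHolds; rfl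

theorem PT.rawHolds {E : ι → List Atom} {F : ι → List Atom} {s : ι → Asg} {l : ι → Literal σ}
    (hE : PT m E) (hF : PT m F) (hs : PT m s) (hl : PT m l) :
    PT m fun a => rawHolds (E a) (F a) (s a) (Literal.raw (l a)) :=
  (fp_rawHolds.comp ((hE.pair hF).pair (hs.pair hl)) :)

/-- The body of the rule is true. -/
def fires (E F : List Atom) (r : Rule σ) (s : Asg) : Bool :=
  r.body.all fun l => rawHolds E F s (Literal.raw l)

def headAtom (r : Rule σ) (s : Asg) : Atom := (r.head.idx, (List.ofFn r.headVars).map s.fn)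

/-- The immediate consequences. -/
def consequences (E F : List Atom) (rs : List (Rule σ)) (ss : List Asg) : List Atom :=
  rs.flatMap fun r => (ss.filter (fires E F r)).map (headAtom r)

/-- Everything that could ever be derived with these assignments. It bounds the size of each stage
of the fixpoint iteration, and its length is the number of rounds. -/
def allHeads (rs : List (Rule σ)) (ss : List Asg) : List Atom :=
  rs.flatMap fun r => ss.map (headAtom r)

/-- The least fixpoint. -/
def fixpoint (E : List Atom) (rs : List (Rule σ)) (ss : List Asg) : List Atom :=
  (allHeads rs ss).foldl (fun F _ => consequences E F rs ss) []

theorem fp_headAtom : FP fun p : Rule σ × Asg => headAtom p.1 p.2 := by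
  have hr : FP fun p : Rule σ × Asg => Rule.raw p.1 := (fp_cast fun _ => rfl).comp fp_fst
  have hf : FP fun p : (Rule σ × Asg) × ℕ => p.1.2.fn p.2 := fp_fst.snd.fn fp_snd
  exact (hr.fst.pair (hr.snd.fst.map hf)).congr fun _ => rfl

theorem PT.headAtom {r : ι → Rule σ} {s : ι → Asg}
    (hr : PT m r) (hs : PT m s) :
    PT m fun a => headAtom (r a) (s a) :=
  (fp_headAtom.comp (hr.pair hs) :)

theorem fp_fires : FP fun p : (List Atom × List Atom) × Rule σ × Asg =>
    fires p.1.1 p.1.2 p.2.1 p.2.2 := by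
  have hr : FP fun p : (List Atom × List Atom) × Rule σ × Asg => Rule.raw p.2.1 :=
    (fp_cast fun _ => rfl).comp fp_snd.fst
  have h : FP fun p : ((List Atom × List Atom) × Rule σ × Asg) × Literal σ =>
      rawHolds p.1.1.1 p.1.1.2 p.1.2.2 (Literal.raw p.2) :=
    fp_fst.fst.fst.rawHolds fp_fst.fst.snd fp_fst.snd.snd fp_snd
  exact (hr.snd.snd.all h).congr fun _ => rfl

theorem PT.fires {E : ι → List Atom} {F : ι → List Atom} {r : ι → Rule σ} {s : ι → Asg}
    (hE : PT m E) (hF : PT m F) (hr : PT m r) (hs : PT m s) :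
    PT m fun a => fires (E a) (F a) (r a) (s a) :=
  (fp_fires.comp ((hE.pair hF).pair (hr.pair hs)) :)

theorem fp_consequences : FP fun p : (List Atom × List Atom) × List (Rule σ) × List Asg =>
    consequences p.1.1 p.1.2 p.2.1 p.2.2 := by
  have h₁ : FP fun q : (((List Atom × List Atom) × List (Rule σ) × List Asg) × Rule σ) × Asg =>
      headAtom q.1.2 q.2 := fp_fst.snd.headAtom fp_snd
  have h₂ : FP fun q : (((List Atom × List Atom) × List (Rule σ) × List Asg) × Rule σ) × Asg =>
      fires q.1.1.1.1 q.1.1.1.2 q.1.2 q.2 :=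
    fp_fst.fst.fst.fst.fires fp_fst.fst.fst.snd fp_fst.snd fp_snd
  have h₃ : FP fun q : ((List Atom × List Atom) × List (Rule σ) × List Asg) × Rule σ =>
      (q.1.2.2.filter (fires q.1.1.1 q.1.1.2 q.2)).map (headAtom q.2) :=
    (fp_fst.snd.snd.filter h₂).map h₁
  exact (fp_snd.fst.flatMap h₃).congr fun _ => rfl

theorem PT.consequences {E : ι → List Atom} {F : ι → List Atom} {r : ι → List (Rule σ)} {s : ι → List Asg}
    (hE : PT m E) (hF : PT m F) (hr : PT m r) (hs : PT m s) :
    PT m fun a => consequences (E a) (F a) (r a) (s a) :=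
  (fp_consequences.comp ((hE.pair hF).pair (hr.pair hs)) :)

theorem fp_allHeads : FP fun p : List (Rule σ) × List Asg => allHeads p.1 p.2 := by
  have h₁ : FP fun q : ((List (Rule σ) × List Asg) × Rule σ) × Asg =>
      headAtom q.1.2 q.2 := fp_fst.snd.headAtom fp_snd
  have h₃ : FP fun q : (List (Rule σ) × List Asg) × Rule σ =>
      q.1.2.map (headAtom q.2) := fp_fst.snd.map h₁
  exact (fp_fst.flatMap h₃).congr fun _ => rfl

theorem PT.allHeads {r : ι → List (Rule σ)} {s : ι → List Asg}
    (hr : PT m r) (hs : PT m s) :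
    PT m fun a => allHeads (r a) (s a) :=
  (fp_allHeads.comp (hr.pair hs) :)

theorem size_sublist {α : Type} [Data α] {l k : List α} (h : l.Sublist k) : size l ≤ size k := by
  induction h with
  | slnil => rfl
  | cons a _ ih => rw [size_cons]; lia
  | cons_cons a _ ih => rw [size_cons, size_cons]; lia

/-- Rules and assignments are scanned in the same order in both lists; filtering only omits entries.
-/
theorem consequences_sublist (E F : List Atom) (rs : List (Rule σ)) (ss : List Asg) :
    (consequences E F rs ss).Sublist (allHeads rs ss) := by
  induction rs with
  | nil => exact List.Sublist.refl _
  | cons r rs ih => exact ((List.filter_sublist).map _).append ih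

theorem fp_fixpoint : FP fun p : List Atom × List (Rule σ) × List Asg =>
    fixpoint p.1 p.2.1 p.2.2 := by
  have hg : FP fun q : (List Atom × List (Rule σ) × List Asg) × List Atom × Atom =>
      consequences q.1.1 q.2.1 q.1.2.1 q.1.2.2 :=
    fp_fst.fst.consequences fp_snd.fst fp_fst.snd.fst fp_fst.snd.snd
  have hh : FP fun p : List Atom × List (Rule σ) × List Asg => allHeads p.2.1 p.2.2 :=
    fp_snd.fst.allHeads fp_snd.snd
  refine PT.foldl (B := fun p => size (allHeads p.2.1 p.2.2) + 1) hh (.nil (.refl _)) hg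
    (hh.sizeB.add (.const 1)) ?_
  rintro p l₁ - -
  rcases l₁.eq_nil_or_concat with rfl | ⟨l, a, rfl⟩
  · simp
  · rw [List.concat_eq_append, List.foldl_append]
    exact (size_sublist (consequences_sublist _ _ _ _)).trans (Nat.le_succ _)

theorem PT.fixpoint {E : ι → List Atom} {r : ι → List (Rule σ)} {s : ι → List Asg}
    (hE : PT m E) (hr : PT m r) (hs : PT m s) :
    PT m fun a => fixpoint (E a) (r a) (s a) :=
  (fp_fixpoint.comp (hE.pair (hr.pair hs)) :)

/-- Lists of length `k`. -/
def words (D : List ℕ) : ℕ → List (List ℕ)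
  | 0 => [[]]
  | k + 1 => D.flatMap fun a => (words D k).map fun w => a :: w

theorem mem_words {D : List ℕ} {k : ℕ} {w : List ℕ} :
    w ∈ words D k ↔ w.length = k ∧ ∀ a ∈ w, a ∈ D := by
  induction k generalizing w with
  | zero => simp +contextual [words]
  | succ k ih =>
    simp only [words, List.mem_flatMap, List.mem_map, ih]
    constructor
    · rintro ⟨a, ha, w, ⟨rfl, hw⟩, rfl⟩
      simpa using ⟨ha, hw⟩
    · rintro ⟨h, hw⟩
      cases w with
      | nil => simp at h
      | cons a w =>
        exact ⟨a, hw a (by simp), w, ⟨by simpa using h, fun b hb => hw b (by simp [hb])⟩, rfl⟩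

/-- The exponent `k` is fixed in advance. It will be an arity of the schema, and this is where
fixing the schema keeps the number of facts polynomial. -/
theorem fp_words (k : ℕ) : FP fun D : List ℕ => words D k := by
  induction k with
  | zero => exact fp_const [[]]
  | succ k ih =>
    have h : FP fun q : (List ℕ × ℕ) × List ℕ => q.1.2 :: q.2 := fp_fst.snd.cons fp_snd
    have h' : FP fun q : List ℕ × ℕ => (words q.1 k).map fun w => q.2 :: w :=
      (ih.comp fp_fst).map h
    exact fp_id.flatMap h'

/-- Remove duplicates. -/
def dedupl {α : Type} [DecidableEq α] (l : List α) : List α :=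
  l.foldl (fun s a => bif memb a s then s else a :: s) []

theorem dedupl_spec {α : Type} [DecidableEq α] (l : List α) :
    (dedupl l).Nodup ∧ ∀ a, a ∈ dedupl l ↔ a ∈ l := by
  have key : ∀ (l s : List α), s.Nodup →
      (l.foldl (fun s a => bif memb a s then s else a :: s) s).Nodup ∧
        ∀ a, a ∈ l.foldl (fun s a => bif memb a s then s else a :: s) s ↔ a ∈ s ∨ a ∈ l := by
    intro l
    induction l with
    | nil => intro s hs; simpa using hs
    | cons a l ih =>
      intro s hs
      rw [List.foldl_cons]
      by_cases h : a ∈ s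
      · rw [memb_iff.2 h, cond_true]
        refine ⟨(ih s hs).1, fun b => ?_⟩
        rw [(ih s hs).2, List.mem_cons]
        constructor
        · tauto
        · rintro (h' | rfl | h') <;> tauto
      · rw [Bool.eq_false_iff.2 (mt memb_iff.1 h), cond_false]
        have hs' : (a :: s).Nodup := List.nodup_cons.2 ⟨h, hs⟩
        refine ⟨(ih _ hs').1, fun b => ?_⟩
        rw [(ih _ hs').2, List.mem_cons, List.mem_cons]
        tauto
  have := key l [] List.nodup_nil
  refine ⟨this.1, fun a => (this.2 a).trans (by simp)⟩

theorem fp_dedupl {α : Type} [Data α] [DecidableEq α] [EqData α] :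
    FP (dedupl : List α → List α) := by
  have hg : FP fun q : List α × List α × α =>
      bif memb q.2.2 q.2.1 then q.2.1 else q.2.2 :: q.2.1 :=
    (fp_snd.snd.mem fp_snd.fst).cond fp_snd.fst (fp_snd.snd.cons fp_snd.fst)
  refine PT.foldl (x := fun _ => []) (B := size) fp_id (.nil (.refl _)) hg (.refl _) ?_
  rintro _ l₁ l₂ rfl
  have key : ∀ (l s : List α),
      size (l.foldl (fun s a => bif memb a s then s else a :: s) s) + 1 ≤
        size l + size s := by
    intro l
    induction l with
    | nil => intro s; simp
    | cons a l ih =>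
      intro s
      have := ih (bif memb a s then s else a :: s)
      rw [List.foldl_cons]
      rw [size_cons]
      cases h : memb a s
      · rw [h, cond_false, size_cons] at this
        rw [cond_false]
        lia
      · rw [h, cond_true] at this
        rw [cond_true]
        lia
  have h₁ := key l₁ []
  have h₂ := size_append l₁ l₂
  have h₃ := size_pos l₂
  rw [size_nil] at h₁
  lia

/-- All facts with constants in `D`, without repetitions. -/
def allFacts (σ : Schema) (D : List ℕ) : List Atom :=
  dedupl ((List.finRange σ.n).flatMap fun R => (words D (σ.arity R)).map fun w => ((R : ℕ), w))

/-- The relations are finitely many and known beforehand, so the recursion over them builds the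
program rather than running in it. -/
theorem fp_allFacts : FP (allFacts σ) := by
  have h : ∀ Rs : List (Fin σ.n), FP fun D : List ℕ =>
      Rs.flatMap fun R => (words D (σ.arity R)).map fun w => ((R : ℕ), w) := by
    intro Rs
    induction Rs with
    | nil => exact fp_const []
    | cons R Rs ih =>
      have h₁ : FP fun q : List ℕ × List ℕ => ((R : ℕ), q.2) := (fp_const (R : ℕ)).pair fp_snd
      exact ((fp_words (σ.arity R)).map h₁).append ih
  exact fp_dedupl.comp (h _)

/-- All sets of facts with constants in `D`. -/
def candidates (σ : Schema) (D : List ℕ) : List (List Atom) :=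
  (choices (allFacts σ D) [false, true]).map fun c => (c.filter Prod.snd).map Prod.fst

/-- The facts in which two sets of facts differ. -/
def differences (all I J : List Atom) : List Atom :=
  all.filter fun q => (memb q J && !(memb q I)) || (memb q I && !(memb q J))

/-- An element of the list with the fewest differences. -/
def argmin (all I : List Atom) (Js : List (List Atom)) : List Atom :=
  Js.foldl (fun b J => bif decide ((differences all I J).length ≤ (differences all I b).length)
    then J else b) (Js.headD [])

theorem fp_differences :
    FP fun p : (List Atom × List Atom) × List Atom => differences p.1.1 p.1.2 p.2 := by
  have h : FP fun q : ((List Atom × List Atom) × List Atom) × Atom => memb q.2 q.1.2 :=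
    fp_snd.mem fp_fst.snd
  have h' : FP fun q : ((List Atom × List Atom) × List Atom) × Atom => memb q.2 q.1.1.2 :=
    fp_snd.mem fp_fst.fst.snd
  have hf := (h.and h'.not).or (h'.and h.not)
  exact fp_fst.fst.filter hf

theorem PT.differences {u : ι → List Atom} {I : ι → List Atom} {J : ι → List Atom}
    (hu : PT m u) (hI : PT m I) (hJ : PT m J) :
    PT m fun a => differences (u a) (I a) (J a) :=
  (fp_differences.comp ((hu.pair hI).pair hJ) :)

/-- The start value is arbitrary, which makes the induction work; the lemma bounds the accumulator
of the fold and shows that the result is a candidate. -/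
theorem argmin_mem (all I : List Atom) (Js : List (List Atom)) (b : List Atom) :
    Js.foldl (fun b J => bif decide ((differences all I J).length ≤ (differences all I b).length)
      then J else b) b ∈ b :: Js := by
  induction Js generalizing b with
  | nil => simp
  | cons J Js ih =>
    rw [List.foldl_cons]
    have := ih (bif decide ((differences all I J).length ≤ (differences all I b).length)
      then J else b)
    rcases List.mem_cons.1 this with h | h
    · rw [h]
      cases decide ((differences all I J).length ≤ (differences all I b).length) <;> simp
    · exact List.mem_cons_of_mem _ (List.mem_cons_of_mem _ h)

theorem fp_argmin :
    FP fun p : (List Atom × List Atom) × List (List Atom) => argmin p.1.1 p.1.2 p.2 := by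
  have h₁ : FP fun q : ((List Atom × List Atom) × List (List Atom)) × List Atom × List Atom =>
      differences q.1.1.1 q.1.1.2 q.2.2 := fp_fst.fst.fst.differences fp_fst.fst.snd fp_snd.snd
  have h₂ : FP fun q : ((List Atom × List Atom) × List (List Atom)) × List Atom × List Atom =>
      differences q.1.1.1 q.1.1.2 q.2.1 := fp_fst.fst.fst.differences fp_fst.fst.snd fp_snd.fst
  have hg := (h₁.length_le h₂).cond fp_snd.snd fp_snd.fst
  refine PT.foldl (B := fun p => size p.2 + 1) fp_snd ((fp_headD []).comp fp_snd) hg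
    (fp_snd.sizeB.add (.const 1)) ?_
  rintro ⟨⟨all, I⟩, Js⟩ l₁ l₂ h
  have h' := argmin_mem all I l₁ (Js.headD [])
  have hJ : ∀ J ∈ Js.headD [] :: l₁, size J ≤ size Js + 1 := by
    intro J hJ
    have : J ∈ Js ∨ J = [] := by
      dsimp only at h
      rcases List.mem_cons.1 hJ with rfl | hJ
      · cases Js <;> simp
      · exact .inl (by simp [h, hJ])
    rcases this with hJ | rfl
    · exact (size_le_of_mem hJ).trans (Nat.le_succ _)
    · simp
  exact hJ _ h'

/-- The candidates from which the goal can be derived. -/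
def goodCandidates (cs : List (List Atom)) (rs : List (Rule σ)) (ss : List Asg) (goal : Atom) :
    List (List Atom) :=
  cs.filter fun J => memb goal (fixpoint J rs ss)

theorem fp_goodCandidates :
    FP fun p : List (List Atom) × (List (Rule σ) × List Asg) × Atom =>
      goodCandidates p.1 p.2.1.1 p.2.1.2 p.2.2 := by
  have h : FP fun q : (List (List Atom) × (List (Rule σ) × List Asg) × Atom) × List Atom =>
      fixpoint q.2 q.1.2.1.1 q.1.2.1.2 :=
    fp_snd.fixpoint fp_fst.snd.fst.fst fp_fst.snd.fst.snd
  have h' : FP fun q : (List (List Atom) × (List (Rule σ) × List Asg) × Atom) × List Atom =>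
      memb q.1.2.2 (fixpoint q.2 q.1.2.1.1 q.1.2.1.2) := fp_fst.snd.snd.mem h
  exact (fp_fst.filter h').congr fun _ => rfl

theorem PT.goodCandidates {c : ι → List (List Atom)} {r : ι → List (Rule σ)} {s : ι → List Asg} {g : ι → Atom}
    (hc : PT m c) (hr : PT m r) (hs : PT m s) (hg : PT m g) :
    PT m fun a => goodCandidates (c a) (r a) (s a) (g a) :=
  (fp_goodCandidates.comp (hc.pair ((hr.pair hs).pair hg)) :)

/-- The facts to be inserted and deleted in order to obtain `J` from `I`. -/
def updateLists (all I J : List Atom) : List Atom × List Atom :=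
  (all.filter fun q => memb q J && !(memb q I),
    all.filter fun q => memb q I && !(memb q J))

theorem fp_updateLists :
    FP fun p : (List Atom × List Atom) × List Atom => updateLists p.1.1 p.1.2 p.2 := by
  have h : FP fun q : ((List Atom × List Atom) × List Atom) × Atom => memb q.2 q.1.2 :=
    fp_snd.mem fp_fst.snd
  have h' : FP fun q : ((List Atom × List Atom) × List Atom) × Atom => memb q.2 q.1.1.2 :=
    fp_snd.mem fp_fst.fst.snd
  exact (fp_fst.fst.filter (h.and h'.not)).pair (fp_fst.fst.filter (h'.and h.not))

theorem PT.updateLists {u : ι → List Atom} {I : ι → List Atom} {J : ι → List Atom}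
    (hu : PT m u) (hI : PT m I) (hJ : PT m J) :
    PT m fun a => updateLists (u a) (I a) (J a) :=
  (fp_updateLists.comp ((hu.pair hI).pair hJ) :)

def encodeAtom (q : Atom) : List Γ' := Enc.nat q.1 ++ Enc.list Enc.nat q.2

/-- Encode the update that leads to the best good candidate. -/
def answerWord (all I : List Atom) (good : List (List Atom)) : List Γ' :=
  bif good.isEmpty then []
  else
    let u := updateLists all I (argmin all I good)
    Enc.list encodeAtom u.1 ++ Enc.list encodeAtom u.2

theorem encList_eq {α : Type} (f : α → List Γ') (l : List α) :
    Enc.list f l = (l.flatMap fun a => .bra :: f a) ++ [.ket] := by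
  induction l <;> simp_all [Enc.list]

theorem PT.encList {α β : Type} [Data α] [Data β] {m : α → ℕ} {f : β → List Γ'} {l : α → List β}
    (hl : PT m l) (hf : FP f) : PT m fun a => Enc.list f (l a) := by
  have h : FP fun q : α × β => .bra :: f q.2 := (fp_const Γ'.bra).cons (hf.comp fp_snd)
  exact ((hl.flatMap h).append ((fp_const [Γ'.ket]).mono hl.1)).congr fun a => encList_eq f (l a)

theorem fp_encNat : FP Enc.nat := by
  have h : FP fun b : Bool => Γ'.bit b :=
    (fp_id.cond (fp_const (.bit true)) (fp_const (.bit false))).congr fun b => by cases b <;> rfl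
  have h₁ : FP encodeNat := fp_cast fun _ => rfl
  have h₂ : FP fun q : ℕ × Bool => Γ'.bit q.2 := h.comp fp_snd
  exact (h₁.map h₂).append (fp_const [Γ'.comma])

theorem fp_answerWord :
    FP fun p : (List Atom × List Atom) × List (List Atom) => answerWord p.1.1 p.1.2 p.2 := by
  have h : FP encodeAtom := (fp_encNat.comp fp_fst).append (fp_snd.encList fp_encNat)
  have hu : FP fun p : (List Atom × List Atom) × List (List Atom) =>
      updateLists p.1.1 p.1.2 (argmin p.1.1 p.1.2 p.2) :=
    fp_fst.fst.updateLists fp_fst.snd fp_argmin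
  exact (fp_isEmpty.comp fp_snd).cond (fp_const []) ((hu.fst.encList h).append (hu.snd.encList h))

theorem PT.answerWord {u : ι → List Atom} {I : ι → List Atom} {J : ι → List (List Atom)}
    (hu : PT m u) (hI : PT m I) (hJ : PT m J) :
    PT m fun a => answerWord (u a) (I a) (J a) :=
  (fp_answerWord.comp ((hu.pair hI).pair hJ) :)

/-- The whole algorithm, for given lists of variables and of constants. -/
def solve (x : Program σ × List (DBFact σ) × List ℕ) (V D : List ℕ) : List Γ' :=
  answerWord (allFacts σ D) (x.2.1.map DBFact.raw)
    (goodCandidates (candidates σ D) x.1.rules (choices V D) (x.1.ans.idx, x.2.2))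

/-- There are at most `|D| ^ |V|` assignments and two to the number of facts candidates, both single
exponential; everything else is polynomial in these lists. -/
theorem pt_solve : ∃ p : Polynomial ℕ,
    PT (fun q : (Program σ × List (DBFact σ) × List ℕ) × List ℕ × List ℕ => 2 ^ p.eval (size q))
      fun q => solve q.1 q.2.1 q.2.2 := by
  obtain ⟨r, hr⟩ := (fp_allFacts (σ := σ)).sizeB
  let Q := (Program σ × List (DBFact σ) × List ℕ) × List ℕ × List ℕ
  -- The square pays for the assignments, as `(|D| + 1) ^ |V| ≤ 2 ^ (|D| * |V|)`. The term `2 * r`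
  -- pays for the candidates, as `3 ^ f ≤ 2 ^ (2 * f)` with `f ≤ r` the number of facts; the base is
  -- `3` because `PT.choices` adds one to the two truth values. The last term dominates the size
  -- itself.
  let p : Polynomial ℕ := .X ^ 2 + 2 * r + .X
  let m : Q → ℕ := fun q => 2 ^ p.eval (size q)
  refine ⟨p, ?_⟩
  change PT m _
  have hm : PolyB m size := polyB_two_pow .X (fun a => by simp) _
  have hV : PT m fun q : Q => q.2.1 := fp_snd.fst.mono hm
  have hD : PT m fun q : Q => q.2.2 := fp_snd.snd.mono hm
  have hP : PT m fun q : Q => Program.raw q.1.1 := ((fp_cast fun _ => rfl).comp fp_fst.fst).mono hm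
  have hsD : ∀ q : Q, size q.2.2 ≤ size q := fun q => by
    have h₁ := size_pair q.1 q.2
    have h₂ := size_pair q.2.1 q.2.2
    have h₃ : size q = size (q.1, q.2) := rfl
    have h₄ : size q.2 = size (q.2.1, q.2.2) := rfl
    lia
  have hsV : ∀ q : Q, size q.2.1 ≤ size q := fun q => by
    have h₁ := size_pair q.1 q.2
    have h₂ := size_pair q.2.1 q.2.2
    have h₃ : size q = size (q.1, q.2) := rfl
    have h₄ : size q.2 = size (q.2.1, q.2.2) := rfl
    lia
  have hI : PT m fun q : Q => q.1.2.1.map DBFact.raw := by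
    have h : FP fun q : Q × DBFact σ => DBFact.raw q.2 := (fp_cast fun _ => rfl).comp fp_snd
    exact (fp_fst.snd.fst.mono hm).map h
  have hasg : PT m fun q : Q => choices q.2.1 q.2.2 := by
    refine hV.choices hD ((PolyB.refl m).of_le fun q => ?_)
    refine (Nat.pow_le_pow_left Nat.lt_two_pow_self _).trans ?_
    rw [← pow_mul]
    refine Nat.pow_le_pow_right (by lia) ?_
    have h₁ := (length_lt_size q.2.2).le.trans (hsD q)
    have h₂ := (length_lt_size q.2.1).le.trans (hsV q)
    have := Nat.mul_le_mul h₁ h₂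
    simp only [p, Polynomial.eval_add, Polynomial.eval_pow, Polynomial.eval_X,
      Polynomial.eval_mul, Polynomial.eval_ofNat]
    rw [pow_two]
    lia
  have hall : PT m fun q : Q => allFacts σ q.2.2 := fp_allFacts.comp hD
  have hcand : PT m fun q : Q => candidates σ q.2.2 := by
    have h₁ : FP fun q : (Q × List (Atom × Bool)) × Atom × Bool => q.2.2 := fp_snd.snd
    have h₂ : FP fun q : (Q × List (Atom × Bool)) × Atom × Bool => q.2.1 := fp_snd.fst
    have h₃ : FP fun q : Q × List (Atom × Bool) => (q.2.filter Prod.snd).map Prod.fst :=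
      (fp_snd.filter h₁).map h₂
    refine PT.map (PT.choices hall ((fp_const [false, true]).mono hm)
      ((PolyB.refl m).of_le fun q => ?_)) h₃
    change 3 ^ _ ≤ 2 ^ _
    refine (Nat.pow_le_pow_left (by lia : 3 ≤ 2 ^ 2) _).trans ?_
    rw [← pow_mul]
    refine Nat.pow_le_pow_right (by lia) ?_
    have h₁ := (length_lt_size (allFacts σ q.2.2)).le.trans
      ((hr q.2.2).trans (eval_monotone r (hsD q)))
    simp only [p, Polynomial.eval_add, Polynomial.eval_pow, Polynomial.eval_X,
      Polynomial.eval_mul, Polynomial.eval_ofNat]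
    dsimp only at h₁
    lia
  have hgoal : PT m fun q : Q => (q.1.1.ans.idx, q.1.2.2) :=
    hP.snd.snd.pair (fp_fst.snd.snd.mono hm)
  have hgood : PT m fun q : Q => goodCandidates (candidates σ q.2.2) q.1.1.rules
      (choices q.2.1 q.2.2) (q.1.1.ans.idx, q.1.2.2) :=
    hcand.goodCandidates hP.fst hasg hgoal
  exact hall.answerWord hI hgood

end StackProg

/-! ## Running times -/

namespace StackProg

open Computability

variable {σ : Schema} {ι : Type} [Data ι] {m : ι → ℕ}

/-- The program, the facts and the tuple. -/
abbrev RawInput (σ : Schema) := Program σ × List (DBFact σ) × List ℕ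

def litNumbers (l : Literal σ) : List ℕ := (Literal.raw l).2.2.map fun t => (Term.raw t).2

/-- The leading `0` makes every rule contribute at least one entry, so that `length_rules_le` holds.
-/
def ruleNumbers (r : Rule σ) : List ℕ :=
  0 :: (List.ofFn r.headVars ++ r.body.flatMap litNumbers)

/-- The variables and constants of the input, with at least one number for each rule. -/
def numbers (x : RawInput σ) : List ℕ :=
  0 :: (x.2.2 ++ (x.2.1.flatMap fun F => List.ofFn F.args) ++ x.1.rules.flatMap ruleNumbers)

theorem fp_litNumbers : FP (litNumbers : Literal σ → List ℕ) := by
  have hl : FP fun l : Literal σ => Literal.raw l := fp_cast fun _ => rfl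
  have ht : FP fun t : Term => Term.raw t := fp_cast fun _ => rfl
  have h : FP fun q : Literal σ × Term => (Term.raw q.2).2 := (ht.comp fp_snd).snd
  exact hl.snd.snd.map h

theorem fp_ruleNumbers : FP (ruleNumbers : Rule σ → List ℕ) := by
  have hr : FP fun r : Rule σ => Rule.raw r := fp_cast fun _ => rfl
  have h : FP fun q : Rule σ × Literal σ => litNumbers q.2 := fp_litNumbers.comp fp_snd
  exact ((fp_const 0).cons (hr.snd.fst.append (hr.snd.snd.flatMap h))).congr fun _ => rfl

theorem fp_numbers : FP (numbers : RawInput σ → List ℕ) := by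
  have hP : FP fun x : RawInput σ => Program.raw x.1 := (fp_cast fun _ => rfl).comp fp_fst
  have hF : FP fun F : DBFact σ => DBFact.raw F := fp_cast fun _ => rfl
  have h : FP fun q : RawInput σ × Rule σ => ruleNumbers q.2 := fp_ruleNumbers.comp fp_snd
  have h' : FP fun q : RawInput σ × DBFact σ => (DBFact.raw q.2).2 := (hF.comp fp_snd).snd
  have h₁ : FP fun x : RawInput σ => x.2.2 := fp_snd.snd
  have h₂ : FP fun x : RawInput σ => x.2.1 := fp_snd.fst
  exact ((fp_const 0).cons ((h₁.append (h₂.flatMap h')).append (hP.fst.flatMap h))).congr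
    fun _ => rfl

/-- The positive number with the binary code `w ++ [true]`. -/
def posOfBits : List Bool → PosNum
  | [] => .one
  | false :: w => .bit0 (posOfBits w)
  | true :: w => .bit1 (posOfBits w)

def natOfBits (w : List Bool) : ℕ := (posOfBits w : ℕ)

/-- The final `true` is the leading binary digit, so every word of bits, with zeros anywhere,
becomes the code of a number, and different words give different numbers. -/
theorem encodeNat_natOfBits (w : List Bool) : encodeNat (natOfBits w) = w ++ [true] := by
  have h : encodePosNum (posOfBits w) = w ++ [true] := by
    induction w with
    | nil => rfl
    | cons b w ih => cases b <;> simp [posOfBits, encodePosNum, ih]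
  rw [← h, encodeNat, natOfBits, PosNum.of_to_nat]
  rfl

theorem natOfBits_injective : Function.Injective natOfBits := by
  intro v w h
  have := encodeNat_natOfBits v
  rw [h, encodeNat_natOfBits] at this
  exact List.append_cancel_right this.symm

/-- Numbers are represented by their binary digits, so the conversion merely appends a digit. -/
theorem fp_natOfBits : FP natOfBits :=
  (fp_id.append (fp_const [true])).recast fun w => congrArg enc (encodeNat_natOfBits w)

/-- Many numbers: those with `c` binary digits, where `c` is a power of the length of `xs`. -/
def manyNumbers (k : ℕ) (xs : List ℕ) : List ℕ :=
  (choices (words (0 :: 0 :: xs) k) [false, true]).map fun c => natOfBits (c.map Prod.snd)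

theorem length_words (D : List ℕ) (k : ℕ) : (words D k).length = D.length ^ k := by
  induction k with
  | zero => rfl
  | succ k ih => simp [words, ih, pow_succ, mul_comm]

/-- The `(xs.length + 2) ^ k` words over `0 :: 0 :: xs` are used only as positions: each way to
place bits there gives a different number. The two extra entries match the base `n + 2` in
`exists_domainSize_le`. -/
theorem le_card_manyNumbers (k : ℕ) (xs : List ℕ) :
    2 ^ (xs.length + 2) ^ k ≤ (manyNumbers k xs).toFinset.card := by
  have h : ((Finset.univ : Finset (Fin ((xs.length + 2) ^ k) → Bool)).image
      fun b => natOfBits (List.ofFn b)).card = 2 ^ (xs.length + 2) ^ k := by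
    rw [Finset.card_image_of_injective _
      fun _ _ h => List.ofFn_injective (natOfBits_injective h)]
    simp
  rw [← h]
  refine Finset.card_le_card fun n hn => ?_
  obtain ⟨b, -, rfl⟩ := Finset.mem_image.1 hn
  have hl : (words (0 :: 0 :: xs) k).reverse.length = (List.ofFn b).length := by
    rw [List.length_reverse, length_words, List.length_ofFn]
    rfl
  refine List.mem_toFinset.2 (List.mem_map.2
    ⟨(words (0 :: 0 :: xs) k).reverse.zip (List.ofFn b), mem_choices.2 ⟨?_, ?_⟩, ?_⟩)
  · exact List.map_fst_zip hl.le
  · rintro ⟨u, _ | _⟩ - <;> simp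
  · rw [List.map_snd_zip hl.ge]

theorem pt_manyNumbers (k : ℕ) : ∃ p : Polynomial ℕ,
    PT (fun xs => 2 ^ p.eval (size xs)) (manyNumbers k) := by
  have hw : FP fun xs : List ℕ => words (0 :: 0 :: xs) k :=
    (fp_words k).comp ((fp_const 0).cons ((fp_const 0).cons fp_id))
  obtain ⟨r, hr⟩ := hw.sizeB
  have hm : PolyB (fun xs : List ℕ => 2 ^ (2 * r + .X : Polynomial ℕ).eval (size xs)) size :=
    polyB_two_pow .X (fun a => by simp) _
  have h : FP fun q : List ℕ × List (List ℕ × Bool) => natOfBits (q.2.map Prod.snd) := by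
    have h₁ : FP fun q : (List ℕ × List (List ℕ × Bool)) × List ℕ × Bool => q.2.2 := fp_snd.snd
    exact fp_natOfBits.comp (fp_snd.map h₁)
  have hc : PT (fun xs : List ℕ => 2 ^ (2 * r + .X : Polynomial ℕ).eval (size xs))
      fun xs => choices (words (0 :: 0 :: xs) k) [false, true] := by
    refine PT.choices (hw.mono hm) ((fp_const [false, true]).mono hm)
      ((PolyB.refl _).of_le fun xs => ?_)
    have h₁ := (length_lt_size (words (0 :: 0 :: xs) k)).le.trans (hr xs)
    have h₂ : 2 * (words (0 :: 0 :: xs) k).length ≤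
        (2 * r + .X : Polynomial ℕ).eval (size xs) := by
      simp only [Polynomial.eval_add, Polynomial.eval_X, Polynomial.eval_mul,
        Polynomial.eval_ofNat]
      lia
    refine le_trans ?_ (Nat.pow_le_pow_right (by lia) h₂)
    rw [pow_mul]
    exact Nat.pow_le_pow_left (by simp) _
  exact ⟨_, (hc.map h).congr fun _ => rfl⟩

/-- The inputs, presented by their codes. -/
def CodedInput (L : Set (Program σ)) : Type := MAInput L

instance (L : Set (Program σ)) : Data (CodedInput L) := Data.via MAInput.encode

/-- An input word is a code followed by the empty rest, to which the parser applies. -/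
theorem fp_decode (L : Set (Program σ)) : FP fun x : CodedInput L => MAInput.raw x := by
  have h₁ : FP fun x : CodedInput L => (⟨x, []⟩ : Str (MAInput.encode (L := L))) :=
    fp_cast fun x => congrArg enc (List.append_nil (MAInput.encode (L := L) x))
  have h₂ : FP fun x : MAInput L => MAInput.raw x := fp_cast fun _ => rfl
  exact h₂.comp (((parses_input (L := L)).1.comp h₁).fst)

/-- If the algorithm is correct over the domain `D`, then its running time is determined by
that of the computation of `D`. -/
theorem solvableInTime {L : Set (Program σ)} {D : RawInput σ → List ℕ}
    {F : ℕ → ℕ} (hF : Monotone F) (hF' : ∀ n, n ≤ F n)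
    (hF'' : ∀ (p : Polynomial ℕ) (T : ℕ → ℕ), PolyB (fun n => F (p.eval n)) T →
      ∃ q : Polynomial ℕ, ∀ n, T n ≤ F (q.eval n))
    (hD : ∀ r : Polynomial ℕ, ∃ p : Polynomial ℕ,
      PT (fun x => F (p.eval (size x))) D ∧
      PolyB (fun x => F (p.eval (size x))) fun x => 2 ^ r.eval (size (x, numbers x, D x)))
    (h : ∀ x : MAInput L, ∃ y : MAOutput σ, MAOutput.encode y =
      solve (MAInput.raw x) (numbers (MAInput.raw x)) (D (MAInput.raw x)) ∧ MAOutput.IsSolution x y) :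
    ∃ p : Polynomial ℕ, (MAmin L).SolvableInTime fun n => F (p.eval n) := by
  choose f hf hfs using h
  obtain ⟨r, hr⟩ := pt_solve (σ := σ)
  obtain ⟨p, hp, hp'⟩ := hD r
  have hdec := fp_decode L
  obtain ⟨d, hd⟩ := hdec.sizeB
  let q : Polynomial ℕ := p.comp d + .X
  let M : CodedInput L → ℕ := fun x => F (q.eval (size x))
  have hM : PolyB M size := (PolyB.refl M).of_le fun x => by
    refine le_trans ?_ (hF' _)
    simp [q]
  have hM' : PolyB M fun x => F (p.eval (size (MAInput.raw (L := L) x))) :=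
    (PolyB.refl M).of_le fun x => hF <| by
      have := eval_monotone p (hd x)
      simp only [q, Polynomial.eval_add, Polynomial.eval_comp, Polynomial.eval_X]
      exact this.trans (Nat.le_add_right _ _)
  have hx : PT M fun x : CodedInput L => MAInput.raw x := hdec.mono hM
  have hD' : PT M fun x : CodedInput L => D (MAInput.raw x) := hp.comp' hx hM'
  have hN : PT M fun x : CodedInput L => numbers (MAInput.raw x) := fp_numbers.comp hx
  have hs : PT M fun x : CodedInput L =>
      solve (MAInput.raw x) (numbers (MAInput.raw x)) (D (MAInput.raw x)) :=
    (hr.comp' (hx.pair (hN.pair hD')) ((hp'.comp fun x : CodedInput L => MAInput.raw x).trans hM') :)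
  -- The function `f` was obtained by choice, but the code of each of its values is the word
  -- computed by `solve`, and only codes matter to the machine.
  have hs' : @PT _ _ (Data.via MAInput.encode) (Data.via MAOutput.encode)
      (fun x => F (q.eval (@size (MAInput L) (Data.via MAInput.encode) x))) f :=
    @PT.recast _ _ _ (Data.via MAInput.encode) _ (Data.via MAOutput.encode) _ _ hs f
      fun x => congrArg enc (hf x)
  obtain ⟨t, M, hM⟩ := hs'.exists_computableInTime hF hF' hF''
  exact ⟨t, f, hfs, M, hM⟩

/-- The domain is computed in polynomial time, so the `2 ^ r` of `solve` stays single exponential.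
-/
theorem mem_FEXP {L : Set (Program σ)} (h : ∀ x : MAInput L, ∃ y : MAOutput σ,
    MAOutput.encode y = solve (MAInput.raw x) (numbers (MAInput.raw x)) (numbers (MAInput.raw x)) ∧ MAOutput.IsSolution x y) :
    MAmin L ∈ FEXP := by
  refine solvableInTime (F := fun n => 2 ^ n) (pow_right_mono₀ one_le_two)
    (fun n => Nat.lt_two_pow_self.le) (fun p T hT => PolyB.le_two_pow (s := fun n => n) hT)
    (D := numbers) (fun r => ?_) h
  have hN : FP fun x : RawInput σ => (x, numbers x, numbers x) :=
    fp_id.pair (fp_numbers.pair fp_numbers)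
  obtain ⟨s, hs⟩ := hN.sizeB
  have h₁ : PolyB (fun x : RawInput σ => 2 ^ (r.comp s + .X : Polynomial ℕ).eval (size x)) size :=
    polyB_two_pow .X (fun a => by simp) _
  have h₂ : PolyB (fun x : RawInput σ => 2 ^ (r.comp s + .X : Polynomial ℕ).eval (size x))
      fun x => 2 ^ r.eval (size (x, numbers x, numbers x)) :=
    (PolyB.refl _).of_le fun x => Nat.pow_le_pow_right (by lia) (by
      rw [Polynomial.eval_add, Polynomial.eval_comp]
      exact (eval_monotone r (hs x)).trans (Nat.le_add_right _ _))
  exact ⟨_, fp_numbers.mono h₁, h₂⟩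

/-- The domain now has size `2 ^ poly`, and `solve` adds one more exponential. -/
theorem mem_F2EXP {L : Set (Program σ)} {k : ℕ} (h : ∀ x : MAInput L, ∃ y : MAOutput σ,
    MAOutput.encode y = solve (MAInput.raw x) (numbers (MAInput.raw x))
      (numbers (MAInput.raw x) ++ manyNumbers k (numbers (MAInput.raw x))) ∧ MAOutput.IsSolution x y) :
    MAmin L ∈ F2EXP := by
  refine solvableInTime (F := fun n => 2 ^ 2 ^ n)
    (fun a b h => Nat.pow_le_pow_right (by lia) (Nat.pow_le_pow_right (by lia) h))
    (fun n => Nat.lt_two_pow_self.le.trans Nat.lt_two_pow_self.le)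
    (fun p T hT => PolyB.le_two_pow_two_pow (s := fun n => n) hT)
    (D := fun x => numbers x ++ manyNumbers k (numbers x)) (fun r => ?_) h
  obtain ⟨p, hp⟩ := pt_manyNumbers k
  obtain ⟨s, hs⟩ := (fp_numbers (σ := σ)).sizeB
  let q : Polynomial ℕ := p.comp s + .X
  have hq : PolyB (fun x : RawInput σ => 2 ^ q.eval (size x)) size :=
    polyB_two_pow .X (fun a => by simp) _
  have hD : PT (fun x : RawInput σ => 2 ^ q.eval (size x))
      fun x => numbers x ++ manyNumbers k (numbers x) :=
    (fp_numbers.mono hq).append (hp.comp' (fp_numbers.mono hq)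
      ((PolyB.refl _).of_le fun x => Nat.pow_le_pow_right (by lia) (by
        have := eval_monotone p (hs x)
        simp only [q, Polynomial.eval_add, Polynomial.eval_comp]
        exact this.trans (Nat.le_add_right _ _))))
  obtain ⟨t, ht⟩ := (((PT.id hq).pair ((fp_numbers.mono hq).pair hD)).sizeB).le_two_pow
  have h₂ : PolyB (fun x : RawInput σ => 2 ^ t.eval (size x))
      fun x => r.eval (size (x, numbers x, numbers x ++ manyNumbers k (numbers x))) :=
    PolyB.trans ⟨r, fun _ => le_rfl⟩ ((PolyB.refl _).of_le ht)
  obtain ⟨v, hv⟩ := h₂.le_two_pow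
  refine ⟨q + v, hD.mono ((PolyB.refl _).of_le fun x => ?_), (PolyB.refl _).of_le fun x => ?_⟩
  · refine (Nat.lt_two_pow_self.le).trans (Nat.pow_le_pow_right (by lia)
      (Nat.pow_le_pow_right (by lia) ?_))
    simp
  · refine Nat.pow_le_pow_right (by lia) ((hv x).trans (Nat.pow_le_pow_right (by lia) ?_))
    simp

end StackProg

/-! ## Correctness of the algorithm -/

namespace StackProg

open Computability

variable {σ : Schema}

theorem Term.eval_congr {t : Term} {g g' : ℕ → ℕ} (h : ∀ x, t = .var x → g x = g' x) :
    t.eval g = t.eval g' := by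
  cases t with
  | var x => exact h x rfl
  | const c => rfl

theorem Literal.holdsEDB_congr {l : Literal σ} {J : Instance σ} {g g' : ℕ → ℕ}
    (h : ∀ x, l.HasVar x → g x = g' x) : l.HoldsEDB J g ↔ l.HoldsEDB J g' := by
  cases l with
  | edb R t =>
    have : ∀ i, (t i).eval g = (t i).eval g' :=
      fun i => Term.eval_congr fun x hx => h x ⟨i, hx⟩
    simp only [Literal.HoldsEDB, this]
  | idb S t => rfl
  | eq s t =>
    have h₁ : s.eval g = s.eval g' := Term.eval_congr fun x hx => h x (.inl hx)
    have h₂ : t.eval g = t.eval g' := Term.eval_congr fun x hx => h x (.inr hx)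
    simp only [Literal.HoldsEDB, h₁, h₂]
  | negEdb R t =>
    have : ∀ i, (t i).eval g = (t i).eval g' :=
      fun i => Term.eval_congr fun x hx => h x ⟨i, hx⟩
    simp only [Literal.HoldsEDB, this]
  | neq s t =>
    have h₁ : s.eval g = s.eval g' := Term.eval_congr fun x hx => h x (.inl hx)
    have h₂ : t.eval g = t.eval g' := Term.eval_congr fun x hx => h x (.inr hx)
    simp only [Literal.HoldsEDB, h₁, h₂]

/-- Derivations in which the variables of the rules take values in `D`. -/
inductive DerivesIn (P : Program σ) (D : List ℕ) (J : Instance σ) :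
    (S : IDB) → (Fin S.arity → ℕ) → Prop where
  | rule (r : Rule σ) (hr : r ∈ P.rules) (g : ℕ → ℕ) (hg : ∀ x, r.HasVar x → g x ∈ D)
      (hE : ∀ l ∈ r.body, l.HoldsEDB J g)
      (hI : ∀ (S : IDB) (t : Fin S.arity → Term), Literal.idb S t ∈ r.body →
        DerivesIn P D J S (fun i => (t i).eval g)) :
      DerivesIn P D J r.head (fun i => g (r.headVars i))

theorem DBFact.raw_injective : Function.Injective (DBFact.raw (σ := σ)) := by
  rintro ⟨R, a⟩ ⟨R', b⟩ h
  simp only [DBFact.raw, Prod.mk.injEq] at h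
  obtain ⟨h₁, h₂⟩ := h
  obtain rfl := Fin.ext h₁
  obtain rfl := List.ofFn_injective h₂
  rfl

/-- The list `E` consists of the facts in `J`, possibly among other atoms. -/
def Represents (E : List Atom) (J : Instance σ) : Prop := ∀ F : DBFact σ, DBFact.raw F ∈ E ↔ F ∈ J

def idbAtom (S : IDB) (a : Fin S.arity → ℕ) : Atom := (S.idx, List.ofFn a)

/-- Equal atoms have symbols of equal arity only after comparing lengths of lists; transporting a
predicate avoids an equation between tuples of different types. -/
theorem idbAtom_inj {S S' : IDB} {a : Fin S.arity → ℕ} {b : Fin S'.arity → ℕ}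
    (h : idbAtom S a = idbAtom S' b) (p : (S : IDB) → (Fin S.arity → ℕ) → Prop) (hb : p S' b) :
    p S a := by
  obtain ⟨k, i⟩ := S
  obtain ⟨k', i'⟩ := S'
  simp only [idbAtom, Prod.mk.injEq] at h
  obtain ⟨rfl, h⟩ := h
  have hk : k = k' := by simpa using congrArg List.length h
  subst hk
  obtain rfl := List.ofFn_injective h
  exact hb

/-! ### The fixpoint iteration agrees with derivability -/

section Fixpoint

variable {E F : List Atom} {J : Instance σ} {s : Asg} {rs : List (Rule σ)} {ss : List Asg}

theorem rawHolds_iff (hE : Represents E J) (l : Literal σ) :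
    rawHolds E F s (Literal.raw l) = true ↔ l.HoldsEDB J s.fn ∧
      ∀ S t, l = .idb S t → idbAtom S (fun i => (t i).eval s.fn) ∈ F := by
  cases l with
  | edb R t =>
    rw [Literal.HoldsEDB, ← hE]
    simp [rawHolds, Literal.raw, DBFact.raw, List.map_ofFn, Function.comp_def]
  | idb S t =>
    simp only [rawHolds, Literal.raw, List.map_ofFn, Literal.HoldsEDB, true_and, one_ne_zero,
      decide_false, decide_true, cond_false, cond_true, memb_iff]
    constructor
    · rintro h _ _ ⟨⟩
      exact h
    · intro h
      exact h S t rfl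
  | eq s t => simp [rawHolds, Literal.raw, Literal.HoldsEDB]
  | negEdb R t =>
    rw [Literal.HoldsEDB, ← hE]
    simp [rawHolds, Literal.raw, DBFact.raw, List.map_ofFn, Function.comp_def, ← memb_iff]
  | neq s t => simp [rawHolds, Literal.raw, Literal.HoldsEDB]

theorem fires_iff (hE : Represents E J) (r : Rule σ) :
    fires E F r s = true ↔ (∀ l ∈ r.body, l.HoldsEDB J s.fn) ∧
      ∀ S t, Literal.idb S t ∈ r.body → idbAtom S (fun i => (t i).eval s.fn) ∈ F := by
  simp only [fires, List.all_eq_true, rawHolds_iff hE]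
  constructor
  · intro h
    exact ⟨fun l hl => (h l hl).1, fun S t hl => (h _ hl).2 S t rfl⟩
  · rintro ⟨h₁, h₂⟩ l hl
    refine ⟨h₁ l hl, ?_⟩
    rintro S t rfl
    exact h₂ S t hl

theorem headAtom_eq (r : Rule σ) (s : Asg) :
    headAtom r s = idbAtom r.head fun i => s.fn (r.headVars i) := by
  simp [headAtom, idbAtom, List.map_ofFn, Function.comp_def]

theorem fixpoint_eq_iterate (E : List Atom) (rs : List (Rule σ)) (ss : List Asg) :
    fixpoint E rs ss = (fun F => consequences E F rs ss)^[(allHeads rs ss).length] [] := by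
  have key : ∀ (l : List Atom) (F : List Atom), l.foldl (fun F _ => consequences E F rs ss) F =
      (fun F => consequences E F rs ss)^[l.length] F := by
    intro l
    induction l with
    | nil => intro F; rfl
    | cons a l ih => intro F; exact ih _
  exact key _ _

/-- Every stage of the iteration contains derivable atoms only, whatever assignments are used. -/
theorem fixpoint_sound (P : Program σ) (hE : Represents E J) (ss : List Asg) (S : IDB)
    (a : Fin S.arity → ℕ) (h : idbAtom S a ∈ fixpoint E P.rules ss) : Derives P J S a := by
  have key : ∀ (n : ℕ) (S : IDB) (a : Fin S.arity → ℕ),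
      idbAtom S a ∈ (fun F => consequences E F P.rules ss)^[n] [] → Derives P J S a := by
    intro n
    induction n with
    | zero => intro S a h; simp at h
    | succ n ih =>
      intro S a h
      rw [Function.iterate_succ_apply'] at h
      simp only [consequences, List.mem_flatMap, List.mem_map, List.mem_filter] at h
      obtain ⟨r, hr, s, ⟨-, hs⟩, h⟩ := h
      rw [headAtom_eq] at h
      obtain ⟨h₁, h₂⟩ := (fires_iff hE r).1 hs
      exact idbAtom_inj h.symm (Derives P J)
        (.rule r hr s.fn h₁ fun S t hl => ih _ _ (h₂ S t hl))
  rw [fixpoint_eq_iterate] at h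
  exact key _ _ _ h

/-- Sublists instead of subsets: two stages of equal length are then equal, which is what
termination rests on. -/
theorem consequences_mono (hE : Represents E J) {F G : List Atom} (h : ∀ q ∈ F, q ∈ G) :
    (consequences E F rs ss).Sublist (consequences E G rs ss) := by
  have key : ∀ r, (ss.filter (fires E F r)).Sublist (ss.filter (fires E G r)) := fun r =>
    List.monotone_filter_right ss fun s hs => by
      rw [fires_iff hE] at hs ⊢
      exact ⟨hs.1, fun S t hl => h _ (hs.2 S t hl)⟩
  induction rs with
  | nil => exact List.Sublist.refl _
  | cons r rs ih => exact ((key r).map _).append ih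

/-- The stages form an increasing chain of sublists, all no longer than `allHeads`. Until the chain
is stationary each round adds an entry, so as many rounds as `allHeads` has entries are enough. -/
theorem consequences_fixpoint (hE : Represents E J) :
    consequences E (fixpoint E rs ss) rs ss = fixpoint E rs ss := by
  rw [fixpoint_eq_iterate, ← Function.iterate_succ_apply' (fun F => consequences E F rs ss)]
  set T : List Atom → List Atom := fun F => consequences E F rs ss with hT
  have hsub : ∀ n, (T^[n] []).Sublist (T^[n + 1] []) := by
    intro n
    induction n with
    | zero => exact List.nil_sublist _
    | succ n ih =>
      rw [Function.iterate_succ_apply', Function.iterate_succ_apply' _ (n + 1)]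
      exact consequences_mono hE ih.subset
  have hlen : ∀ n, (T^[n] []).length ≤ (allHeads rs ss).length := by
    intro n
    cases n with
    | zero => exact Nat.zero_le _
    | succ n =>
      rw [Function.iterate_succ_apply']
      exact (consequences_sublist _ _ _ _).length_le
  have hgrow : ∀ n, n ≤ (T^[n] []).length ∨ T^[n + 1] [] = T^[n] [] := by
    intro n
    induction n with
    | zero => exact .inl (Nat.zero_le _)
    | succ n ih =>
      by_cases h : T^[n + 1] [] = T^[n] []
      · right
        rw [Function.iterate_succ_apply' T (n + 1), h, ← Function.iterate_succ_apply' T n, h]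
      · left
        have h₁ := ih.resolve_right h
        have h₂ := (hsub n).length_le
        have h₃ : (T^[n] []).length ≠ (T^[n + 1] []).length :=
          fun h₃ => h ((hsub n).eq_of_length h₃).symm
        lia
  have hstable : ∀ n, T^[n + 1] [] = T^[n] [] → T^[n + 2] [] = T^[n + 1] [] := fun n h => by
    rw [Function.iterate_succ_apply' T (n + 1), h, ← Function.iterate_succ_apply' T n, h]
  -- Either the last stage already has the greatest possible length and cannot grow, or the chain
  -- has become stationary.
  rcases hgrow (allHeads rs ss).length with h | h
  · have h₁ := hlen ((allHeads rs ss).length + 1)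
    have h₂ := (hsub (allHeads rs ss).length).length_le
    exact ((hsub _).eq_of_length (by lia)).symm
  · exact h

/-- Repetitions in `V` do no harm, as all entries with the same key carry the same value. -/
theorem fn_map (V : List ℕ) (g : ℕ → ℕ) {x : ℕ} (hx : x ∈ V) :
    Asg.fn (V.map fun x => (x, g x)) x = g x := by
  have key : ∀ (V : List ℕ) (d : ℕ), d = g x ∨ x ∈ V →
      (V.map fun x => (x, g x)).foldl (fun s p => bif decide (p.1 = x) then p.2 else s) d =
        g x := by
    intro V
    induction V with
    | nil => simp
    | cons y V ih =>
      intro d hd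
      rw [List.map_cons, List.foldl_cons]
      refine ih _ ?_
      by_cases h : y = x
      · simp [h]
      · simpa [h, Ne.symm h] using hd
  exact key V 0 (.inr hx)

/-- Each rule application of the derivation uses an assignment that can be extended to all of `V`,
and the resulting list is among the enumerated choices. -/
theorem fixpoint_complete (P : Program σ) {V D : List ℕ}
    (hV : ∀ r ∈ P.rules, ∀ x, r.HasVar x → x ∈ V) (h0 : 0 ∈ D) (hE : Represents E J) (S : IDB)
    (a : Fin S.arity → ℕ) (h : DerivesIn P D J S a) :
    idbAtom S a ∈ fixpoint E P.rules (choices V D) := by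
  classical
  induction h with
  | rule r hr g hg hB hI ih =>
    -- Variables of other rules get the value `0`, which is why `0` has to lie in `D`. The reversal
    -- below matches the order of keys in `choices`.
    let g' : ℕ → ℕ := fun x => if r.HasVar x then g x else 0
    let s : Asg := V.reverse.map fun x => (x, g' x)
    have hs : ∀ x, r.HasVar x → s.fn x = g x := fun x hx => by
      rw [fn_map _ _ (List.mem_reverse.2 (hV r hr x hx))]
      exact if_pos hx
    rw [← consequences_fixpoint hE]
    simp only [consequences, List.mem_flatMap, List.mem_map, List.mem_filter]
    refine ⟨r, hr, s, ⟨mem_choices.2 ⟨?_, ?_⟩, (fires_iff hE r).2 ⟨fun l hl => ?_, ?_⟩⟩, ?_⟩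
    · simp [s, Function.comp_def]
    · intro p hp
      obtain ⟨x, -, rfl⟩ := List.mem_map.1 hp
      dsimp only [g']
      split_ifs with hx
      · exact hg x hx
      · exact h0
    · exact (Literal.holdsEDB_congr fun x hx => hs x (.inr ⟨l, hl, hx⟩)).2 (hB l hl)
    · intro S t hl
      have : (fun i => (t i).eval s.fn) = fun i => (t i).eval g := funext fun i =>
        Term.eval_congr fun x hx => hs x (.inr ⟨_, hl, i, hx⟩)
      rw [this]
      exact ih S t hl
    · rw [headAtom_eq]
      congr 1
      funext i
      exact hs _ (.inl ⟨i, rfl⟩)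

end Fixpoint

/-- Lifts the list of raw atoms to genuine facts. Absence of repetitions lets lengths of filtered
lists be read as cardinalities. -/
theorem exists_allFacts (σ : Schema) (D : List ℕ) : ∃ A : List (DBFact σ),
    allFacts σ D = A.map DBFact.raw ∧ A.Nodup ∧ ∀ F, F ∈ A ↔ ∀ i, F.args i ∈ D := by
  have hmem : ∀ q, q ∈ allFacts σ D ↔ ∃ F : DBFact σ, (∀ i, F.args i ∈ D) ∧ DBFact.raw F = q := by
    intro q
    rw [allFacts, (dedupl_spec _).2]
    simp only [List.mem_flatMap, List.mem_map, mem_words, List.mem_finRange, true_and]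
    constructor
    · rintro ⟨R, w, ⟨hw, hD⟩, rfl⟩
      obtain ⟨t, rfl⟩ : ∃ t : Fin (σ.arity R) → ℕ, w = List.ofFn t := by
        exact ⟨fun i => w.get (i.cast hw.symm), by
          apply List.ext_get <;> simp [hw]⟩
      exact ⟨⟨R, t⟩, fun i => hD _ (List.mem_ofFn.2 ⟨i, rfl⟩), rfl⟩
    · rintro ⟨F, hF, rfl⟩
      refine ⟨F.rel, List.ofFn F.args, ⟨by simp, fun a ha => ?_⟩, rfl⟩
      obtain ⟨i, rfl⟩ := List.mem_ofFn.1 ha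
      exact hF i
  have hlift : ∀ l : List Atom, (∀ q ∈ l, ∃ F : DBFact σ, DBFact.raw F = q) →
      ∃ A : List (DBFact σ), l = A.map DBFact.raw := by
    intro l hl
    induction l with
    | nil => exact ⟨[], rfl⟩
    | cons q l ih =>
      obtain ⟨F, rfl⟩ := hl q (by simp)
      obtain ⟨A, rfl⟩ := ih fun q hq => hl q (by simp [hq])
      exact ⟨F :: A, rfl⟩
  obtain ⟨A, hA⟩ := hlift (allFacts σ D) fun q hq => by
    obtain ⟨F, -, h⟩ := (hmem q).1 hq
    exact ⟨F, h⟩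
  refine ⟨A, hA, ?_, fun F => ?_⟩
  · refine List.Nodup.of_map DBFact.raw ?_
    rw [← hA]
    exact (dedupl_spec _).1
  · have := hmem (DBFact.raw F)
    rw [hA, List.mem_map_of_injective DBFact.raw_injective] at this
    rw [this]
    constructor
    · rintro ⟨G, hG, h⟩
      obtain rfl := DBFact.raw_injective h
      exact hG
    · intro h
      exact ⟨F, h, rfl⟩

theorem argmin_le (all I : List Atom) {Js : List (List Atom)} {J : List Atom} (hJ : J ∈ Js) :
    (differences all I (argmin all I Js)).length ≤ (differences all I J).length := by
  have key : ∀ (Js : List (List Atom)) (b : List Atom), ∀ J ∈ b :: Js,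
      (differences all I (Js.foldl (fun b J =>
        bif decide ((differences all I J).length ≤ (differences all I b).length)
        then J else b) b)).length ≤ (differences all I J).length := by
    intro Js
    induction Js with
    | nil => simp
    | cons K Js ih =>
      intro b J hJ
      rw [List.foldl_cons]
      have h₁ := ih (bif decide ((differences all I K).length ≤ (differences all I b).length)
        then K else b)
      by_cases h : (differences all I K).length ≤ (differences all I b).length
      · rw [decide_eq_true h, cond_true] at h₁ ⊢
        rcases List.mem_cons.1 hJ with rfl | hJ
        · exact (h₁ K (by simp)).trans h
        · exact h₁ J hJ
      · rw [decide_eq_false h, cond_false] at h₁ ⊢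
        rcases List.mem_cons.1 hJ with rfl | hJ
        · exact h₁ J (by simp)
        · rcases List.mem_cons.1 hJ with rfl | hJ
          · exact (h₁ b (by simp)).trans (by lia)
          · exact h₁ J (by simp [hJ])
  exact key Js _ J (List.mem_cons_of_mem _ hJ)

/-- The algorithm is correct if minimum repairs can be found over the domain `D`. -/
theorem solve_correct {L : Set (Program σ)} (x : MAInput L) {D : List ℕ}
    (hV : ∀ r ∈ x.prog.rules, ∀ v, r.HasVar v → v ∈ numbers (MAInput.raw x))
    (h0 : 0 ∈ D) (hx : ∀ F ∈ x.inst, ∀ i, F.args i ∈ D)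
    (hD : ∀ U, IsRepair x.prog x.inst x.tup U → ∃ J : Instance σ,
      (∀ F ∈ J, ∀ i, F.args i ∈ D) ∧ DerivesIn x.prog D J x.prog.ans x.tup ∧
      ((J \ x.inst) ∪ (x.inst \ J)).card ≤ U.size) :
    ∃ y : MAOutput σ, MAOutput.encode y = solve (MAInput.raw x) (numbers (MAInput.raw x)) D ∧
      MAOutput.IsSolution x y := by
  obtain ⟨A, hA, hnd, hAm⟩ := exists_allFacts σ D
  set I := x.facts.map DBFact.raw with hI
  set good := goodCandidates (candidates σ D) x.prog.rules
    (choices (numbers (MAInput.raw x)) D) (idbAtom x.prog.ans x.tup) with hgood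
  have hsolve : solve (MAInput.raw x) (numbers (MAInput.raw x)) D =
    answerWord (allFacts σ D) I good := rfl
  rw [hsolve]
  have hIr : ∀ F : DBFact σ, memb (DBFact.raw F) I = decide (F ∈ x.inst) := fun F => by
    rw [Bool.eq_iff_iff, memb_iff, hI, List.mem_map_of_injective DBFact.raw_injective,
      decide_eq_true_iff, MAInput.inst, List.mem_toFinset]
  have hfilter : ∀ p : Atom → Bool,
      (allFacts σ D).filter p = (A.filter fun F => p (DBFact.raw F)).map DBFact.raw := fun p => by
    rw [hA, List.filter_map]
    rfl
  -- Counting differences within `allFacts` misses nothing, because both instances are over `D`.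
  have hcard : ∀ (E : List Atom) (J : Instance σ), Represents E J → (∀ F ∈ J, ∀ i, F.args i ∈ D) →
      (differences (allFacts σ D) I E).length = ((J \ x.inst) ∪ (x.inst \ J)).card := by
    intro E J hE hJ
    rw [differences, hfilter, List.length_map, ← List.toFinset_card_of_nodup (hnd.filter _)]
    congr 1
    ext F
    have h₁ : memb (DBFact.raw F) E = decide (F ∈ J) := by
      rw [Bool.eq_iff_iff, memb_iff, decide_eq_true_iff, hE]
    simp only [List.mem_toFinset, List.mem_filter, hAm, h₁, hIr, Bool.or_eq_true, Bool.and_eq_true,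
      Bool.not_eq_true', decide_eq_true_iff, decide_eq_false_iff_not, Finset.mem_union,
      Finset.mem_sdiff]
    constructor
    · exact fun h => h.2
    · rintro (h | h)
      · exact ⟨hJ F h.1, .inl h⟩
      · exact ⟨hx F h.1, .inr h⟩
  have hexists : ∀ U, IsRepair x.prog x.inst x.tup U → ∃ E ∈ good,
      (differences (allFacts σ D) I E).length ≤ U.size := by
    intro U hU
    obtain ⟨J, hJ, hder, hle⟩ := hD U hU
    -- The characteristic function of `J` on the facts over `D`, in the order produced by `choices`.
    let c : List (Atom × Bool) := (A.reverse).map fun F => (DBFact.raw F, decide (F ∈ J))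
    let E := (c.filter Prod.snd).map Prod.fst
    have hE : Represents E J := fun F => by
      simp only [E, c, List.mem_map, List.mem_filter, List.mem_reverse]
      constructor
      · rintro ⟨_, ⟨⟨G, hG, rfl⟩, h₁⟩, h₂⟩
        obtain rfl := DBFact.raw_injective h₂
        simpa using h₁
      · intro h
        exact ⟨_, ⟨⟨F, (hAm F).2 (hJ F h), rfl⟩, by simpa using h⟩, rfl⟩
    refine ⟨E, List.mem_filter.2 ⟨List.mem_map.2 ⟨c, mem_choices.2 ⟨?_, ?_⟩, rfl⟩, ?_⟩, ?_⟩
    · rw [hA, ← List.map_reverse]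
      simp [c, Function.comp_def]
    · rintro ⟨q, _ | _⟩ - <;> simp
    · rw [memb_iff]
      exact fixpoint_complete x.prog hV h0 hE _ _ hder
    · rw [hcard E J hE hJ]
      exact hle
  by_cases hg : good = []
  · refine ⟨none, ?_, ?_⟩
    · rw [hg]
      rfl
    · rintro ⟨U, hU⟩
      obtain ⟨E, hE, -⟩ := hexists U hU
      rw [hg] at hE
      simp at hE
  · set E := argmin (allFacts σ D) I good with hEdef
    have hEg : E ∈ good := by
      have := argmin_mem (allFacts σ D) I good (good.headD [])
      rcases List.mem_cons.1 this with h | h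
      · rw [hEdef, argmin, h]
        cases hgg : good with
        | nil => exact absurd hgg hg
        | cons K l => simp
      · exact h
    have hEall : ∀ q ∈ E, q ∈ allFacts σ D := by
      obtain ⟨c, hc, hcE⟩ := List.mem_map.1 (List.mem_filter.1 hEg).1
      intro q hq
      rw [← hcE] at hq
      obtain ⟨p, hp, rfl⟩ := List.mem_map.1 hq
      rw [← List.mem_reverse, ← (mem_choices.1 hc).1]
      exact List.mem_map_of_mem (List.mem_filter.1 hp).1
    -- The instance that the selected candidate represents; the output is the update from the given
    -- instance to this one.
    let J : Instance σ := (A.filter fun F => memb (DBFact.raw F) E).toFinset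
    have hJ : ∀ F ∈ J, ∀ i, F.args i ∈ D := fun F hF => by
      simp only [J, List.mem_toFinset, List.mem_filter] at hF
      exact (hAm F).1 hF.1
    have hE : Represents E J := fun F => by
      simp only [J, List.mem_toFinset, List.mem_filter, memb_iff]
      constructor
      · intro h
        have := hEall _ h
        rw [hA, List.mem_map_of_injective DBFact.raw_injective] at this
        exact ⟨this, h⟩
      · exact fun h => h.2
    have hEJ : ∀ F, memb (DBFact.raw F) E = decide (F ∈ J) := fun F => by
      rw [Bool.eq_iff_iff, memb_iff, decide_eq_true_iff, hE]
    let ins := A.filter fun F => decide (F ∈ J) && !decide (F ∈ x.inst)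
    let del := A.filter fun F => decide (F ∈ x.inst) && !decide (F ∈ J)
    have hins : ins.toFinset = J \ x.inst := by
      ext F
      simp only [ins, List.mem_toFinset, List.mem_filter, hAm, Bool.and_eq_true,
        Bool.not_eq_true', decide_eq_true_iff, decide_eq_false_iff_not, Finset.mem_sdiff]
      exact ⟨fun h => h.2, fun h => ⟨hJ F h.1, h⟩⟩
    have hdel : del.toFinset = x.inst \ J := by
      ext F
      simp only [del, List.mem_toFinset, List.mem_filter, hAm, Bool.and_eq_true,
        Bool.not_eq_true', decide_eq_true_iff, decide_eq_false_iff_not, Finset.mem_sdiff]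
      exact ⟨fun h => h.2, fun h => ⟨hx F h.1, h⟩⟩
    have henc : ∀ l : List (DBFact σ),
        Enc.list encodeAtom (l.map DBFact.raw) = Enc.list Enc.fact l := by
      intro l
      induction l with
      | nil => rfl
      | cons F l ih =>
        rw [List.map_cons, Enc.list, Enc.list, ih]
        rfl
    refine ⟨some (ins, del), ?_, ⟨⟨?_, ?_⟩, ?_⟩, ?_⟩
    · have : good.isEmpty = false := by simpa using hg
      rw [answerWord, this, cond_false]
      simp only [updateLists, hfilter, henc, MAOutput.encode]
      rw [← hEdef]
      simp only [hEJ, hIr]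
      rfl
    · rw [hins]
      exact Finset.sdiff_disjoint
    · rw [hdel]
      exact Finset.sdiff_subset
    · have happ : Update.apply ⟨ins.toFinset, del.toFinset⟩ x.inst = J := by
        ext F
        simp only [Update.apply, hins, hdel, Finset.mem_sdiff, Finset.mem_union]
        tauto
      rw [happ]
      exact fixpoint_sound x.prog hE _ _ _ (memb_iff.1 (List.mem_filter.1 hEg).2)
    · intro U hU
      obtain ⟨E', hE', hle⟩ := hexists U hU
      refine le_trans ?_ ((argmin_le (allFacts σ D) I hE').trans hle)
      rw [← hEdef, hcard E J hE hJ, Update.size, hins, hdel]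

end StackProg

/-! ## Minimum repairs for Datalog programs -/

namespace StackProg

open Computability

variable {σ : Schema}

theorem Literal.hasVar_iff {l : Literal σ} {v : ℕ} :
    l.HasVar v ↔ Term.var v ∈ (Literal.raw l).2.2 := by
  cases l <;> simp [Literal.HasVar, Literal.raw, List.mem_ofFn, eq_comm]

section Numbers

variable {L : Set (Program σ)} (x : MAInput L)

theorem mem_numbers_of_rule {r : Rule σ} (hr : r ∈ x.prog.rules) {n : ℕ} (hn : n ∈ ruleNumbers r) :
    n ∈ numbers (MAInput.raw x) := by
  refine List.mem_cons_of_mem _ (List.mem_append_right _ (List.mem_flatMap.2 ⟨r, hr, hn⟩))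

theorem mem_numbers_of_term {r : Rule σ} (hr : r ∈ x.prog.rules) {l : Literal σ} (hl : l ∈ r.body)
    {t : Term} (ht : t ∈ (Literal.raw l).2.2) : (Term.raw t).2 ∈ numbers (MAInput.raw x) :=
  mem_numbers_of_rule x hr (List.mem_cons_of_mem _ (List.mem_append_right _
    (List.mem_flatMap.2 ⟨l, hl, List.mem_map.2 ⟨t, ht, rfl⟩⟩)))

theorem mem_numbers_of_hasVar {r : Rule σ} (hr : r ∈ x.prog.rules) {v : ℕ} (hv : r.HasVar v) :
    v ∈ numbers (MAInput.raw x) := by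
  rcases hv with ⟨i, rfl⟩ | ⟨l, hl, hv⟩
  · exact mem_numbers_of_rule x hr (List.mem_cons_of_mem _ (List.mem_append_left _
      (List.mem_ofFn.2 ⟨i, rfl⟩)))
  · exact mem_numbers_of_term x hr hl (Literal.hasVar_iff.1 hv)

theorem mem_numbers_of_const {r : Rule σ} (hr : r ∈ x.prog.rules) {l : Literal σ} (hl : l ∈ r.body)
    {c : ℕ} (hc : Term.const c ∈ (Literal.raw l).2.2) : c ∈ numbers (MAInput.raw x) :=
  mem_numbers_of_term x hr hl hc

theorem mem_numbers_of_mem_inst {F : DBFact σ} (hF : F ∈ x.inst) (i : Fin (σ.arity F.rel)) :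
    F.args i ∈ numbers (MAInput.raw x) := by
  refine List.mem_cons_of_mem _ (List.mem_append_left _ (List.mem_append_right _
    (List.mem_flatMap.2 ⟨F, ?_, List.mem_ofFn.2 ⟨i, rfl⟩⟩)))
  rwa [MAInput.inst, List.mem_toFinset] at hF

theorem mem_numbers_of_tup (i : Fin x.prog.ans.arity) : x.tup i ∈ numbers (MAInput.raw x) :=
  List.mem_cons_of_mem _ (List.mem_append_left _ (List.mem_append_left _
    (List.mem_ofFn.2 ⟨i, rfl⟩)))

theorem zero_mem_numbers (x : RawInput σ) : 0 ∈ numbers x := List.mem_cons_self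

end Numbers

def DBFact.map (h : ℕ → ℕ) (F : DBFact σ) : DBFact σ := ⟨F.rel, fun i => h (F.args i)⟩

theorem Term.eval_comp {t : Term} {h g : ℕ → ℕ} (ht : ∀ c, t = .const c → h c = c) :
    t.eval (fun v => h (g v)) = h (t.eval g) := by
  cases t with
  | var v => rfl
  | const c => exact (ht c rfl).symm

theorem Literal.holdsEDB_map {l : Literal σ} {J J' : Instance σ} {h g : ℕ → ℕ}
    (hl : l.IsPositive) (hc : ∀ c, Term.const c ∈ (Literal.raw l).2.2 → h c = c)
    (hJ : ∀ F ∈ J, DBFact.map h F ∈ J') (hg : l.HoldsEDB J g) :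
    l.HoldsEDB J' fun v => h (g v) := by
  cases l with
  | edb R t =>
    have : ∀ i, (t i).eval (fun v => h (g v)) = h ((t i).eval g) := fun i =>
      Term.eval_comp fun c hi => hc c (List.mem_ofFn.2 ⟨i, hi⟩)
    simp only [Literal.HoldsEDB, this]
    exact hJ _ hg
  | idb S t => trivial
  | eq s t =>
    have h₁ : s.eval (fun v => h (g v)) = h (s.eval g) :=
      Term.eval_comp fun c hi => hc c (by simp [Literal.raw, hi])
    have h₂ : t.eval (fun v => h (g v)) = h (t.eval g) :=
      Term.eval_comp fun c hi => hc c (by simp [Literal.raw, hi])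
    simp only [Literal.HoldsEDB, h₁, h₂]
    exact congrArg h hg
  | negEdb R t => exact hl.elim
  | neq s t => exact hl.elim

/-- Homomorphisms preserve the derivations of a Datalog program. -/
theorem Derives.map {P : Program σ} (hP : ∀ r ∈ P.rules, ∀ l ∈ r.body, l.IsPositive) {D : List ℕ}
    {J J' : Instance σ} {h : ℕ → ℕ} (hD : ∀ c, h c ∈ D)
    (hc : ∀ r ∈ P.rules, ∀ l ∈ r.body, ∀ c, Term.const c ∈ (Literal.raw l).2.2 → h c = c)
    (hJ : ∀ F ∈ J, DBFact.map h F ∈ J') {S : IDB} {a : Fin S.arity → ℕ} (hd : Derives P J S a) :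
    DerivesIn P D J' S fun i => h (a i) := by
  induction hd with
  | rule r hr g hE hI ih =>
    refine .rule r hr (fun v => h (g v)) (fun v _ => hD _)
      (fun l hl => Literal.holdsEDB_map (hP r hr l hl) (hc r hr l hl) hJ (hE l hl)) fun S t hl => ?_
    have : (fun i => (t i).eval fun v => h (g v)) = fun i => h ((t i).eval g) := funext fun i =>
      Term.eval_comp fun c hi => hc r hr _ hl c (List.mem_ofFn.2 ⟨i, hi⟩)
    rw [this]
    exact ih S t hl

/-- All constants foreign to the input are collapsed to `0`. The resulting homomorphism preserves
positive derivations and fixes the input, and the image of a repair needs no more insertions. -/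
theorem mem_FEXP_datalog (σ : Schema) : MAmin (Datalog σ) ∈ FEXP := by
  refine mem_FEXP fun x => solve_correct x (fun r hr v => mem_numbers_of_hasVar x hr)
    (zero_mem_numbers _) (fun F => mem_numbers_of_mem_inst x) fun U hU => ?_
  set D := numbers (MAInput.raw x) with hDdef
  let h : ℕ → ℕ := fun c => if c ∈ D then c else 0
  have hh : ∀ c ∈ D, h c = c := fun c hc => if_pos hc
  have hD : ∀ c, h c ∈ D := fun c => by
    dsimp only [h]
    split_ifs with hc
    · exact hc
    · exact zero_mem_numbers _
  have hI : ∀ F ∈ x.inst, DBFact.map h F = F := fun F hF => by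
    rw [DBFact.map]
    congr 1
    exact funext fun i => hh _ (mem_numbers_of_mem_inst x hF i)
  obtain ⟨⟨-, -⟩, hd⟩ := hU
  set J := U.apply x.inst with hJ
  -- Putting the original instance back undoes all deletions, which positive programs tolerate. What
  -- is left of the difference consists of images of inserted facts.
  refine ⟨J.image (DBFact.map h) ∪ x.inst, ?_, ?_, ?_⟩
  · intro F hF i
    rcases Finset.mem_union.1 hF with hF | hF
    · obtain ⟨G, -, rfl⟩ := Finset.mem_image.1 hF
      exact hD _
    · exact mem_numbers_of_mem_inst x hF i
  · have := Derives.map (J' := J.image (DBFact.map h) ∪ x.inst) x.mem.2 hD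
      (fun r hr l hl c hc => hh c (mem_numbers_of_const x hr hl hc))
      (fun F hF => Finset.mem_union_left _ (Finset.mem_image_of_mem _ hF)) hd
    rwa [show (fun i => h (x.tup i)) = x.tup from
      funext fun i => hh _ (mem_numbers_of_tup x i)] at this
  · have : (J.image (DBFact.map h) ∪ x.inst) \ x.inst ∪
        x.inst \ (J.image (DBFact.map h) ∪ x.inst) ⊆ (U.ins ∪ U.del).image (DBFact.map h) := by
      intro F hF
      simp only [Finset.mem_union, Finset.mem_sdiff, Finset.mem_image] at hF ⊢
      rcases hF with ⟨⟨G, hG, rfl⟩ | hF, hF'⟩ | ⟨hF, hF'⟩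
      · refine ⟨G, .inl ?_, rfl⟩
        rw [hJ, Update.apply, Finset.mem_sdiff, Finset.mem_union] at hG
        refine hG.1.resolve_left fun hG => hF' ?_
        rwa [hI G hG]
      · exact absurd hF hF'
      · exact absurd (.inr hF) hF'
    exact (Finset.card_le_card this).trans Finset.card_image_le

end StackProg

/-! ## Renaming of constants -/

namespace StackProg

open Computability

variable {σ : Schema}

/-- Elements of `B` are treated one at a time; as long as `D` is larger than the set already mapped,
an unused value is available. -/
theorem exists_injOn_extension {A D : Finset ℕ} {θ : ℕ → ℕ} (hθ : Set.InjOn θ A)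
    (hD : ∀ a ∈ A, θ a ∈ D) (B : Finset ℕ) (h : (A ∪ B).card ≤ D.card) :
    ∃ θ' : ℕ → ℕ, (∀ a ∈ A, θ' a = θ a) ∧ Set.InjOn θ' (A ∪ B : Finset ℕ) ∧
      ∀ a ∈ A ∪ B, θ' a ∈ D := by
  classical
  induction B using Finset.induction_on with
  | empty => exact ⟨θ, fun _ _ => rfl, by simpa using hθ, by simpa using hD⟩
  | insert b B hb ih =>
    rw [Finset.union_insert] at h ⊢
    obtain ⟨θ', h₁, h₂, h₃⟩ := ih ((Finset.card_le_card (Finset.subset_insert _ _)).trans h)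
    by_cases hb' : b ∈ A ∪ B
    · rw [Finset.insert_eq_self.2 hb']
      exact ⟨θ', h₁, h₂, h₃⟩
    · rw [Finset.card_insert_of_notMem hb'] at h
      obtain ⟨d, hd, hd'⟩ := Finset.exists_mem_notMem_of_card_lt_card
        (lt_of_le_of_lt (Finset.card_image_le (s := A ∪ B) (f := θ')) h)
      have hne : ∀ a ∈ A ∪ B, Function.update θ' b d a = θ' a := fun a ha =>
        Function.update_of_ne (fun e : a = b => hb' (e ▸ ha)) _ _
      refine ⟨Function.update θ' b d, fun a ha => ?_, ?_, fun a ha => ?_⟩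
      · rw [hne a (Finset.mem_union_left _ ha), h₁ a ha]
      · rw [Finset.coe_insert, Set.injOn_insert (by simpa using hb')]
        refine ⟨h₂.congr fun a ha => (hne a ha).symm, ?_⟩
        rintro ⟨a, ha, h⟩
        rw [hne a ha, Function.update_self] at h
        exact hd' (Finset.mem_image.2 ⟨a, ha, h⟩)
      · rcases Finset.mem_insert.1 ha with rfl | ha
        · rwa [Function.update_self]
        · rw [hne a ha]
          exact h₃ a ha

/-- All arguments of the fact belong to `Z`. -/
def DBFact.Over (Z : Set ℕ) (F : DBFact σ) : Prop := ∀ i, F.args i ∈ Z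

theorem DBFact.Over.map_injOn {Z : Set ℕ} {h : ℕ → ℕ} (hh : Set.InjOn h Z) {F G : DBFact σ}
    (hF : DBFact.Over Z F) (hG : DBFact.Over Z G) (e : DBFact.map h F = DBFact.map h G) : F = G := by
  obtain ⟨R, a⟩ := F
  obtain ⟨R', b⟩ := G
  simp only [DBFact.map, DBFact.mk.injEq] at e
  obtain ⟨rfl, e⟩ := e
  have e := eq_of_heq e
  congr 1
  exact funext fun i => hh (hF i) (hG i) (congrFun e i)

theorem DBFact.map_eq_self {h : ℕ → ℕ} {F : DBFact σ} (hF : ∀ i, h (F.args i) = F.args i) :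
    DBFact.map h F = F := by
  rw [DBFact.map]
  congr 1
  exact funext hF

theorem DBFact.map_congr {h h' : ℕ → ℕ} {F : DBFact σ} (hF : ∀ i, h (F.args i) = h' (F.args i)) :
    DBFact.map h F = DBFact.map h' F := by
  rw [DBFact.map, DBFact.map]
  congr 1
  exact funext hF

/-- Injectivity preserves inequalities, and the equivalence between membership in `J` and in `J'`
serves negated atoms in one direction and positive ones in the other. -/
theorem Literal.holdsEDB_injOn {l : Literal σ} {J J' : Instance σ} {h g : ℕ → ℕ} {Z : Set ℕ}
    (hh : Set.InjOn h Z) (hv : ∀ v, l.HasVar v → g v ∈ Z)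
    (hc : ∀ c, Term.const c ∈ (Literal.raw l).2.2 → c ∈ Z ∧ h c = c)
    (hJ : ∀ F, DBFact.Over Z F → (F ∈ J ↔ DBFact.map h F ∈ J')) (hg : l.HoldsEDB J g) :
    l.HoldsEDB J' fun v => h (g v) := by
  have heval : ∀ t ∈ (Literal.raw l).2.2, t.eval (fun v => h (g v)) = h (t.eval g) :=
    fun t ht => Term.eval_comp fun c hi => (hc c (hi ▸ ht)).2
  have hZ : ∀ t ∈ (Literal.raw l).2.2, t.eval g ∈ Z := fun t ht => by
    cases t with
    | var v => exact hv v (Literal.hasVar_iff.2 ht)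
    | const c => exact (hc c ht).1
  cases l with
  | edb R t =>
    have hm : ∀ i, t i ∈ (Literal.raw (Literal.edb R t)).2.2 := fun i => List.mem_ofFn.2 ⟨i, rfl⟩
    simp only [Literal.HoldsEDB, heval _ (hm _)]
    exact (hJ _ fun i => hZ _ (hm i)).1 hg
  | idb S t => trivial
  | eq s t =>
    have hs : s ∈ (Literal.raw (Literal.eq (σ := σ) s t)).2.2 := List.mem_cons_self
    have ht : t ∈ (Literal.raw (Literal.eq (σ := σ) s t)).2.2 :=
      List.mem_cons_of_mem _ List.mem_cons_self
    simp only [Literal.HoldsEDB, heval _ hs, heval _ ht]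
    exact congrArg h hg
  | negEdb R t =>
    have hm : ∀ i, t i ∈ (Literal.raw (Literal.negEdb R t)).2.2 :=
      fun i => List.mem_ofFn.2 ⟨i, rfl⟩
    simp only [Literal.HoldsEDB, heval _ (hm _)]
    exact fun h' => hg ((hJ _ fun i => hZ _ (hm i)).2 h')
  | neq s t =>
    have hs : s ∈ (Literal.raw (Literal.neq (σ := σ) s t)).2.2 := List.mem_cons_self
    have ht : t ∈ (Literal.raw (Literal.neq (σ := σ) s t)).2.2 :=
      List.mem_cons_of_mem _ List.mem_cons_self
    simp only [Literal.HoldsEDB, heval _ hs, heval _ ht]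
    exact fun h' => hg (hh (hZ _ hs) (hZ _ ht) h')

/-- The facts with arguments in a finite set. -/
def factsOver (σ : Schema) (Z : Finset ℕ) : Finset (DBFact σ) :=
  (Finset.univ.sigma fun R : Fin σ.n => Fintype.piFinset fun _ : Fin (σ.arity R) => Z).image
    fun F => ⟨F.1, F.2⟩

theorem mem_factsOver {Z : Finset ℕ} {F : DBFact σ} : F ∈ factsOver σ Z ↔ DBFact.Over Z F := by
  simp only [factsOver, Finset.mem_image, Finset.mem_sigma, Fintype.mem_piFinset, Finset.mem_univ,
    true_and]
  constructor
  · rintro ⟨G, hG, rfl⟩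
    exact hG
  · intro h
    exact ⟨⟨F.rel, F.args⟩, h, rfl⟩

/-- The number of facts over a set with `n` elements. -/
def factCount (σ : Schema) (n : ℕ) : ℕ := ∑ R : Fin σ.n, n ^ σ.arity R

theorem factCount_mono (σ : Schema) : Monotone (factCount σ) := fun _ _ h =>
  Finset.sum_le_sum fun _ _ => Nat.pow_le_pow_left h _

theorem card_factsOver_le (Z : Finset ℕ) : (factsOver σ Z).card ≤ factCount σ Z.card := by
  refine Finset.card_image_le.trans ?_
  simp [factCount]

/-- The constants of the program belong to `C`, its variables to `V`. -/
def UsesOnly (P : Program σ) (C V : Finset ℕ) : Prop :=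
  (∀ r ∈ P.rules, ∀ l ∈ r.body, ∀ c, Term.const c ∈ (Literal.raw l).2.2 → c ∈ C) ∧
    ∀ r ∈ P.rules, ∀ v, r.HasVar v → v ∈ V

theorem UsesOnly.eval_mem {P : Program σ} {C V : Finset ℕ} (hP : UsesOnly P C V) {r : Rule σ}
    (hr : r ∈ P.rules) {g : ℕ → ℕ} {l : Literal σ} (hl : l ∈ r.body) {t : Term}
    (ht : t ∈ (Literal.raw l).2.2) : t.eval g ∈ C ∪ V.image g := by
  cases t with
  | var v =>
    exact Finset.mem_union_right _ (Finset.mem_image_of_mem _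
      (hP.2 r hr v (.inr ⟨l, hl, Literal.hasVar_iff.2 ht⟩)))
  | const c => exact Finset.mem_union_left _ (hP.1 r hr l hl c ht)

/-- Derivations are preserved if the constants outside `C` are renamed injectively, provided that
there is room for the values of the variables of a rule. -/
theorem Derives.rename {P : Program σ} {C V K : Finset ℕ} (hP : UsesOnly P C V) (hC : C ⊆ K)
    {J : Instance σ} (hJ : ∀ F ∈ J, DBFact.Over K F) {D : List ℕ}
    (hcard : K.card + V.card ≤ D.toFinset.card) {ρ : ℕ → ℕ} (hρC : ∀ c ∈ C, ρ c = c)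
    {S : IDB} {a : Fin S.arity → ℕ} (hd : Derives P J S a) (θ : ℕ → ℕ) (hθ : ∀ k ∈ K, θ k = ρ k)
    (hinj : Set.InjOn θ (K ∪ Finset.univ.image a : Finset ℕ))
    (hD : ∀ z ∈ K ∪ Finset.univ.image a, θ z ∈ D) :
    DerivesIn P D (J.image (DBFact.map ρ)) S fun i => θ (a i) := by
  induction hd generalizing θ with
  | rule r hr g hE hI ih =>
    have hZ : (K ∪ Finset.univ.image fun i => g (r.headVars i)) ∪ V.image g = K ∪ V.image g := by
      rw [Finset.union_assoc]
      congr 1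
      refine Finset.union_eq_right.2 fun z hz => ?_
      obtain ⟨i, -, rfl⟩ := Finset.mem_image.1 hz
      exact Finset.mem_image_of_mem _ (hP.2 r hr _ (.inl ⟨i, rfl⟩))
    -- The renaming is extended to the values of the variables in this rule application. It keeps
    -- its values on `K` and on the arguments of the head; different applications may rename other
    -- constants differently, so room for `V.card` of them is enough.
    obtain ⟨θ', h₁, h₂, h₃⟩ := exists_injOn_extension (D := D.toFinset) hinj
      (fun z hz => List.mem_toFinset.2 (hD z hz)) (V.image g) (by
        rw [hZ]
        refine le_trans (Finset.card_union_le _ _) (le_trans ?_ hcard)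
        exact Nat.add_le_add_left Finset.card_image_le _)
    rw [hZ] at h₂ h₃
    have hθ' : ∀ k ∈ K, θ' k = ρ k := fun k hk => by
      rw [h₁ k (Finset.mem_union_left _ hk), hθ k hk]
    have hhead : (fun i => θ (g (r.headVars i))) = fun i => θ' (g (r.headVars i)) :=
      funext fun i => (h₁ _ (Finset.mem_union_right _
        (Finset.mem_image_of_mem _ (Finset.mem_univ i)))).symm
    have hCK : C ∪ V.image g ⊆ K ∪ V.image g := Finset.union_subset_union_left hC
    rw [hhead]
    refine .rule r hr (fun v => θ' (g v)) (fun v hv => List.mem_toFinset.1 (h₃ _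
      (Finset.mem_union_right _ (Finset.mem_image_of_mem _ (hP.2 r hr v hv))))) (fun l hl => ?_)
      fun S t hl => ?_
    · refine Literal.holdsEDB_injOn (Z := (K ∪ V.image g : Finset ℕ)) h₂ (fun v hv => ?_)
        (fun c hc => ?_) (fun F hF => ?_) (hE l hl)
      · exact Finset.mem_union_right _ (Finset.mem_image_of_mem _
          (hP.2 r hr v (.inr ⟨l, hl, hv⟩)))
      · have := hP.1 r hr l hl c hc
        exact ⟨Finset.mem_union_left _ (hC this), (hθ' c (hC this)).trans (hρC c this)⟩
      -- The renamed instance is the same for all extensions, because `J` lives over `K`, where they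
      -- agree with `ρ`. Injectivity then shows that no further fact over the visible constants
      -- enters it.
      · have hmap : ∀ G ∈ J, DBFact.map ρ G = DBFact.map θ' G := fun G hG =>
          DBFact.map_congr fun i => (hθ' _ (hJ G hG i)).symm
        rw [Finset.mem_image]
        constructor
        · intro h
          exact ⟨F, h, hmap F h⟩
        · rintro ⟨G, hG, h⟩
          rw [hmap G hG] at h
          have : DBFact.Over (K ∪ V.image g : Finset ℕ) G :=
            fun i => Finset.mem_union_left _ (hJ G hG i)
          rwa [← DBFact.Over.map_injOn h₂ this hF h]
    · have hev : (fun i => (t i).eval fun v => θ' (g v)) = fun i => θ' ((t i).eval g) :=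
        funext fun i => Term.eval_comp fun c hi => by
          have := hP.1 r hr _ hl c (List.mem_ofFn.2 ⟨i, hi⟩)
          exact (hθ' c (hC this)).trans (hρC c this)
      rw [hev]
      have hsub : (K ∪ Finset.univ.image fun i => (t i).eval g) ⊆ K ∪ V.image g := by
        refine Finset.union_subset Finset.subset_union_left fun z hz => ?_
        obtain ⟨i, -, rfl⟩ := Finset.mem_image.1 hz
        exact hCK (hP.eval_mem hr hl (List.mem_ofFn.2 ⟨i, rfl⟩))
      exact ih S t hl θ' hθ' (h₂.mono (Finset.coe_subset.2 hsub))
        fun z hz => List.mem_toFinset.1 (h₃ z (hsub hz))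

end StackProg

/-! ## Small models -/

namespace StackProg

open Computability

variable {σ : Schema}

/-- The atom `q` has a derivation tree of rank `n` in which each node carries its own description,
over the finite set `X`, of the facts about its constants. The description of a node has to agree
with that of its parent (with `A`, at the root) on the facts about `C` and the arguments of the
node; an element of `X` outside of `C` may stand for different constants at different nodes. -/
def Realizable (P : Program σ) (C V X : Finset ℕ) (n : ℕ) (q : Atom) (A : Instance σ) : Prop :=
  ∃ r ∈ P.rules, ∃ (g : ℕ → ℕ) (B : Instance σ),
    q = idbAtom r.head (fun i => g (r.headVars i)) ∧ (∀ v ∈ V, g v ∈ X) ∧ B ⊆ factsOver σ X ∧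
    (∀ F, DBFact.Over {z | z ∈ C ∨ z ∈ q.2} F → (F ∈ A ↔ F ∈ B)) ∧
    (∀ l ∈ r.body, l.HoldsEDB B g) ∧
    ∀ S t, Literal.idb S t ∈ r.body →
      ∃ m, ∃ _ : m < n, Realizable P C V X m (idbAtom S fun i => (t i).eval g) B
termination_by n

theorem exists_bound {α : Type} (l : List α) (p : α → ℕ → Prop) (h : ∀ a ∈ l, ∃ m, p a m) :
    ∃ n, ∀ a ∈ l, ∃ m, m < n ∧ p a m := by
  induction l with
  | nil => exact ⟨0, by simp⟩
  | cons a l ih =>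
    obtain ⟨n, hn⟩ := ih fun b hb => h b (List.mem_cons_of_mem _ hb)
    obtain ⟨m, hm⟩ := h a List.mem_cons_self
    refine ⟨max n (m + 1), fun b hb => ?_⟩
    rcases List.mem_cons.1 hb with rfl | hb
    · exact ⟨m, by lia, hm⟩
    · obtain ⟨k, hk, hk'⟩ := hn b hb
      exact ⟨k, by lia, hk'⟩

/-- Only the constants in `C` and the values of the variables matter at a node, and these can be
coloured injectively by `X`. The colouring `χ` comes from the parent and is extended afresh at each
node, retaining `C` and the arguments. -/
theorem Derives.realizable {P : Program σ} {C V X : Finset ℕ} (hP : UsesOnly P C V)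
    (hX : C.card + V.card ≤ X.card) {J : Instance σ} {S : IDB} {a : Fin S.arity → ℕ}
    (hd : Derives P J S a) (χ : ℕ → ℕ) (hχ : ∀ c ∈ C, χ c = c)
    (hinj : Set.InjOn χ (C ∪ Finset.univ.image a : Finset ℕ))
    (hχX : ∀ z ∈ C ∪ Finset.univ.image a, χ z ∈ X) (A : Instance σ)
    (hA : ∀ F, DBFact.Over (C ∪ Finset.univ.image a : Finset ℕ) F →
      (F ∈ J ↔ DBFact.map χ F ∈ A)) :
    ∃ n, Realizable P C V X n (idbAtom S fun i => χ (a i)) A := by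
  classical
  induction hd generalizing χ A with
  | rule r hr g hE hI ih =>
    have hZ : (C ∪ Finset.univ.image fun i => g (r.headVars i)) ∪ V.image g = C ∪ V.image g := by
      rw [Finset.union_assoc]
      congr 1
      refine Finset.union_eq_right.2 fun z hz => ?_
      obtain ⟨i, -, rfl⟩ := Finset.mem_image.1 hz
      exact Finset.mem_image_of_mem _ (hP.2 r hr _ (.inl ⟨i, rfl⟩))
    obtain ⟨χ', h₁, h₂, h₃⟩ := exists_injOn_extension hinj hχX (V.image g) (by
      rw [hZ]
      refine le_trans (Finset.card_union_le _ _) (le_trans ?_ hX)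
      exact Nat.add_le_add_left Finset.card_image_le _)
    have hsub : (C ∪ Finset.univ.image fun i => g (r.headVars i)) ⊆ C ∪ V.image g :=
      hZ ▸ Finset.subset_union_left
    rw [hZ] at h₂ h₃
    have hχ' : ∀ c ∈ C, χ' c = c := fun c hc => by
      rw [h₁ c (Finset.mem_union_left _ hc), hχ c hc]
    have hhead : ∀ i, χ (g (r.headVars i)) = χ' (g (r.headVars i)) := fun i =>
      (h₁ _ (Finset.mem_union_right _ (Finset.mem_image_of_mem _ (Finset.mem_univ i)))).symm
    -- The description of the node: the coloured copy of the part of `J` about the constants visible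
    -- here.
    let B : Instance σ := (J.filter (DBFact.Over (C ∪ V.image g : Finset ℕ))).image (DBFact.map χ')
    have hB : ∀ F, DBFact.Over (C ∪ V.image g : Finset ℕ) F →
        (F ∈ J ↔ DBFact.map χ' F ∈ B) := fun F hF => by
      simp only [B, Finset.mem_image, Finset.mem_filter]
      constructor
      · intro h
        exact ⟨F, ⟨h, hF⟩, rfl⟩
      · rintro ⟨G, ⟨hG, hG'⟩, h⟩
        rwa [← DBFact.Over.map_injOn h₂ hG' hF h]
    have hchild : ∀ l ∈ r.body, ∃ m, ∀ S t, l = .idb S t →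
        Realizable P C V X m (idbAtom S fun i => (t i).eval fun v => χ' (g v)) B := by
      intro l hl
      by_cases hidb : ∃ S t, l = .idb S t
      · obtain ⟨S, t, rfl⟩ := hidb
        have hev : (fun i => (t i).eval fun v => χ' (g v)) = fun i => χ' ((t i).eval g) :=
          funext fun i => Term.eval_comp fun c hi =>
            hχ' c (hP.1 r hr _ hl c (List.mem_ofFn.2 ⟨i, hi⟩))
        have hsub' : (C ∪ Finset.univ.image fun i => (t i).eval g) ⊆ C ∪ V.image g := by
          refine Finset.union_subset Finset.subset_union_left fun z hz => ?_
          obtain ⟨i, -, rfl⟩ := Finset.mem_image.1 hz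
          exact hP.eval_mem hr hl (List.mem_ofFn.2 ⟨i, rfl⟩)
        obtain ⟨m, hm⟩ := ih S t hl χ' hχ' (h₂.mono (Finset.coe_subset.2 hsub'))
          (fun z hz => h₃ z (hsub' hz)) B fun F hF => hB F fun i => hsub' (hF i)
        refine ⟨m, ?_⟩
        rintro _ _ ⟨⟩
        rw [hev]
        exact hm
      · exact ⟨0, fun S t h => absurd ⟨S, t, h⟩ hidb⟩
    obtain ⟨n, hn⟩ := exists_bound r.body _ hchild
    refine ⟨n, ?_⟩
    rw [Realizable]
    refine ⟨r, hr, fun v => χ' (g v), B, ?_, fun v hv => h₃ _ (Finset.mem_union_right _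
      (Finset.mem_image_of_mem _ hv)), fun F hF => ?_, fun F hF => ?_, fun l hl => ?_,
      fun S t hl => ?_⟩
    · rw [show (fun i => χ (g (r.headVars i))) = fun i => χ' (g (r.headVars i)) from funext hhead]
    · simp only [B, Finset.mem_image, Finset.mem_filter] at hF
      obtain ⟨G, ⟨-, hG⟩, rfl⟩ := hF
      exact mem_factsOver.2 fun i => h₃ _ (hG i)
    -- A fact over `C` and the coloured arguments is the coloured copy of a fact over the actual
    -- ones, on which `χ` and its extension agree.
    · obtain ⟨G, hG, rfl⟩ : ∃ G : DBFact σ, DBFact.Over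
          (C ∪ Finset.univ.image fun i => g (r.headVars i) : Finset ℕ) G ∧ DBFact.map χ G = F := by
        have : ∀ i, ∃ z ∈ C ∪ Finset.univ.image fun i => g (r.headVars i), χ z = F.args i := by
          intro i
          rcases hF i with h | h
          · exact ⟨_, Finset.mem_union_left _ h, hχ _ h⟩
          · obtain ⟨j, hj⟩ := List.mem_ofFn.1 h
            exact ⟨_, Finset.mem_union_right _ (Finset.mem_image_of_mem _ (Finset.mem_univ j)), hj⟩
        choose z hz hz' using this
        exact ⟨⟨F.rel, z⟩, hz, by rw [DBFact.map]; congr 1; exact funext hz'⟩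
      rw [← hA G hG, hB G fun i => hsub (hG i), DBFact.map_congr fun i => h₁ _ (hG i)]
    · refine Literal.holdsEDB_injOn (Z := (C ∪ V.image g : Finset ℕ)) h₂ (fun v hv => ?_)
        (fun c hc => ?_) hB (hE l hl)
      · exact Finset.mem_union_right _ (Finset.mem_image_of_mem _
          (hP.2 r hr v (.inr ⟨l, hl, hv⟩)))
      · have := hP.1 r hr l hl c hc
        exact ⟨Finset.mem_union_left _ this, hχ' c this⟩
    · obtain ⟨m, hm, h⟩ := hn _ hl
      exact ⟨m, hm, h S t rfl⟩

/-- Names for pairs of an element of a countable set and a colour. -/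
theorem exists_names (C : Finset ℕ) (α : Type) [Countable α] : ∃ (ν : α → ℕ → ℕ) (col : ℕ → ℕ),
    (∀ τ q, col (ν τ q) = q) ∧ (∀ c ∈ C, col c = c) ∧ (∀ τ q, ν τ q ∉ C) ∧
    ∀ τ q τ' q', ν τ q = ν τ' q' → τ = τ' := by
  obtain ⟨e, he⟩ := exists_injective_nat α
  let K := C.sup id + 1
  have hK : ∀ c ∈ C, c < K := fun c hc => Nat.lt_succ_of_le (Finset.le_sup (f := id) hc)
  refine ⟨fun τ q => K + Nat.pair (e τ) q, fun n => if n < K then n else (Nat.unpair (n - K)).2,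
    fun τ q => ?_, fun c hc => if_pos (hK c hc), fun τ q h => ?_, fun τ q τ' q' h => ?_⟩
  · simp
  · have := hK _ h
    lia
  · have h' : Nat.pair (e τ) q = Nat.pair (e τ') q' := by lia
    exact he (Nat.pair_eq_pair.1 h').1

instance : Countable (DBFact σ) := DBFact.raw_injective.countable

/-- The atoms and descriptions that may occur in `Realizable`. -/
noncomputable def types (P : Program σ) (V X : Finset ℕ) : Finset (Atom × Instance σ) :=
  (allHeads P.rules (choices V.toList X.toList)).toFinset ×ˢ (factsOver σ X).powerset

/-- An atom is determined by a rule and an assignment of `V` into `X`, a description by a set of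
facts over `X`. -/
theorem card_types_le (P : Program σ) (V X : Finset ℕ) : (types P V X).card ≤
    P.rules.length * X.card ^ V.card * 2 ^ factCount σ X.card := by
  rw [types, Finset.card_product, Finset.card_powerset]
  refine Nat.mul_le_mul ((List.toFinset_card_le _).trans ?_)
    (Nat.pow_le_pow_right (by lia) (card_factsOver_le X))
  rw [allHeads, List.length_flatMap]
  simp [length_choices]

theorem Realizable.mem_types {P : Program σ} {C V X : Finset ℕ} (hP : UsesOnly P C V) {n : ℕ}
    {q : Atom} {A : Instance σ} (hA : A ⊆ factsOver σ X) (h : Realizable P C V X n q A) :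
    (q, A) ∈ types P V X := by
  rw [Realizable] at h
  obtain ⟨r, hr, g, B, rfl, hg, -⟩ := h
  refine Finset.mem_product.2 ⟨List.mem_toFinset.2 (List.mem_flatMap.2 ⟨r, hr, List.mem_map.2
    ⟨V.toList.reverse.map fun v => (v, g v), mem_choices.2 ⟨?_, ?_⟩, ?_⟩⟩),
    Finset.mem_powerset.2 hA⟩
  · simp [Function.comp_def]
  · intro p hp
    obtain ⟨v, hv, rfl⟩ := List.mem_map.1 hp
    exact Finset.mem_toList.2 (hg v (by simpa using hv))
  · rw [headAtom_eq]
    congr 1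
    funext i
    exact fn_map _ _ (by simpa using hP.2 r hr _ (.inl ⟨i, rfl⟩))

end StackProg

/-! ## Small instances -/

namespace StackProg

open Computability

variable {σ : Schema}

/-- If an atom is realizable, then it can be derived from a small instance. -/
theorem Realizable.exists_small {P : Program σ} {C V X : Finset ℕ} (hP : UsesOnly P C V)
    (hCX : C ⊆ X) {n₀ : ℕ} {S₀ : IDB} {a₀ : Fin S₀.arity → ℕ} {A₀ : Instance σ}
    (hA₀ : A₀ ⊆ factsOver σ X) (ha₀ : ∀ i, a₀ i ∈ C)
    (h₀ : Realizable P C V X n₀ (idbAtom S₀ a₀) A₀) :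
    ∃ J : Instance σ, Derives P J S₀ a₀ ∧
      J.card ≤ factCount σ (C.card + (types P V X).card * X.card) := by
  classical
  -- The constant `ν τ q` is the one introduced at nodes of type `τ` for the colour `q`, and `col`
  -- recovers the colour while fixing `C`.
  obtain ⟨ν, col, hcol, hcolC, hνC, hν⟩ := exists_names C (Atom × Instance σ)
  let R : Atom × Instance σ → Prop := fun τ => ∃ n, Realizable P C V X n τ.1 τ.2
  let rk : Atom × Instance σ → ℕ := fun τ => sInf {n | Realizable P C V X n τ.1 τ.2}
  -- One rule, assignment and description are fixed for each realizable type, taken at its least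
  -- rank; the types of the children then have strictly smaller rank.
  have hW : ∀ τ, R τ → ∃ (g : ℕ → ℕ) (B : Instance σ), ∃ r ∈ P.rules,
      τ.1 = idbAtom r.head (fun i => g (r.headVars i)) ∧ (∀ v ∈ V, g v ∈ X) ∧
      B ⊆ factsOver σ X ∧
      (∀ F, DBFact.Over {z | z ∈ C ∨ z ∈ τ.1.2} F → (F ∈ τ.2 ↔ F ∈ B)) ∧
      (∀ l ∈ r.body, l.HoldsEDB B g) ∧
      ∀ S t, Literal.idb S t ∈ r.body → R (idbAtom S fun i => (t i).eval g, B) ∧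
        rk (idbAtom S fun i => (t i).eval g, B) < rk τ := by
    intro τ hτ
    have : Realizable P C V X (rk τ) τ.1 τ.2 := Nat.sInf_mem hτ
    rw [Realizable] at this
    obtain ⟨r, hr, g, B, h₁, h₂, h₃, h₄, h₅, h₆⟩ := this
    refine ⟨g, B, r, hr, h₁, h₂, h₃, h₄, h₅, fun S t hl => ?_⟩
    obtain ⟨m, hm, h⟩ := h₆ S t hl
    exact ⟨⟨m, h⟩, lt_of_le_of_lt (Nat.sInf_le h) hm⟩
  choose! g B hgB using hW
  let names : Finset ℕ := C ∪ (types P V X ×ˢ X).image fun p => ν p.1 p.2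
  -- Facts over `C` are read off from `A₀`. Any other fact is decided by the type of least rank
  -- among its named constants, provided that this type is unique.
  let J : Instance σ := (factsOver σ names).filter fun F => (DBFact.Over C F ∧ F ∈ A₀) ∨
    ∃ τ, (∃ i q, F.args i = ν τ q) ∧
      (∀ i τ' q, F.args i = ν τ' q → τ' = τ ∨ rk τ < rk τ') ∧ DBFact.map col F ∈ B τ
  have hJC : ∀ F, DBFact.Over C F → (F ∈ J ↔ F ∈ A₀) := by
    intro F hF
    simp only [J, Finset.mem_filter, mem_factsOver]
    constructor
    · rintro ⟨-, h | ⟨τ, ⟨i, q, h⟩, -⟩⟩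
      · exact h.2
      · exact absurd (h ▸ hF i) (hνC τ q)
    · exact fun h => ⟨fun i => Finset.mem_union_left _ (hF i), .inl ⟨hF, h⟩⟩
  have hJν : ∀ τ F, DBFact.Over names F → (∃ i q, F.args i = ν τ q) →
      (∀ i τ' q, F.args i = ν τ' q → τ' = τ ∨ rk τ < rk τ') →
      (F ∈ J ↔ DBFact.map col F ∈ B τ) := by
    intro τ F hF hτ hmin
    simp only [J, Finset.mem_filter, mem_factsOver]
    constructor
    · rintro ⟨-, h | ⟨τ', ⟨i', q', h'⟩, hmin', h⟩⟩
      · obtain ⟨i, q, hi⟩ := hτ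
        exact absurd (hi ▸ h.1 i) (hνC τ q)
      · obtain ⟨i, q, hi⟩ := hτ
        rcases hmin i' τ' q' h' with rfl | h₁
        · exact h
        · rcases hmin' i τ q hi with rfl | h₂
          · exact h
          · lia
    · exact fun h => ⟨hF, .inr ⟨τ, hτ, hmin, h⟩⟩
  -- Here `c` lists the actual arguments of a node and `t` their colours. Arguments outside `C` were
  -- introduced at ancestors, so their types have rank above `n`. The last hypothesis says that `J`
  -- agrees with the description of the parent on the facts about `C` and `c`.
  have claim : ∀ (n : ℕ) (τ : Atom × Instance σ), rk τ = n → R τ → τ.2 ⊆ factsOver σ X →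
      ∀ (S : IDB) (t c : Fin S.arity → ℕ), τ.1 = idbAtom S t → (∀ i, col (c i) = t i) →
      (∀ i, t i ∈ C → c i = t i) → (∀ i j, t i = t j → c i = c j) → (∀ i, c i ∈ names) →
      (∀ i, c i ∈ C ∨ ∃ τ' q, c i = ν τ' q ∧ n < rk τ') →
      (∀ F, DBFact.Over {z | z ∈ C ∨ ∃ i, c i = z} F → (F ∈ J ↔ DBFact.map col F ∈ τ.2)) →
      Derives P J S c := by
    intro n
    induction n using Nat.strong_induction_on with
    | _ n ih =>
    intro τ hrk hR hτX S t c hS h₁ h₂ h₃ h₄ h₅ h₆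
    obtain ⟨r, hr, hq, hgX, hBX, hagree, hE, hchild⟩ := hgB τ hR
    refine idbAtom_inj (hS.symm.trans hq) (fun S t => ∀ c : Fin S.arity → ℕ,
      (∀ i, col (c i) = t i) → (∀ i, t i ∈ C → c i = t i) → (∀ i j, t i = t j → c i = c j) →
      (∀ i, c i ∈ names) → (∀ i, c i ∈ C ∨ ∃ τ' q, c i = ν τ' q ∧ n < rk τ') →
      (∀ F, DBFact.Over {z | z ∈ C ∨ ∃ i, c i = z} F → (F ∈ J ↔ DBFact.map col F ∈ τ.2)) →
      Derives P J S c) ?_ c h₁ h₂ h₃ h₄ h₅ h₆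
    clear h₁ h₂ h₃ h₄ h₅ h₆ hS c t S
    intro c h₁ h₂ h₃ h₄ h₅ h₆
    -- The constant behind each colour at this node: elements of `C` stand for themselves, colours
    -- of arguments for the inherited constants, and the remaining colours for new constants of type
    -- `τ`. Since `col` inverts it, this map is injective.
    let dec : ℕ → ℕ := fun q => if q ∈ C then q
      else if h : ∃ i, g τ (r.headVars i) = q then c h.choose else ν τ q
    have hdC : ∀ q ∈ C, dec q = q := fun q hq => if_pos hq
    have hdt : ∀ i, dec (g τ (r.headVars i)) = c i := fun i => by
      by_cases hi : g τ (r.headVars i) ∈ C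
      · rw [hdC _ hi, h₂ i hi]
      · have hex : ∃ j, g τ (r.headVars j) = g τ (r.headVars i) := ⟨i, rfl⟩
        dsimp only [dec]
        rw [if_neg hi, dif_pos hex]
        exact h₃ _ _ hex.choose_spec
    have hcases : ∀ q, (q ∈ C ∧ dec q = q) ∨ (∃ i, q = g τ (r.headVars i) ∧ dec q = c i) ∨
        (q ∉ C ∧ (¬ ∃ i, g τ (r.headVars i) = q) ∧ dec q = ν τ q) := by
      intro q
      by_cases hqC : q ∈ C
      · exact .inl ⟨hqC, hdC q hqC⟩
      · by_cases hex : ∃ i, g τ (r.headVars i) = q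
        · obtain ⟨i, rfl⟩ := hex
          exact .inr (.inl ⟨i, rfl, hdt i⟩)
        · refine .inr (.inr ⟨hqC, hex, ?_⟩)
          dsimp only [dec]
          rw [if_neg hqC, dif_neg hex]
    have hcd : ∀ q, col (dec q) = q := by
      intro q
      rcases hcases q with ⟨hq, h⟩ | ⟨i, rfl, h⟩ | ⟨-, -, h⟩
      · rw [h, hcolC q hq]
      · rw [h, h₁]
      · rw [h, hcol]
    have hdX : ∀ q ∈ X, dec q ∈ names := by
      intro q hqX
      rcases hcases q with ⟨hq, h⟩ | ⟨i, -, h⟩ | ⟨-, -, h⟩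
      · rw [h]
        exact Finset.mem_union_left _ hq
      · rw [h]
        exact h₄ i
      · rw [h]
        obtain ⟨m, hm⟩ := hR
        exact Finset.mem_union_right _ (Finset.mem_image.2
          ⟨(τ, q), Finset.mem_product.2 ⟨hm.mem_types hP hτX, hqX⟩, rfl⟩)
    have hdν : ∀ q τ' q', dec q = ν τ' q' → τ' = τ ∨ rk τ < rk τ' := by
      intro q τ' q' e
      rcases hcases q with ⟨hq, h⟩ | ⟨i, -, h⟩ | ⟨-, -, h⟩
      · rw [← h, e] at hq
        exact absurd hq (hνC _ _)
      · rw [h] at e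
        rcases h₅ i with h' | ⟨τ'', q'', h', hlt⟩
        · exact absurd (e ▸ h') (hνC _ _)
        · right
          rw [hν _ _ _ _ (e.symm.trans h'), hrk]
          exact hlt
      · exact .inl (hν _ _ _ _ (e.symm.trans h))
    have hmap : ∀ F : DBFact σ, DBFact.map col (DBFact.map dec F) = F := fun F =>
      DBFact.map_eq_self (h := fun q => col (dec q)) (F := F) fun i => hcd _
    have key : ∀ F, DBFact.Over X F → (F ∈ B τ ↔ DBFact.map dec F ∈ J) := by
      intro F hF
      -- A fact about old constants only is handled by the agreement of `J` with the parent and of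
      -- the parent with `B τ`. A fact with a new constant belongs to `τ`, since all its other named
      -- constants have type `τ` or a type of larger rank.
      by_cases hold : ∀ i, F.args i ∈ C ∨ ∃ j, g τ (r.headVars j) = F.args i
      · rw [h₆, hmap, hagree]
        · intro i
          refine (hold i).imp id ?_
          rintro ⟨j, hj⟩
          rw [hq]
          exact List.mem_ofFn.2 ⟨j, hj⟩
        · intro i
          rcases hold i with h | ⟨j, h⟩
          · exact .inl (show dec (F.args i) ∈ C from (hdC _ h).symm ▸ h)
          · exact .inr ⟨j, ((hdt j).symm.trans (congrArg dec h))⟩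
      · push Not at hold
        obtain ⟨i, hiC, hi⟩ := hold
        rw [hJν τ (DBFact.map dec F) (fun i => hdX _ (hF i)) ?_ fun i τ' q e => hdν _ τ' q e, hmap]
        rcases hcases (F.args i) with ⟨h, -⟩ | ⟨j, h, -⟩ | ⟨-, -, h⟩
        · exact absurd h hiC
        · exact absurd h.symm (hi j)
        · exact ⟨i, _, h⟩
    have hX : ∀ v, r.HasVar v → g τ v ∈ X := fun v hv => hgX v (hP.2 r hr v hv)
    have hder : Derives P J r.head fun i => dec (g τ (r.headVars i)) := by
      refine .rule r hr (fun v => dec (g τ v)) (fun l hl => ?_) fun S t hl => ?_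
      · refine Literal.holdsEDB_injOn (Z := X)
          (fun p _ q _ e => by rw [← hcd p, e, hcd q]) (fun v hv => hX v (.inr ⟨l, hl, hv⟩))
          (fun c hc => ?_) key (hE l hl)
        have := hP.1 r hr l hl c hc
        exact ⟨hCX this, hdC c this⟩
      · have hev : (fun i => (t i).eval fun v => dec (g τ v)) =
            fun i => dec ((t i).eval (g τ)) :=
          funext fun i => Term.eval_comp fun c hi =>
            hdC c (hP.1 r hr _ hl c (List.mem_ofFn.2 ⟨i, hi⟩))
        have htX : ∀ i, (t i).eval (g τ) ∈ X := fun i => by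
          rcases Finset.mem_union.1 (hP.eval_mem (g := g τ) hr hl (List.mem_ofFn.2 ⟨i, rfl⟩))
            with h | h
          · exact hCX h
          · obtain ⟨v, hv, h⟩ := Finset.mem_image.1 h
            exact h ▸ hgX v hv
        obtain ⟨hRc, hrkc⟩ := hchild S t hl
        rw [hev]
        refine ih _ (hrk ▸ hrkc) (idbAtom S fun i => (t i).eval (g τ), B τ) rfl hRc hBX S _ _ rfl
          (fun i => hcd _) (fun i hi => hdC _ hi) (fun i j h => congrArg dec h)
          (fun i => hdX _ (htX i)) (fun i => ?_) fun F hF => ?_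
        · rcases hcases ((t i).eval (g τ)) with ⟨h, h'⟩ | ⟨j, -, h'⟩ | ⟨-, -, h'⟩
          · exact .inl (h'.symm ▸ h)
          · rw [h']
            refine (h₅ j).imp id ?_
            rintro ⟨τ', q, h, hlt⟩
            exact ⟨τ', q, h, lt_trans (hrk ▸ hrkc) hlt⟩
          · exact .inr ⟨τ, _, h', hrkc⟩
        -- For facts about `C` and the arguments of the child, `dec` inverts `col`, so `key`
        -- provides the agreement that the child requires.
        · have hFd : ∀ i, dec (col (F.args i)) = F.args i ∧ col (F.args i) ∈ X := by
            intro i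
            rcases hF i with h | ⟨j, h⟩
            · rw [hcolC _ h]
              exact ⟨hdC _ h, hCX h⟩
            · rw [← h, hcd]
              exact ⟨rfl, htX j⟩
          have hX' : DBFact.Over X (DBFact.map col F) := fun i => (hFd i).2
          rw [key _ hX']
          rw [show DBFact.map dec (DBFact.map col F) = F from
            DBFact.map_eq_self (h := fun q => dec (col q)) (F := F) fun i => (hFd i).1]
    rwa [show (fun i => dec (g τ (r.headVars i))) = c from funext hdt] at hder
  refine ⟨J, ?_, ?_⟩
  · refine claim _ (idbAtom S₀ a₀, A₀) rfl ⟨n₀, h₀⟩ hA₀ S₀ a₀ a₀ rfl (fun i => hcolC _ (ha₀ i))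
      (fun _ _ => rfl) (fun _ _ h => h) (fun i => Finset.mem_union_left _ (ha₀ i))
      (fun i => .inl (ha₀ i)) fun F hF => ?_
    have hFC : DBFact.Over C F := fun i => by
      rcases hF i with h | ⟨j, h⟩
      · exact h
      · exact h ▸ ha₀ j
    rw [hJC F hFC, DBFact.map_eq_self fun i => hcolC _ (hFC i)]
  · refine (Finset.card_filter_le _ _).trans ((card_factsOver_le _).trans (factCount_mono σ ?_))
    refine (Finset.card_union_le _ _).trans (Nat.add_le_add_left ?_ _)
    exact Finset.card_image_le.trans (Finset.card_product _ _).le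

/-- If a tuple of constants from `C` can be derived from some instance, then it can be derived from
a small one. -/
theorem Derives.exists_small {P : Program σ} {C V : Finset ℕ} (hP : UsesOnly P C V)
    {J : Instance σ} {S : IDB} {a : Fin S.arity → ℕ} (hd : Derives P J S a) (ha : ∀ i, a i ∈ C) :
    ∃ J' : Instance σ, Derives P J' S a ∧ J'.card ≤ factCount σ (C.card +
      P.rules.length * (C.card + V.card) ^ V.card * 2 ^ factCount σ (C.card + V.card) *
        (C.card + V.card)) := by
  classical
  -- The colours include `C`, so at the root, whose arguments lie in `C`, the identity is a
  -- colouring, and the description is the part of `J` over `C`.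
  obtain ⟨X, hCX, hX⟩ := Infinite.exists_superset_card_eq C (C.card + V.card) (by lia)
  have hCa : C ∪ Finset.univ.image a = C := Finset.union_eq_left.2 fun z hz => by
    obtain ⟨i, -, rfl⟩ := Finset.mem_image.1 hz
    exact ha i
  obtain ⟨n, hn⟩ := Derives.realizable (X := X) hP hX.ge hd id (fun _ _ => rfl) (Set.injOn_id _)
    (fun z hz => hCX (hCa ▸ hz)) (J.filter (DBFact.Over C)) fun F hF => by
      rw [hCa] at hF
      rw [DBFact.map_eq_self fun _ => rfl, Finset.mem_filter]
      exact ⟨fun h => ⟨h, hF⟩, fun h => h.1⟩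
  have hA : J.filter (DBFact.Over C) ⊆ factsOver σ X := fun F hF =>
    mem_factsOver.2 fun i => hCX ((Finset.mem_filter.1 hF).2 i)
  obtain ⟨J', h₁, h₂⟩ := hn.exists_small hP hCX hA ha
  refine ⟨J', h₁, h₂.trans (factCount_mono σ (Nat.add_le_add_left ?_ _))⟩
  rw [← hX]
  exact Nat.mul_le_mul_right _ (card_types_le P V X)

end StackProg

/-! ## Minimum repairs for semi-positive programs -/

namespace StackProg

open Computability

variable {σ : Schema}

/-- The number of facts in the small instances, for inputs with `n` variables and constants. -/
def smallSize (σ : Schema) (n : ℕ) : ℕ :=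
  factCount σ (n + n * (n + n) ^ n * 2 ^ factCount σ (n + n) * (n + n))

/-- A number of constants that suffices for a minimum repair. -/
def domainSize (σ : Schema) (n : ℕ) : ℕ :=
  n + (factCount σ n + (smallSize σ n + factCount σ n)) * (∑ R, σ.arity R) + n

theorem polyB_sum {α ι : Type} {m : α → ℕ} {f : ι → α → ℕ} (s : Finset ι)
    (h : ∀ i ∈ s, PolyB m (f i)) : PolyB m fun a => ∑ i ∈ s, f i a := by
  classical
  induction s using Finset.induction_on with
  | empty => exact .const 0
  | insert i s hi ih =>
    simp only [Finset.sum_insert hi]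
    exact (h i (Finset.mem_insert_self _ _)).add
      (ih fun j hj => h j (Finset.mem_insert_of_mem hj))

theorem PolyB.factCount {α : Type} {m f : α → ℕ} (h : PolyB m f) :
    PolyB m fun a => factCount σ (f a) :=
  polyB_sum _ fun R _ => h.pow (σ.arity R)

/-- All exponents that occur are polynomial in `n`, and sums, products and `factCount` are
polynomial operations. The polynomial `p` collects the exponents, with `(n + n) * n` for `(n + n) ^
n`. The shape of the bound is that of `le_card_manyNumbers`. -/
theorem exists_domainSize_le (σ : Schema) : ∃ k, ∀ n, domainSize σ n ≤ 2 ^ (n + 2) ^ k := by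
  have hn : PolyB (fun n : ℕ => n) fun n => n := .refl _
  have h₁ : PolyB (fun n : ℕ => n) fun n => (n + n) * n + StackProg.factCount σ (n + n) + n :=
    (((hn.add hn).mul hn).add (hn.add hn).factCount).add hn
  obtain ⟨p, hp⟩ := h₁
  have h₂ : PolyB (fun n : ℕ => 2 ^ p.eval n) fun n => n :=
    (PolyB.refl _).of_le fun n => le_trans (by have := hp n; lia) Nat.lt_two_pow_self.le
  have h₃ : PolyB (fun n : ℕ => 2 ^ p.eval n) fun n => (n + n) ^ n :=
    (PolyB.refl _).of_le fun n => by
      refine (Nat.pow_le_pow_left Nat.lt_two_pow_self.le n).trans ?_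
      rw [← pow_mul]
      exact Nat.pow_le_pow_right (by lia) (by have := hp n; lia)
  have h₄ : PolyB (fun n : ℕ => 2 ^ p.eval n) fun n => 2 ^ StackProg.factCount σ (n + n) :=
    (PolyB.refl _).of_le fun n => Nat.pow_le_pow_right (by lia) (by have := hp n; lia)
  have h₅ : PolyB (fun n : ℕ => 2 ^ p.eval n) (smallSize σ) :=
    (h₂.add (((h₂.mul h₃).mul h₄).mul (h₂.add h₂))).factCount
  have h₆ : PolyB (fun n : ℕ => 2 ^ p.eval n) (domainSize σ) :=
    (h₂.add (((h₂.factCount).add (h₅.add h₂.factCount)).mul (.const _))).add h₂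
  obtain ⟨q, hq⟩ := PolyB.le_two_pow (s := fun n : ℕ => n) h₆
  obtain ⟨k, hk⟩ := exists_eval_le_pow q
  exact ⟨k, fun n => (hq n).trans (Nat.pow_le_pow_right (by lia) (hk n))⟩

/-- The constants that occur in an instance. -/
def activeDomain (J : Instance σ) : Finset ℕ := J.biUnion fun F => Finset.univ.image F.args

theorem over_activeDomain {J : Instance σ} {F : DBFact σ} (hF : F ∈ J) (i : Fin (σ.arity F.rel)) :
    F.args i ∈ activeDomain J :=
  Finset.mem_biUnion.2 ⟨F, hF, Finset.mem_image_of_mem _ (Finset.mem_univ i)⟩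

theorem card_activeDomain_le (J : Instance σ) :
    (activeDomain J).card ≤ J.card * ∑ R, σ.arity R := by
  refine Finset.card_biUnion_le_card_mul _ _ _ fun F _ => Finset.card_image_le.trans ?_
  rw [Finset.card_univ, Fintype.card_fin]
  exact Finset.single_le_sum (f := fun R => σ.arity R) (fun _ _ => Nat.zero_le _)
    (Finset.mem_univ _)

/-- An instance from which a tuple can be derived can be replaced by one with constants in a
sufficiently large domain. -/
theorem Derives.exists_over {P : Program σ} {C V : Finset ℕ} (hP : UsesOnly P C V)
    {I J : Instance σ} (hI : ∀ F ∈ I, DBFact.Over C F) {S : IDB} {a : Fin S.arity → ℕ}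
    (ha : ∀ i, a i ∈ C) (hd : Derives P J S a) {D : List ℕ} (hCD : ∀ c ∈ C, c ∈ D)
    (hcard : C.card + J.card * (∑ R, σ.arity R) + V.card ≤ D.toFinset.card) :
    ∃ J' : Instance σ, (∀ F ∈ J', ∀ i, F.args i ∈ D) ∧ DerivesIn P D J' S a ∧
      ((J' \ I) ∪ (I \ J')).card ≤ ((J \ I) ∪ (I \ J)).card := by
  have hle : (C ∪ activeDomain J).card ≤ C.card + J.card * ∑ R, σ.arity R :=
    (Finset.card_union_le _ _).trans (Nat.add_le_add_left (card_activeDomain_le J) _)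
  -- The constants of the input stay fixed and the other constants of `J` are moved injectively into
  -- `D`.
  obtain ⟨ρ, h₁, h₂, h₃⟩ := exists_injOn_extension (A := C) (D := D.toFinset) (θ := id)
    (Set.injOn_id _) (fun c hc => List.mem_toFinset.2 (hCD c hc)) (activeDomain J) (by lia)
  have hJ : ∀ F ∈ J, DBFact.Over (C ∪ activeDomain J : Finset ℕ) F := fun F hF i =>
    Finset.mem_union_right _ (over_activeDomain hF i)
  have hρI : ∀ F ∈ I, DBFact.map ρ F = F := fun F hF =>
    DBFact.map_eq_self fun i => h₁ _ (hI F hF i)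
  have hK : C ∪ activeDomain J ∪ Finset.univ.image a = C ∪ activeDomain J :=
    Finset.union_eq_left.2 fun z hz => by
      obtain ⟨i, -, rfl⟩ := Finset.mem_image.1 hz
      exact Finset.mem_union_left _ (ha i)
  refine ⟨J.image (DBFact.map ρ), fun F hF i => ?_, ?_, ?_⟩
  · obtain ⟨G, hG, rfl⟩ := Finset.mem_image.1 hF
    exact List.mem_toFinset.1 (h₃ _ (hJ G hG i))
  · have := Derives.rename hP Finset.subset_union_left hJ (by lia) h₁ hd ρ (fun _ _ => rfl)
      (by rwa [hK]) fun z hz => List.mem_toFinset.1 (h₃ z (hK ▸ hz))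
    rwa [show (fun i => ρ (a i)) = a from funext fun i => h₁ _ (ha i)] at this
  -- As `ρ` fixes the facts of `I`, every fact in the new symmetric difference is the image of one
  -- in the old.
  · refine le_trans (Finset.card_le_card fun F hF => ?_)
      (Finset.card_image_le (s := (J \ I) ∪ (I \ J)) (f := DBFact.map ρ))
    simp only [Finset.mem_union, Finset.mem_sdiff, Finset.mem_image] at hF ⊢
    rcases hF with ⟨⟨G, hG, rfl⟩, hGI⟩ | ⟨hFI, hFJ⟩
    · exact ⟨G, .inl ⟨hG, fun h => hGI ((hρI G h).symm ▸ h)⟩, rfl⟩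
    · exact ⟨F, .inr ⟨hFI, fun h => hFJ ⟨F, h, hρI F hFI⟩⟩, hρI F hFI⟩

theorem length_rules_le (x : RawInput σ) : x.1.rules.length ≤ (numbers x).length := by
  have : x.1.rules.length ≤ (x.1.rules.flatMap ruleNumbers).length := by
    induction x.1.rules with
    | nil => exact le_rfl
    | cons r l ih =>
      rw [List.flatMap_cons, List.length_append, List.length_cons, ruleNumbers, List.length_cons]
      lia
  simp only [numbers, List.length_cons, List.length_append]
  lia

/-- Any repair is matched by one that is no larger and leads to an instance with at most
exponentially many facts; its constants are then renamed into the domain. -/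
theorem mem_F2EXP_spDatalog (σ : Schema) : MAmin (spDatalog σ) ∈ F2EXP := by
  obtain ⟨k, hk⟩ := exists_domainSize_le σ
  refine mem_F2EXP (k := k) fun x => ?_
  set N := numbers (MAInput.raw x) with hN
  set D := N ++ manyNumbers k N with hD
  have hND : ∀ c ∈ N, c ∈ D := fun c hc => List.mem_append_left _ hc
  refine solve_correct x (fun r hr v => mem_numbers_of_hasVar x hr)
    (hND 0 (zero_mem_numbers _)) (fun F hF i => hND _ (mem_numbers_of_mem_inst x hF i))
    fun U hU => ?_
  let C := N.toFinset
  have hC : ∀ c ∈ N, c ∈ C := fun c hc => List.mem_toFinset.2 hc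
  have hCN : C.card ≤ N.length := List.toFinset_card_le _
  have hP : UsesOnly x.prog C C :=
    ⟨fun r hr l hl c hc => hC c (mem_numbers_of_const x hr hl hc),
      fun r hr v hv => hC v (mem_numbers_of_hasVar x hr hv)⟩
  have hI : ∀ F ∈ x.inst, DBFact.Over C F := fun F hF i => hC _ (mem_numbers_of_mem_inst x hF i)
  have hIcard : x.inst.card ≤ factCount σ N.length :=
    (Finset.card_le_card fun F hF => mem_factsOver.2 (hI F hF)).trans
      ((card_factsOver_le C).trans (factCount_mono σ hCN))
  have ha : ∀ i, x.tup i ∈ C := fun i => hC _ (mem_numbers_of_tup x i)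
  have hDcard : domainSize σ N.length ≤ D.toFinset.card := by
    refine (hk _).trans ((le_card_manyNumbers k N).trans (Finset.card_le_card fun n hn => ?_))
    rw [List.mem_toFinset] at hn ⊢
    exact List.mem_append_right _ hn
  have hsmall : ∃ J : Instance σ, Derives x.prog J x.prog.ans x.tup ∧
      ((J \ x.inst) ∪ (x.inst \ J)).card ≤ U.size ∧
      J.card ≤ factCount σ N.length + (smallSize σ N.length + factCount σ N.length) := by
    -- A repair below the threshold inserts few facts, so the instance it leads to is small. Above
    -- the threshold it costs no more to delete as much of the given instance as necessary and to
    -- install a small one: `smallSize` bounds the insertions, `factCount` the deletions.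
    by_cases hUs : U.size ≤ smallSize σ N.length + factCount σ N.length
    · refine ⟨U.apply x.inst, hU.2, Finset.card_le_card fun F hF => ?_, ?_⟩
      · simp only [Update.apply, Finset.mem_union, Finset.mem_sdiff] at hF ⊢
        tauto
      · refine (Finset.card_le_card Finset.sdiff_subset).trans
          ((Finset.card_union_le _ _).trans (Nat.add_le_add hIcard ?_))
        exact (Finset.card_le_card Finset.subset_union_left).trans hUs
    · obtain ⟨J, hJ, hJcard⟩ := Derives.exists_small hP hU.2 ha
      have hJs : J.card ≤ smallSize σ N.length := by
        refine hJcard.trans (factCount_mono σ ?_)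
        have h₁ : (C.card + C.card) ^ C.card ≤ (N.length + N.length) ^ N.length := by
          rcases Nat.eq_zero_or_pos (N.length + N.length) with h | h
          · simp [show N.length = 0 by lia, show C.card = 0 by lia]
          · exact (Nat.pow_le_pow_left (by lia) _).trans (Nat.pow_le_pow_right h hCN)
        have h₂ : 2 ^ factCount σ (C.card + C.card) ≤ 2 ^ factCount σ (N.length + N.length) :=
          Nat.pow_le_pow_right (by lia) (factCount_mono σ (by lia))
        exact Nat.add_le_add hCN (Nat.mul_le_mul (Nat.mul_le_mul (Nat.mul_le_mul
          (length_rules_le (MAInput.raw x)) h₁) h₂) (by lia))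
      refine ⟨J, hJ, ?_, by lia⟩
      have h₁ := Finset.card_union_le (J \ x.inst) (x.inst \ J)
      have h₂ := Finset.card_le_card (Finset.sdiff_subset : J \ x.inst ⊆ J)
      have h₃ := Finset.card_le_card (Finset.sdiff_subset : x.inst \ J ⊆ x.inst)
      lia
  obtain ⟨J, hJ, hJU, hJcard⟩ := hsmall
  obtain ⟨J', h₁, h₂, h₃⟩ := Derives.exists_over hP hI ha hJ
    (fun c hc => hND c (List.mem_toFinset.1 hc)) (by
      refine le_trans ?_ hDcard
      exact Nat.add_le_add (Nat.add_le_add hCN (Nat.mul_le_mul_right _ hJcard)) hCN)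
  exact ⟨J', h₁, h₂, h₃.trans hJU⟩

end StackProg

theorem mainTheorem8 (σ : Schema) :
    MAmin (Datalog σ) ∈ FEXP ∧ MAmin (spDatalog σ) ∈ F2EXP :=
  ⟨StackProg.mem_FEXP_datalog σ, StackProg.mem_F2EXP_spDatalog σ⟩
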